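/- **Setting.** Let $2\le k\le\infty$, and let $N=\{\rho<0\}\subset\mathbb C^n$ be a bounded domain with boundary of class $C^k$, where $\rho:\mathbb C^n\to\mathbb R$ is of class $C^k$ and $d\rho\ne0$ on $\partial N$. Suppose that $N$ is strictly (Levi) pseudoconvex: at every $p\in\partial N$, $$\sum_{j,l=1}^n\frac{\partial^2\rho}{\partial z_j\,\partial\bar z_l}(p)\,w_j\bar w_l>0\quad\text{for all } w\in\mathbb C^n\setminus\{0\}\text{ with }\sum_{j=1}^n\frac{\partial\rho}{\partial z_j}(p)\,w_j=0 .$$ Let $D\subset\mathbb C$ be the open unit disk, and let $f:\overline D\to\mathbb C^n$ be smooth up to the boundary, with $f(D)\subset N$ and $f(\partial D)\subset\partial N$. The $\bar\partial$-energy is $E''(f)=\int_D|\partial f/\partial\bar z|^2\,dx\,dy$. A *variation* of $f$ is a family of maps $f_t:\overline D\to\mathbb C^n$, $|t|<\varepsilon$, of class $C^k$ in $(t,z)$, with $f_0=f$, $f_t(D)\subset N$ and $f_t(\partial D)\subset\partial N$. The map $f$ is a *critical point* of $E''$ if $\frac{d}{dt}\big|_{t=0}E''(f_t)=0$ for every variation.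 A *variation field* along $f$ is a smooth map $V:\overline D\to\mathbb C^n$ such that $V(z)$ is tangent to $\partial N$ at $f(z)$ for every $z\in\partial D$. With $\langle\cdot,\cdot\rangle$ the real inner product of $\mathbb C^n=\mathbb R^{2n}$, $J$ multiplication by $i$, and $\nu$ the outward unit normal of $\partial N$, the second variation of $E''$ at a critical point $f$ is the index form $$I(V,V)=\frac12\Big[\int_D\big(|V_x|^2+|V_y|^2\big)dx\,dy+\int_{\partial D}\Big\langle\nabla_VV,\frac{\partial f}{\partial r}+J\frac{\partial f}{\partial\theta}\Big\rangle d\theta+\int_{\partial D}\Big\langle J\frac{\partial V}{\partial\theta},V\Big\rangle d\theta\Big],$$ where, since $\frac{\partial f}{\partial r}+J\frac{\partial f}{\partial\theta}$ is normal to $\partial N$ at a critical point, the middle integrand is $\langle\nabla_VV,\nu\rangle\,\langle\frac{\partial f}{\partial r}+J\frac{\partial f}{\partial\theta},\nu\rangle$, with $\langle\nabla_VV,\nu\rangle=-D^2\rho(V,V)/|\nabla\rho|$. The *Morse index* of $f$ is the maximal real dimension (possibly $\infty$) of a space of variation fields on which $I$ is negative definite, and $f$ is *stable* if $I(V,V)\ge0$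 for every variation field $V$. **Theorem 1.2.** Suppose that $f$ is a critical point of the $\bar\partial$-energy. 1. If $f$ is not holomorphic on $D$, then its Morse index for the $\bar\partial$-energy is at least $n-1$. 2. In particular, if $n\ge2$ and $f$ is stable, then $f$ is holomorphic. 3. If $n\ge2$ and $f$ is minimizing, in the sense that for every variation $f_t$ one has $E''(f)\le E''(f_t)$ for all sufficiently small $|t|$, then $f$ is holomorphic. -/

import Mathlib

open scoped ContDiff Topology

noncomputable section

namespace DbarDisk

/-- `ℂⁿ` with its standard Hermitian (hence Euclidean) norm. -/
abbrev Cn (n : ℕ) : Type := EuclideanSpace ℂ (Fin n)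

/-! ### Strictly pseudoconvex domains -/

/-- The `j`-th vector of the standard complex basis of `ℂⁿ`. -/
def basisVec {n : ℕ} (j : Fin n) : Cn n := EuclideanSpace.single j (1 : ℂ)

/-- The Wirtinger derivative `∂u/∂z_j = (∂u/∂x_j - i ∂u/∂y_j) / 2` on `ℂⁿ`. -/
def wirtinger {n : ℕ} (j : Fin n) (u : Cn n → ℂ) (p : Cn n) : ℂ :=
  (1 / 2 : ℂ) * (fderiv ℝ u p (basisVec j)
    - Complex.I * fderiv ℝ u p (Complex.I • basisVec j))

/-- The Wirtinger derivative `∂u/∂z̄_j = (∂u/∂x_j + i ∂u/∂y_j) / 2` on `ℂⁿ`. -/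
def wirtingerBar {n : ℕ} (j : Fin n) (u : Cn n → ℂ) (p : Cn n) : ℂ :=
  (1 / 2 : ℂ) * (fderiv ℝ u p (basisVec j)
    + Complex.I * fderiv ℝ u p (Complex.I • basisVec j))

/-- The Levi form `∑_{j,k} ∂²ρ/∂z_j∂z̄_k (p) w_j w̄_k`
(for a real `ρ` of class `C²` this complex number is real). -/
def leviForm {n : ℕ} (ρ : Cn n → ℝ) (p w : Cn n) : ℂ :=
  ∑ j, ∑ k, wirtinger j (wirtingerBar k (fun q => (ρ q : ℂ))) p
    * w j * (starRingEnd ℂ) (w k)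

/-- `N` is a bounded domain in `ℂⁿ` with boundary of class `C^k`, `ρ : ℂⁿ → ℝ` is a defining
function of class `C^k` for it, and `N` is strictly Levi pseudoconvex. -/
structure IsStrictlyPseudoconvex {n : ℕ} (k : ℕ∞) (N : Set (Cn n)) (ρ : Cn n → ℝ) : Prop where
  connected : IsConnected N
  bounded : Bornology.IsBounded N
  contDiff : ContDiff ℝ k ρ
  eq_sublevel : N = {p | ρ p < 0}
  fderiv_ne_zero : ∀ p ∈ frontier N, fderiv ℝ ρ p ≠ 0
  levi_pos : ∀ p ∈ frontier N, ∀ w : Cn n, w ≠ 0 →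
    ∑ j, wirtinger j (fun q => (ρ q : ℂ)) p * w j = 0 → 0 < (leviForm ρ p w).re

/-! ### Disks and their `∂̄`-energy -/

/-- The closed unit disk. Only the values of a map `ℂ → ℂⁿ` on this set are relevant below. -/
abbrev disk : Set ℂ := Metric.closedBall (0 : ℂ) 1

/-- The derivative of `f` at `z ∈ disk` in the direction `v` (one-sided on the boundary). -/
def dirDeriv {n : ℕ} (f : ℂ → Cn n) (z v : ℂ) : Cn n := fderivWithin ℝ f disk z v

/-- `∂f/∂z̄ = (∂f/∂x + i ∂f/∂y) / 2`. -/
def dbar {n : ℕ} (f : ℂ → Cn n) (z : ℂ) : Cn n :=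
  (1 / 2 : ℂ) • (dirDeriv f z 1 + Complex.I • dirDeriv f z Complex.I)

/-- The `∂̄`-energy `E''(f) = ∫_D |∂f/∂z̄|² dx dy`. -/
def dbarEnergy {n : ℕ} (f : ℂ → Cn n) : ℝ :=
  ∫ z in Metric.ball (0 : ℂ) 1, ‖dbar f z‖ ^ 2

/-- `f` maps the open disk into `N` and the unit circle into the boundary of `N`. -/
def IsDiskIn {n : ℕ} (N : Set (Cn n)) (f : ℂ → Cn n) : Prop :=
  Set.MapsTo f (Metric.ball (0 : ℂ) 1) N ∧ Set.MapsTo f (Metric.sphere (0 : ℂ) 1) (frontier N)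

/-- `F` is a deformation of `f`, of class `C^k` in `(t, z)`, through disks in `N` with boundary
in `∂N`. -/
def IsVariation {n : ℕ} (k : ℕ∞) (N : Set (Cn n)) (f : ℂ → Cn n) (F : ℝ → ℂ → Cn n) : Prop :=
  Set.EqOn (F 0) f disk ∧
  ∃ ε > 0, ContDiffOn ℝ k (Function.uncurry F) (Set.Ioo (-ε) ε ×ˢ disk) ∧
    ∀ t ∈ Set.Ioo (-ε) ε, IsDiskIn N (F t)

/-- `f` is a critical point of the `∂̄`-energy. -/
def IsDbarCritical {n : ℕ} (k : ℕ∞) (N : Set (Cn n)) (f : ℂ → Cn n) : Prop :=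
  ∀ F : ℝ → ℂ → Cn n, IsVariation k N f F → HasDerivAt (fun t => dbarEnergy (F t)) 0 0

/-- `f` minimizes the `∂̄`-energy along each of its deformations, for small times. (Every map that
minimizes the energy among the nearby disks, or in its homotopy class, has this property.) -/
def IsDbarMinimizing {n : ℕ} (k : ℕ∞) (N : Set (Cn n)) (f : ℂ → Cn n) : Prop :=
  ∀ F : ℝ → ℂ → Cn n, IsVariation k N f F → ∀ᶠ t in 𝓝 (0 : ℝ), dbarEnergy f ≤ dbarEnergy (F t)

/-! ### Second variation -/

/-- `V` is a variation field along `f`: smooth on the closed disk, and tangent to `∂N` along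
`∂D`. -/
def IsVariationField {n : ℕ} (ρ : Cn n → ℝ) (f V : ℂ → Cn n) : Prop :=
  ContDiffOn ℝ ∞ V disk ∧ ∀ z ∈ Metric.sphere (0 : ℂ) 1, fderiv ℝ ρ (f z) (V z) = 0

/-- `⟨∇_v v, ν⟩` for `v` tangent at `p` to the hypersurface `{ρ = 0}` with unit normal
`ν = ∇ρ / |∇ρ|`. Differentiating `dρ(v) = 0` along `v` gives `⟨∇_v v, ∇ρ⟩ = -D²ρ(v, v)`. -/
def normalAccel {n : ℕ} (ρ : Cn n → ℝ) (p v : Cn n) : ℝ :=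
  -(fderiv ℝ (fderiv ℝ ρ) p v v) / ‖fderiv ℝ ρ p‖

/-- `⟨w, ν⟩`, where `ν = ∇ρ / |∇ρ|`. -/
def normalComponent {n : ℕ} (ρ : Cn n → ℝ) (p w : Cn n) : ℝ :=
  fderiv ℝ ρ p w / ‖fderiv ℝ ρ p‖

/-- `∂f/∂r + J ∂f/∂θ` at a point `z` of the unit circle. -/
def boundaryField {n : ℕ} (f : ℂ → Cn n) (z : ℂ) : Cn n :=
  dirDeriv f z z + Complex.I • dirDeriv f z (Complex.I * z)

/-- The index form of the `∂̄`-energy at a critical disk `f` (the metric of `ℂⁿ` is flat),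
`I(V,V) = ½ (∫_D |∇V|² dx dy + ∫_∂D ⟨∇_V V, ∂f/∂r + J ∂f/∂θ⟩ dθ + ∫_∂D ⟨J ∂V/∂θ, V⟩ dθ)`.
At a critical disk `∂f/∂r + J ∂f/∂θ` is normal to `∂N`, so that the second integrand is the product
of the normal components of its two factors. -/
def indexForm {n : ℕ} (ρ : Cn n → ℝ) (f V : ℂ → Cn n) : ℝ :=
  (1 / 2 : ℝ) *
    ((∫ z in Metric.ball (0 : ℂ) 1,
        (‖dirDeriv V z 1‖ ^ 2 + ‖dirDeriv V z Complex.I‖ ^ 2))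
    + (∫ θ in (0 : ℝ)..(2 * Real.pi),
        normalAccel ρ (f (circleMap 0 1 θ)) (V (circleMap 0 1 θ))
          * normalComponent ρ (f (circleMap 0 1 θ)) (boundaryField f (circleMap 0 1 θ)))
    + (∫ θ in (0 : ℝ)..(2 * Real.pi),
        inner ℝ
          (Complex.I • dirDeriv V (circleMap 0 1 θ) (Complex.I * circleMap 0 1 θ))
          (V (circleMap 0 1 θ))))

/-- `W` is a space of variation fields along `f` on which the index form is negative definite. -/
def IsNegativeDefiniteOn {n : ℕ} (ρ : Cn n → ℝ) (f : ℂ → Cn n)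
    (W : Submodule ℝ (ℂ → Cn n)) : Prop :=
  ∀ V ∈ W, IsVariationField ρ f V ∧ (V ≠ 0 → indexForm ρ f V < 0)

/-- The Morse index: the supremum of the dimensions of the spaces of variation fields on which the
index form is negative definite. -/
def morseIndex {n : ℕ} (ρ : Cn n → ℝ) (f : ℂ → Cn n) : ℕ∞ :=
  ⨆ W : {W : Submodule ℝ (ℂ → Cn n) // FiniteDimensional ℝ W ∧ IsNegativeDefiniteOn ρ f W},
    (Module.finrank ℝ W.1 : ℕ∞)

/-- `f` is stable: the index form is nonnegative on all variation fields. -/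
def IsDbarStable {n : ℕ} (ρ : Cn n → ℝ) (f : ℂ → Cn n) : Prop :=
  ∀ V : ℂ → Cn n, IsVariationField ρ f V → 0 ≤ indexForm ρ f V

end DbarDisk

end

noncomputable section

namespace DbarDisk

open Complex Set Metric MeasureTheory

/-! ### The closed unit disk -/

/-! Write P = ∂f/∂z̄; `inner ℂ` is conjugate linear in its first slot. Compactly supported
variations show that P is antiholomorphic (`IsDbarCritical.isAntiholomorphic`). Variations supported
near a boundary point, made by pushing points along a fixed direction back to their level of ρ
(`exists_local_variation`), show that on the circle z̄P is a real multiple μ of the gradient of ρ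
(`exists_multiplier`).

The sign of μ comes from the Hopf differential. The function ⟨P, ∂f/∂z⟩ is holomorphic, and z² times
it is real on the circle by the boundary condition; Cauchy's theorem applied to its square forces it
to vanish there. This gives |P|² = μ dρ(∂f/∂r) (`normSq_dbar_eq`). As f maps the disk into N, the
radial derivative of ρ∘f is nonnegative, so μ ≥ 0, with μ > 0 wherever P ≠ 0 (`multiplier_nonneg`).

If f is not holomorphic, then b = P(z₀) ≠ 0 for some boundary point z₀, by the maximum principle.
For c orthogonal to b the field V_c = ⟨P, b⟩c − ⟨P, c⟩b is holomorphic and orthogonal to P, hence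
tangent to ∂N together with iV_c. On holomorphic fields the Dirichlet term and the term ⟨J ∂V/∂θ, V⟩
cancel, and the index form is a nonpositive multiple of the real Hessian of ρ integrated over the
circle. Adding its values at V_c and iV_c turns the Hessian into the Levi form, so the sum is
negative for c ≠ 0. A real quadratic form with this property on a complex space of dimension n − 1
is negative definite on a real subspace of dimension at least n − 1 (`exists_negativeDefinite`). A
stable disk has index 0, which settles the second claim.

For the third claim actual variations are needed. A cutoff near z₀ and the correction along a fixed
direction produce them but destroy holomorphy. The remedy is to multiply the field by τz^(m+1). On
the circle the Levi form does not see a factor of modulus one, so the negative boundary term, summed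
over τ = 1 and τ = i, does not depend on m. Inside, the field concentrates at the circle and its
∂̄-energy tends to 0 (`tendsto_dbarEnergy_powField`). For large m the energy would decrease to
second order, against minimality. -/

lemma ball_subset_disk : ball (0 : ℂ) 1 ⊆ disk := ball_subset_closedBall

lemma sphere_subset_disk : sphere (0 : ℂ) 1 ⊆ disk := sphere_subset_closedBall

lemma disk_mem_nhds {z : ℂ} (hz : z ∈ ball (0 : ℂ) 1) : disk ∈ 𝓝 z :=
  Filter.mem_of_superset (isOpen_ball.mem_nhds hz) ball_subset_disk

lemma convex_disk : Convex ℝ disk := convex_closedBall 0 1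

lemma isCompact_disk : IsCompact disk := isCompact_closedBall 0 1

lemma uniqueDiffOn_disk : UniqueDiffOn ℝ disk :=
  uniqueDiffOn_convex convex_disk <| by
    rw [interior_closedBall _ one_ne_zero]; exact ⟨0, by simp⟩

lemma circleMap_mem_sphere_one (θ : ℝ) : circleMap 0 1 θ ∈ sphere (0 : ℂ) 1 :=
  circleMap_mem_sphere 0 zero_le_one θ

lemma circleMap_mem_disk (θ : ℝ) : circleMap 0 1 θ ∈ disk :=
  sphere_subset_disk (circleMap_mem_sphere_one θ)

lemma continuous_comp_circleMap {X : Type*} [TopologicalSpace X] {g : ℂ → X}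
    (hg : ContinuousOn g (sphere (0 : ℂ) 1)) : Continuous fun θ : ℝ => g (circleMap 0 1 θ) :=
  hg.comp_continuous (continuous_circleMap 0 1) circleMap_mem_sphere_one

section Calculus

variable {E : Type*} [NormedAddCommGroup E] [NormedSpace ℝ E]

lemma fderivWithin_disk {h : ℂ → E} {z : ℂ} (hz : z ∈ ball (0 : ℂ) 1) :
    fderivWithin ℝ h disk z = fderiv ℝ h z :=
  fderivWithin_of_mem_nhds (disk_mem_nhds hz)

lemma differentiableAt_of_mem_ball {h : ℂ → E} {m : WithTop ℕ∞} (hm : m ≠ 0)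
    (hh : ContDiffOn ℝ m h disk) {z : ℂ} (hz : z ∈ ball (0 : ℂ) 1) : DifferentiableAt ℝ h z :=
  (hh.differentiableOn hm).differentiableAt (disk_mem_nhds hz)

omit [NormedSpace ℝ E] in
lemma integrableOn_ball_of_continuousOn {h : ℂ → E} (hh : ContinuousOn h disk) :
    IntegrableOn h (ball (0 : ℂ) 1) :=
  (hh.integrableOn_compact isCompact_disk).mono_set ball_subset_disk

lemma intervalIntegral_circle_eq {g : ℂ → E} :
    ∫ θ in (0 : ℝ)..2 * Real.pi, g (circleMap 0 1 θ)
      = ∫ θ in (-Real.pi)..Real.pi, g (circleMap 0 1 θ) := by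
  have hp : Function.Periodic (fun θ : ℝ => g (circleMap 0 1 θ)) (2 * Real.pi) := fun θ => by
    simp only [periodic_circleMap 0 1 θ]
  have := hp.intervalIntegral_add_eq 0 (-Real.pi)
  rw [zero_add] at this
  rw [this]; congr 1; ring

end Calculus

/-! ### Polar coordinates and the Cauchy–Pompeiu formula -/

lemma integral_ball_eq_integral_rect (h : ℂ → ℂ) :
    ∫ z in ball (0 : ℂ) 1, h z =
      ∫ p in Icc ((0 : ℝ), -Real.pi) (1, Real.pi), p.1 • h (p.1 * cexp (p.2 * I)) := by
  have hsym : ∀ p : ℝ × ℝ, Complex.polarCoord.symm p = p.1 * cexp (p.2 * I) := fun p => by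
    rw [Complex.polarCoord_symm_apply, Complex.exp_mul_I]
    simp
  rw [← integral_indicator measurableSet_ball, ← Complex.integral_comp_polarCoord_symm]
  have hset : (Icc ((0 : ℝ), -Real.pi) (1, Real.pi) : Set (ℝ × ℝ))
      =ᵐ[volume] (Ioo (0 : ℝ) 1 ×ˢ Ioo (-Real.pi) Real.pi : Set (ℝ × ℝ)) := by
    rw [Icc_prod_eq]
    exact Measure.set_prod_ae_eq Ioo_ae_eq_Icc.symm Ioo_ae_eq_Icc.symm
  rw [setIntegral_congr_set hset]
  have hsub : (Ioo (0 : ℝ) 1 ×ˢ Ioo (-Real.pi) Real.pi : Set (ℝ × ℝ)) ⊆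
      polarCoord.target := by
    rw [polarCoord_target]
    exact prod_mono (fun x hx => hx.1) subset_rfl
  rw [setIntegral_eq_of_subset_of_forall_sdiff_eq_zero
    polarCoord.open_target.measurableSet hsub]
  · refine setIntegral_congr_fun (measurableSet_Ioo.prod measurableSet_Ioo) fun p hp => ?_
    have : Complex.polarCoord.symm p ∈ ball (0 : ℂ) 1 := by
      rw [mem_ball_zero_iff, Complex.norm_polarCoord_symm, abs_of_pos hp.1.1]
      exact hp.1.2
    simp only [indicator_of_mem this]
    rw [hsym]
  · rintro p ⟨hp, hp'⟩
    rw [polarCoord_target] at hp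
    have : Complex.polarCoord.symm p ∉ ball (0 : ℂ) 1 := by
      rw [mem_ball_zero_iff, Complex.norm_polarCoord_symm, abs_of_pos hp.1]
      exact fun h => hp' ⟨⟨hp.1, h⟩, hp.2⟩
    simp only [indicator_of_notMem this, smul_zero]

/-- The Cauchy–Pompeiu formula for the unit disk. -/
theorem integral_ball_wirtingerBar {h : ℂ → ℂ} (hh : ContDiffOn ℝ 1 h disk) :
    ∫ z in ball (0 : ℂ) 1, (fderivWithin ℝ h disk z 1 + I * fderivWithin ℝ h disk z I)
      = ∫ θ in (0 : ℝ)..2 * Real.pi, circleMap 0 1 θ * h (circleMap 0 1 θ) := by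
  set D := fderivWithin ℝ h disk with hD
  have hDc : ContinuousOn D disk := hh.continuousOn_fderivWithin uniqueDiffOn_disk le_rfl
  set pc : ℝ × ℝ → ℂ := fun p => p.1 * cexp (p.2 * I) with hpc
  set ex : ℝ × ℝ → ℂ := fun p => cexp (p.2 * I) with hex
  have hnorm : ∀ p : ℝ × ℝ, ‖pc p‖ = |p.1| := fun p => by
    simp [hpc, Complex.norm_exp_ofReal_mul_I]
  have hpcc : Continuous pc := by fun_prop
  have hexc : Continuous ex := by fun_prop
  have hmaps : MapsTo pc (Icc ((0 : ℝ), -Real.pi) (1, Real.pi)) disk := fun p hp => by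
    rw [mem_closedBall_zero_iff, hnorm, abs_of_nonneg hp.1.1]; exact hp.2.1
  have hmaps' : ∀ p ∈ Ioo (0 : ℝ) 1 ×ˢ Ioo (-Real.pi) Real.pi, pc p ∈ ball (0 : ℂ) 1 :=
    fun p hp => by rw [mem_ball_zero_iff, hnorm, abs_of_pos hp.1.1]; exact hp.1.2
  let dr : ℝ × ℝ →L[ℝ] ℂ := ofRealCLM.comp (ContinuousLinearMap.fst ℝ ℝ ℝ)
  let dθ : ℝ × ℝ →L[ℝ] ℂ := ofRealCLM.comp (ContinuousLinearMap.snd ℝ ℝ ℝ)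
  have hex' : ∀ p, HasFDerivAt ex (ex p • (I • dθ)) p := fun p => by
    have h1 : HasFDerivAt (fun p : ℝ × ℝ => ((p.2 : ℝ) : ℂ) * I) (I • dθ) p :=
      (dθ.hasFDerivAt (x := p)).mul_const' I |>.congr_fderiv (by ext <;> simp)
    exact h1.cexp
  have hpc' : ∀ p, HasFDerivAt pc (ex p • dr + (pc p * I) • dθ) p := fun p => by
    have := (dr.hasFDerivAt (x := p)).mul (hex' p)
    refine this.congr_fderiv ?_
    ext <;> simp [dr, dθ, hpc, hex]
    ring
  have hcomp : ∀ p ∈ Ioo (0 : ℝ) 1 ×ˢ Ioo (-Real.pi) Real.pi,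
      HasFDerivAt (fun p => h (pc p)) ((D (pc p)).comp (ex p • dr + (pc p * I) • dθ)) p := by
    intro p hp
    have h1 : HasFDerivAt h (D (pc p)) (pc p) := by
      rw [hD, fderivWithin_disk (hmaps' p hp)]
      exact (differentiableAt_of_mem_ball one_ne_zero hh (hmaps' p hp)).hasFDerivAt
    exact h1.comp p (hpc' p)
  -- The polar form of ∂h/∂x + i ∂h/∂y is e^{iθ}(∂h/∂r + (i/r) ∂h/∂θ). Multiplied by the Jacobian r
  -- it is the divergence of (r e^{iθ} h, i e^{iθ} h), which is continuous up to r = 0, so no small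
  -- disk around the origin has to be removed.
  have key := integral_divergence_prod_Icc_of_hasFDerivAt_of_le
    (fun p => pc p * h (pc p)) (fun p => I * ex p * h (pc p))
    (fun p => pc p • ((D (pc p)).comp (ex p • dr + (pc p * I) • dθ))
      + h (pc p) • (ex p • dr + (pc p * I) • dθ))
    (fun p => (I * ex p) • ((D (pc p)).comp (ex p • dr + (pc p * I) • dθ))
      + h (pc p) • (I • (ex p • (I • dθ))))
    ((0 : ℝ), -Real.pi) (1, Real.pi) ⟨zero_le_one, by linarith [Real.pi_pos]⟩
    (hpcc.continuousOn.mul (hh.continuousOn.comp hpcc.continuousOn hmaps))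
    ((continuous_const.mul hexc).continuousOn.mul
      (hh.continuousOn.comp hpcc.continuousOn hmaps))
    (fun p hp => (hpc' p).mul (hcomp p hp))
    (fun p hp => ((hex' p).const_mul I).mul (hcomp p hp))
  have hsimp : ∀ p : ℝ × ℝ,
      (pc p • ((D (pc p)).comp (ex p • dr + (pc p * I) • dθ))
        + h (pc p) • (ex p • dr + (pc p * I) • dθ)) (1, 0)
      + ((I * ex p) • ((D (pc p)).comp (ex p • dr + (pc p * I) • dθ))
        + h (pc p) • (I • (ex p • (I • dθ)))) (0, 1)
      = p.1 • (D (pc p) 1 + I * D (pc p) I) := by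
    intro p
    have e1 : ex p = Real.cos p.2 + Real.sin p.2 * I := by
      simp [hex, Complex.exp_mul_I]
    have hl : ∀ (L : ℂ →L[ℝ] ℂ) (a b : ℝ), L (a + b * I) = a * L 1 + b * L I := fun L a b => by
      have : (a + b * I : ℂ) = a • (1 : ℂ) + b • I := by simp
      rw [this, map_add, map_smul, map_smul]; simp
    have e2 : D (pc p) (ex p) = Real.cos p.2 * D (pc p) 1 + Real.sin p.2 * D (pc p) I := by
      rw [e1, hl]
    have e3 : D (pc p) (pc p * I)
        = (-(p.1 * Real.sin p.2) : ℝ) * D (pc p) 1 + (p.1 * Real.cos p.2 : ℝ) * D (pc p) I := by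
      rw [← hl]; congr 1
      change p.1 * ex p * I = _
      rw [e1]; push_cast; ring_nf; simp only [I_sq]; ring
    have hcs : (Real.cos p.2 : ℂ) ^ 2 + (Real.sin p.2 : ℂ) ^ 2 = 1 := by
      exact_mod_cast Real.cos_sq_add_sin_sq p.2
    have e0 : pc p = p.1 * ex p := rfl
    simp only [add_apply, smul_apply,
      ContinuousLinearMap.comp_apply, smul_eq_mul, dr, dθ, ContinuousLinearMap.coe_fst',
      ContinuousLinearMap.coe_snd', ofRealCLM_apply, ofReal_one, ofReal_zero, mul_one, mul_zero,
      add_zero, zero_add, e2, e3, real_smul]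
    push_cast [e1] at *
    generalize D (pc p) 1 = d1 at *
    generalize D (pc p) I = d2 at *
    generalize h (pc p) = w at *
    rw [e0, e1]
    generalize (Complex.cos (p.2 : ℂ)) = c at *
    generalize (Complex.sin (p.2 : ℂ)) = s at *
    linear_combination (p.1 * (d1 + I * d2)) * hcs +
      (p.1 * (c * s * d2 - s ^ 2 * d1) + w * (c + s * I)) * I_sq
  rw [setIntegral_congr_fun measurableSet_Icc (fun p _ => hsimp p)] at key
  rw [integral_ball_eq_integral_rect, intervalIntegral_circle_eq (g := fun z => z * h z)]
  have hi : IntegrableOn (fun p : ℝ × ℝ => p.1 • (D (pc p) 1 + I * D (pc p) I))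
      (Icc ((0 : ℝ), -Real.pi) (1, Real.pi)) := by
    have hDp : ContinuousOn (fun p => D (pc p)) (Icc ((0 : ℝ), -Real.pi) (1, Real.pi)) :=
      hDc.comp hpcc.continuousOn hmaps
    refine ContinuousOn.integrableOn_compact isCompact_Icc ?_
    exact continuous_fst.continuousOn.smul ((hDp.clm_apply continuousOn_const).add
      (continuousOn_const.mul (hDp.clm_apply continuousOn_const)))
  refine (key ?_).trans ?_
  · exact hi.congr_fun (fun p _ => (hsimp p).symm) measurableSet_Icc
  -- The sides θ = ±π cancel by periodicity and the side r = 0 carries the factor r; only r = 1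
  -- remains.
  · have h1 : ∀ x : ℝ, pc (x, Real.pi) = pc (x, -Real.pi) := fun x => by
      simp [hpc, Complex.exp_pi_mul_I, Complex.exp_neg]
    have h2 : ∀ x : ℝ, ex (x, Real.pi) = ex (x, -Real.pi) := fun x => by
      simp [hex, Complex.exp_pi_mul_I, Complex.exp_neg]
    simp only [h1, h2, sub_self, zero_add]
    simp [hpc, circleMap]

end DbarDisk

namespace DbarDisk

open Complex Set Metric MeasureTheory

variable {n : ℕ}

lemma inner_real_eq_re (x y : Cn n) : inner ℝ x y = (inner ℂ x y).re := by
  simp only [PiLp.inner_apply, Complex.re_sum]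
  rfl

lemma norm_add_sq_re_inner (x y : Cn n) :
    ‖x + y‖ ^ 2 = ‖x‖ ^ 2 + 2 * (inner ℂ x y).re + ‖y‖ ^ 2 := by
  have := norm_add_sq (𝕜 := ℂ) x y
  simpa using this

lemma one_add_one_le_infty : (1 : WithTop ℕ∞) + 1 ≤ ∞ := by
  rw [one_add_one_eq_two]; exact WithTop.coe_le_coe.2 (le_top : (2 : ℕ∞) ≤ ⊤)

/-! ### The operator `∂/∂z̄` -/

lemma contDiffOn_fderivWithin_disk {E : Type*} [NormedAddCommGroup E] [NormedSpace ℝ E]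
    {h : ℂ → E} {l m : WithTop ℕ∞} (hh : ContDiffOn ℝ m h disk) (hl : l + 1 ≤ m) (v : ℂ) :
    ContDiffOn ℝ l (fun z => fderivWithin ℝ h disk z v) disk :=
  (hh.fderivWithin uniqueDiffOn_disk hl).clm_apply contDiffOn_const

lemma contDiffOn_dbar {u : ℂ → Cn n} {l m : WithTop ℕ∞} (hu : ContDiffOn ℝ m u disk)
    (hl : l + 1 ≤ m) : ContDiffOn ℝ l (dbar u) disk :=
  ((contDiffOn_fderivWithin_disk hu hl 1).add
    ((contDiffOn_fderivWithin_disk hu hl I).const_smul I)).const_smul (1 / 2 : ℂ)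

lemma continuousOn_dbar {u : ℂ → Cn n} (hu : ContDiffOn ℝ 1 u disk) :
    ContinuousOn (dbar u) disk :=
  (contDiffOn_dbar (l := 0) hu (by simp)).continuousOn

lemma dbar_add {f u : ℂ → Cn n} {z : ℂ} (hz : z ∈ disk) (hf : ContDiffOn ℝ 1 f disk)
    (hu : ContDiffOn ℝ 1 u disk) : dbar (fun z => f z + u z) z = dbar f z + dbar u z := by
  have hD := (uniqueDiffOn_disk z hz)
  simp only [dbar, dirDeriv,
    fderivWithin_fun_add hD (hf.differentiableOn one_ne_zero z hz)
      (hu.differentiableOn one_ne_zero z hz)]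
  simp only [add_apply]
  module

lemma dbar_const_smul {u : ℂ → Cn n} {z : ℂ} (t : ℝ) (hz : z ∈ disk)
    (hu : ContDiffOn ℝ 1 u disk) : dbar (fun z => t • u z) z = t • dbar u z := by
  have hD := (uniqueDiffOn_disk z hz)
  simp only [dbar, dirDeriv,
    fderivWithin_fun_const_smul hD (hu.differentiableOn one_ne_zero z hz)]
  simp only [smul_apply, ← Complex.coe_smul]
  module

lemma dbar_congr {f g : ℂ → Cn n} (h : EqOn f g disk) {z : ℂ} (hz : z ∈ disk) :
    dbar f z = dbar g z := by
  simp only [dbar, dirDeriv, fderivWithin_congr h (h hz)]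

/-- `P` is annihilated by `∂/∂z` in the open disk. -/
def IsAntiholomorphic (P : ℂ → Cn n) : Prop :=
  ∀ z ∈ ball (0 : ℂ) 1, fderivWithin ℝ P disk z I = -I • fderivWithin ℝ P disk z 1

lemma fderivWithin_inner {P u : ℂ → Cn n} (hP : ContDiffOn ℝ 1 P disk)
    (hu : ContDiffOn ℝ 1 u disk) {z : ℂ} (hz : z ∈ disk) (v : ℂ) :
    fderivWithin ℝ (fun z => inner ℂ (P z) (u z)) disk z v
      = inner ℂ (P z) (fderivWithin ℝ u disk z v) + inner ℂ (fderivWithin ℝ P disk z v) (u z) := by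
  have h1 := (hP.differentiableOn one_ne_zero z hz).hasFDerivWithinAt
  have h2 := (hu.differentiableOn one_ne_zero z hz).hasFDerivWithinAt
  rw [(h1.inner ℂ h2).fderivWithin (uniqueDiffOn_disk z hz)]
  simp [fderivInnerCLM_apply]

lemma two_smul_dbar (u : ℂ → Cn n) (z : ℂ) :
    (2 : ℂ) • dbar u z = fderivWithin ℝ u disk z 1 + I • fderivWithin ℝ u disk z I := by
  simp [dbar, dirDeriv, smul_smul]

/-- Green's formula for the `∂̄`-operator. -/
lemma integral_inner_dbar {P u : ℂ → Cn n} (hP : ContDiffOn ℝ 1 P disk)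
    (hu : ContDiffOn ℝ 1 u disk) (hPa : IsAntiholomorphic P) :
    2 * ∫ z in ball (0 : ℂ) 1, inner ℂ (P z) (dbar u z)
      = ∫ θ in (0 : ℝ)..2 * Real.pi, circleMap 0 1 θ *
          inner ℂ (P (circleMap 0 1 θ)) (u (circleMap 0 1 θ)) := by
  rw [← integral_ball_wirtingerBar (hP.inner ℂ hu), ← integral_const_mul]
  refine setIntegral_congr_fun measurableSet_ball fun z hz => ?_
  have hz' := ball_subset_disk hz
  simp only [fderivWithin_inner hP hu hz', hPa z hz]
  have h2 : 2 * inner ℂ (P z) (dbar u z) = inner ℂ (P z) ((2 : ℂ) • dbar u z) := by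
    rw [inner_smul_right]
  rw [h2, two_smul_dbar, inner_add_right, inner_smul_right, inner_smul_left]
  simp only [map_neg, conj_I, neg_neg]
  linear_combination (-inner ℂ (fderivWithin ℝ P disk z 1) (u z)) * I_sq

/-! ### The energy -/

lemma dbarEnergy_add {f u : ℂ → Cn n} (hf : ContDiffOn ℝ 1 f disk)
    (hu : ContDiffOn ℝ 1 u disk) :
    dbarEnergy (fun z => f z + u z) = dbarEnergy f
      + 2 * (∫ z in ball (0 : ℂ) 1, inner ℂ (dbar f z) (dbar u z)).re + dbarEnergy u := by
  have hfc := continuousOn_dbar hf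
  have huc := continuousOn_dbar hu
  have hic : ContinuousOn (fun z => inner ℂ (dbar f z) (dbar u z)) disk := hfc.inner huc
  have hre : (∫ z in ball (0 : ℂ) 1, inner ℂ (dbar f z) (dbar u z)).re
      = ∫ z in ball (0 : ℂ) 1, (inner ℂ (dbar f z) (dbar u z)).re := by
    rw [← RCLike.re_eq_complex_re]
    exact (integral_re (integrableOn_ball_of_continuousOn hic)).symm
  have hrc : ContinuousOn (fun z => (inner ℂ (dbar f z) (dbar u z)).re) disk :=
    Complex.continuous_re.comp_continuousOn hic
  have h1 : IntegrableOn (fun z => ‖dbar f z‖ ^ 2) (ball (0 : ℂ) 1) :=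
    integrableOn_ball_of_continuousOn (hfc.norm.pow 2)
  have h2 : IntegrableOn (fun z => 2 * (inner ℂ (dbar f z) (dbar u z)).re) (ball (0 : ℂ) 1) :=
    integrableOn_ball_of_continuousOn (hrc.const_mul _)
  have h3 : IntegrableOn (fun z => ‖dbar u z‖ ^ 2) (ball (0 : ℂ) 1) :=
    integrableOn_ball_of_continuousOn (huc.norm.pow 2)
  have h12 : IntegrableOn (fun z => ‖dbar f z‖ ^ 2 + 2 * (inner ℂ (dbar f z) (dbar u z)).re)
    (ball (0 : ℂ) 1) := h1.add h2
  rw [hre, dbarEnergy, dbarEnergy, dbarEnergy, ← integral_const_mul, ← integral_add h1 h2,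
    ← integral_add h12 h3]
  refine setIntegral_congr_fun measurableSet_ball fun z hz => ?_
  simp only [dbar_add (ball_subset_disk hz) hf hu, norm_add_sq_re_inner]

lemma dbarEnergy_const_smul {u : ℂ → Cn n} (t : ℝ) (hu : ContDiffOn ℝ 1 u disk) :
    dbarEnergy (fun z => t • u z) = t ^ 2 * dbarEnergy u := by
  rw [dbarEnergy, dbarEnergy, ← integral_const_mul]
  refine setIntegral_congr_fun measurableSet_ball fun z hz => ?_
  simp only [dbar_const_smul t (ball_subset_disk hz) hu, norm_smul, mul_pow, Real.norm_eq_abs,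
    sq_abs]

lemma dbarEnergy_congr {f g : ℂ → Cn n} (h : EqOn f g disk) : dbarEnergy f = dbarEnergy g :=
  setIntegral_congr_fun measurableSet_ball fun _ hz => by
    simp only [dbar_congr h (ball_subset_disk hz)]

/-! ### Interior variations -/

lemma IsStrictlyPseudoconvex.continuous {k : ℕ∞} {N : Set (Cn n)} {ρ : Cn n → ℝ}
    (hN : IsStrictlyPseudoconvex k N ρ) : Continuous ρ := hN.contDiff.continuous

lemma IsStrictlyPseudoconvex.isOpen {k : ℕ∞} {N : Set (Cn n)} {ρ : Cn n → ℝ}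
    (hN : IsStrictlyPseudoconvex k N ρ) : IsOpen N := by
  rw [hN.eq_sublevel]; exact isOpen_lt hN.continuous continuous_const

lemma isVariation_interior {k : ℕ∞} {N : Set (Cn n)} (hN : IsOpen N)
    {f u : ℂ → Cn n} (hf : ContDiffOn ℝ ∞ f disk) (hfN : IsDiskIn N f)
    (hu : ContDiff ℝ ∞ u) {K : Set ℂ} (hK : IsCompact K) (hKb : K ⊆ ball 0 1)
    (huK : ∀ z ∉ K, u z = 0) :
    IsVariation k N f (fun t z => f z + t • u z) := by
  refine ⟨fun z _ => by simp, ?_⟩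
  have hfK : IsCompact (f '' K) :=
    hK.image_of_continuousOn (hf.continuousOn.mono (hKb.trans ball_subset_disk))
  obtain ⟨δ, hδ, hδN⟩ := hfK.exists_thickening_subset_open hN
    ((image_mono hKb).trans hfN.1.image_subset)
  obtain ⟨C, hC⟩ := hK.exists_bound_of_continuousOn hu.continuous.continuousOn
  have hk : (k : WithTop ℕ∞) ≤ ∞ := by exact_mod_cast le_top
  refine ⟨δ / (|C| + 1), by positivity, ?_, fun t ht => ⟨fun z hz => ?_, fun z hz => ?_⟩⟩
  · have h1 : ContDiffOn ℝ k (fun p : ℝ × ℂ => f p.2) (Ioo (-(δ / (|C| + 1))) (δ / (|C| + 1)) ×ˢ disk) :=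
      (hf.of_le hk).comp contDiffOn_snd fun p hp => hp.2
    exact h1.add (contDiff_fst.smul ((hu.of_le hk).comp contDiff_snd)).contDiffOn
  · by_cases hzK : z ∈ K
    · refine hδN (mem_thickening_iff.2 ⟨f z, mem_image_of_mem _ hzK, ?_⟩)
      rw [dist_eq_norm, add_sub_cancel_left, norm_smul]
      have h1 : |t| < δ / (|C| + 1) := abs_lt.2 ht
      have h2 : ‖u z‖ < |C| + 1 := by linarith [hC z hzK, le_abs_self C]
      have h3 : (0 : ℝ) < |C| + 1 := by positivity
      calc ‖t‖ * ‖u z‖ ≤ |t| * (|C| + 1) := by gcongr; exact le_rfl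
        _ < δ := (lt_div_iff₀ h3).1 h1
    · simp only [huK z hzK, smul_zero, add_zero]; exact hfN.1 hz
  · have hzK : z ∉ K := fun h => by
      have := hKb h
      rw [mem_ball_zero_iff] at this; rw [mem_sphere_zero_iff_norm] at hz; linarith
    simp only [huK z hzK, smul_zero, add_zero]; exact hfN.2 hz

/-- Along f + tu the energy is a quadratic polynomial in t, with linear coefficient twice this real
part. -/
lemma re_integral_inner_dbar_eq_zero {k : ℕ∞} {N : Set (Cn n)} (hN : IsOpen N)
    {f u : ℂ → Cn n} (hf : ContDiffOn ℝ ∞ f disk) (hfN : IsDiskIn N f)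
    (hcrit : IsDbarCritical k N f)
    (hu : ContDiff ℝ ∞ u) {K : Set ℂ} (hK : IsCompact K) (hKb : K ⊆ ball 0 1)
    (huK : ∀ z ∉ K, u z = 0) :
    (∫ z in ball (0 : ℂ) 1, inner ℂ (dbar f z) (dbar u z)).re = 0 := by
  have hd := hcrit _ (isVariation_interior (k := k) hN hf hfN hu hK hKb huK)
  have hf1 : ContDiffOn ℝ 1 f disk := hf.of_le (by simp)
  have hu1 : ContDiffOn ℝ 1 u disk := (hu.of_le (by simp)).contDiffOn
  set A := (∫ z in ball (0 : ℂ) 1, inner ℂ (dbar f z) (dbar u z)).re with hA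
  have he : (fun t : ℝ => dbarEnergy (fun z => f z + t • u z))
      = fun t : ℝ => dbarEnergy f + 2 * (t * A) + t ^ 2 * dbarEnergy u := by
    funext t
    rw [dbarEnergy_add hf1 (hu1.const_smul t), dbarEnergy_const_smul t hu1, hA]
    have : ∫ z in ball (0 : ℂ) 1, inner ℂ (dbar f z) (dbar (fun z => t • u z) z)
        = ∫ z in ball (0 : ℂ) 1, (t : ℂ) * inner ℂ (dbar f z) (dbar u z) :=
      setIntegral_congr_fun measurableSet_ball fun z hz => by
        have h := dbar_const_smul t (ball_subset_disk hz) hu1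
        rw [h, ← Complex.coe_smul, inner_smul_right]
    rw [this, integral_const_mul]
    simp only [re_ofReal_mul]
  have hd' : HasDerivAt (fun t : ℝ => dbarEnergy f + 2 * (t * A) + t ^ 2 * dbarEnergy u)
      (2 * A) 0 := by
    have := (((hasDerivAt_id (0 : ℝ)).mul_const A).const_mul 2).const_add (dbarEnergy f) |>.add
      ((hasDerivAt_pow 2 (0 : ℝ)).mul_const (dbarEnergy u))
    refine (this.congr_deriv (by simp)).congr_of_eventuallyEq (Filter.Eventually.of_forall fun t => ?_)
    simp
  simp only [he] at hd
  have := hd.unique hd'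
  linarith

lemma dbar_smul_const {ψ : ℂ → ℝ} (hψ : ContDiff ℝ ∞ ψ) (v : Cn n) {z : ℂ} (hz : z ∈ disk) :
    dbar (fun z => ψ z • v) z
      = ((1 / 2 : ℂ) * (fderivWithin ℝ ψ disk z 1 + I * fderivWithin ℝ ψ disk z I)) • v := by
  have hd : HasFDerivWithinAt ψ (fderivWithin ℝ ψ disk z) disk z :=
    (hψ.differentiable (by simp)).differentiableAt.differentiableWithinAt.hasFDerivWithinAt
  simp only [dbar, dirDeriv, hd.smul_const v |>.fderivWithin (uniqueDiffOn_disk z hz)]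
  change (1 / 2 : ℂ) • (fderivWithin ℝ ψ disk z 1 • v + I • fderivWithin ℝ ψ disk z I • v) = _
  simp only [← Complex.coe_smul]
  module

/-- A critical disk is harmonic, that is, `∂f/∂z̄` is antiholomorphic. -/
theorem IsDbarCritical.isAntiholomorphic {k : ℕ∞} {N : Set (Cn n)} (hN : IsOpen N)
    {f : ℂ → Cn n} (hf : ContDiffOn ℝ ∞ f disk) (hfN : IsDiskIn N f)
    (hcrit : IsDbarCritical k N f) : IsAntiholomorphic (dbar f) := by
  have hP : ContDiffOn ℝ 1 (dbar f) disk := contDiffOn_dbar hf one_add_one_le_infty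
  set P := dbar f with hPdef
  -- The vector ∂P/∂x − i ∂P/∂y is 2 ∂P/∂z. It is shown to vanish weakly, one constant vector v at a
  -- time; at the end v is taken to be the vector itself.
  have key : ∀ v : Cn n, ∀ z ∈ ball (0 : ℂ) 1,
      inner ℂ (fderivWithin ℝ P disk z 1 - I • fderivWithin ℝ P disk z I) v = 0 := by
    intro v
    have ha : ContDiffOn ℝ 1 (fun z => inner ℂ (P z) v) disk := hP.inner ℂ contDiffOn_const
    have hac : ∀ w : ℂ, ContinuousOn (fun z => fderivWithin ℝ P disk z w) disk := fun w =>
      (contDiffOn_fderivWithin_disk (l := 0) hP (by simp) w).continuousOn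
    have hc : ContinuousOn (fun z =>
        inner ℂ (fderivWithin ℝ P disk z 1 - I • fderivWithin ℝ P disk z I) v) disk :=
      ((hac 1).sub ((hac I).const_smul I)).inner continuousOn_const
    have hae : ∀ᵐ z ∂(volume : Measure ℂ), z ∈ ball (0 : ℂ) 1 →
        inner ℂ (fderivWithin ℝ P disk z 1 - I • fderivWithin ℝ P disk z I) v = 0 := by
      refine isOpen_ball.ae_eq_zero_of_integral_contDiff_smul_eq_zero
        (integrableOn_ball_of_continuousOn hc).locallyIntegrableOn fun ψ hψ hψc hψb => ?_
      have hψ0 : ∀ z ∉ tsupport ψ, ψ z = 0 := fun z hz => image_eq_zero_of_notMem_tsupport hz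
      set β : ℂ → ℂ := fun z =>
        (1 / 2 : ℂ) * (fderivWithin ℝ ψ disk z 1 + I * fderivWithin ℝ ψ disk z I) with hβ
      have hv : ∀ v' : Cn n, (∫ z in ball (0 : ℂ) 1, β z * inner ℂ (P z) v').re = 0 := by
        intro v'
        have := re_integral_inner_dbar_eq_zero hN hf hfN hcrit
          (hψ.smul (contDiff_const (c := v'))) hψc hψb (fun z hz => by simp [hψ0 z hz])
        rw [← this]
        congr 1
        refine setIntegral_congr_fun measurableSet_ball fun z hz => ?_
        have hd := dbar_smul_const hψ v' (ball_subset_disk hz)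
        simp only [← hPdef]
        rw [show dbar (ψ • fun _ => v') z = dbar (fun z => ψ z • v') z from rfl, hd,
          inner_smul_right]
      -- Criticality controls real parts only; testing with iv as well gives the imaginary part.
      have hz0 : ∫ z in ball (0 : ℂ) 1, β z * inner ℂ (P z) v = 0 := by
        refine Complex.ext (hv v) ?_
        have h2 := hv (I • v)
        simp only [inner_smul_right] at h2
        have h3 : ∫ z in ball (0 : ℂ) 1, β z * (I * inner ℂ (P z) v)
            = I * ∫ z in ball (0 : ℂ) 1, β z * inner ℂ (P z) v := by
          rw [← integral_const_mul]; congr 1; funext z; ring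
        rw [h3] at h2
        simpa using h2
      have hψ1 : ContDiffOn ℝ 1 (fun z => (ψ z : ℂ)) disk :=
        (ofRealCLM.contDiff.comp (hψ.of_le (by simp))).contDiffOn
      -- Integration by parts: ψ has support in the open disk, so the boundary term vanishes.
      have hp := integral_ball_wirtingerBar (hψ1.mul ha)
      have hbd : ∀ θ : ℝ, ψ (circleMap 0 1 θ) = 0 := fun θ => hψ0 _ fun h => by
        have h1 := hψb h
        have h2 := circleMap_mem_sphere_one θ
        rw [mem_ball_zero_iff] at h1; rw [mem_sphere_zero_iff_norm] at h2; linarith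
      simp only [hbd, ofReal_zero, zero_mul, mul_zero, intervalIntegral.integral_zero] at hp
      have hψβ : ContinuousOn β disk := by
        have : ∀ w : ℂ, ContinuousOn (fun z => (fderivWithin ℝ ψ disk z w : ℂ)) disk := fun w =>
          continuous_ofReal.comp_continuousOn
            (contDiffOn_fderivWithin_disk (l := 0) (hψ.contDiffOn) (by simp) w).continuousOn
        exact continuousOn_const.mul ((this 1).add (continuousOn_const.mul (this I)))
      have hsplit : ∫ z in ball (0 : ℂ) 1, (2 * (β z * inner ℂ (P z) v) + ψ z •
          inner ℂ (fderivWithin ℝ P disk z 1 - I • fderivWithin ℝ P disk z I) v) = 0 := by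
        refine Eq.trans ?_ hp
        refine setIntegral_congr_fun measurableSet_ball fun z hz => ?_
        have hz' := ball_subset_disk hz
        have hD := uniqueDiffOn_disk z hz'
        have hψd : DifferentiableWithinAt ℝ ψ disk z :=
          (hψ.differentiable (by simp)).differentiableAt.differentiableWithinAt
        have e1 : ∀ w, fderivWithin ℝ (fun z => (ψ z : ℂ)) disk z w = fderivWithin ℝ ψ disk z w :=
          fun w => by
            have := (ofRealCLM.hasFDerivAt.comp_hasFDerivWithinAt z hψd.hasFDerivWithinAt).fderivWithin hD
            have h' : fderivWithin ℝ (fun z => (ψ z : ℂ)) disk z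
              = ofRealCLM.comp (fderivWithin ℝ ψ disk z) := this
            rw [h']; simp
        have e2 := fderivWithin_fun_mul hD (hψ1.differentiableOn one_ne_zero z hz')
          (ha.differentiableOn one_ne_zero z hz')
        have e3 : ∀ w, fderivWithin ℝ (fun z => inner ℂ (P z) v) disk z w
            = inner ℂ (fderivWithin ℝ P disk z w) v := fun w => by
          rw [fderivWithin_inner hP contDiffOn_const hz']; simp
        simp only [hβ]
        rw [e2]
        simp only [add_apply, smul_apply, smul_eq_mul, e1, e3, inner_sub_left, inner_smul_left,
          conj_I, real_smul]
        ring
      have hi1 : IntegrableOn (fun z => 2 * (β z * inner ℂ (P z) v)) (ball (0 : ℂ) 1) :=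
        integrableOn_ball_of_continuousOn ((hψβ.mul ha.continuousOn).const_mul 2)
      have hi2 : IntegrableOn (fun z => ψ z •
          inner ℂ (fderivWithin ℝ P disk z 1 - I • fderivWithin ℝ P disk z I) v)
          (ball (0 : ℂ) 1) :=
        integrableOn_ball_of_continuousOn (hψ.continuous.continuousOn.smul hc)
      rw [integral_add hi1 hi2, integral_const_mul, hz0, mul_zero, zero_add] at hsplit
      rw [← hsplit, setIntegral_eq_integral_of_forall_compl_eq_zero]
      intro z hz
      rw [hψ0 z fun h => hz (hψb h), zero_smul]
    have := Measure.eqOn_open_of_ae_eq (μ := (volume : Measure ℂ)) (g := fun _ => (0 : ℂ))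
      ((ae_restrict_iff' measurableSet_ball).2 hae) isOpen_ball
      (hc.mono ball_subset_disk) continuousOn_const
    exact fun z hz => this hz
  intro z hz
  have h0 : fderivWithin ℝ P disk z 1 - I • fderivWithin ℝ P disk z I = 0 :=
    inner_self_eq_zero.1 (key _ z hz)
  have h1 : fderivWithin ℝ P disk z 1 = I • fderivWithin ℝ P disk z I := sub_eq_zero.1 h0
  rw [h1, smul_smul]
  simp

end DbarDisk

namespace DbarDisk

open Complex Set Metric MeasureTheory

/-! ### Moving points along a direction onto prescribed level sets -/

section LevelCorrection

variable {E : Type*} [NormedAddCommGroup E] [NormedSpace ℝ E]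

/-- The linear automorphism `(x, s) ↦ (x, ℓ x + s a)` of `E × ℝ`. -/
def shearEquiv (ℓ : E →L[ℝ] ℝ) {a : ℝ} (ha : a ≠ 0) : (E × ℝ) ≃L[ℝ] (E × ℝ) :=
  ContinuousLinearEquiv.equivOfInverse
    ((ContinuousLinearMap.fst ℝ E ℝ).prod
      (ℓ.comp (ContinuousLinearMap.fst ℝ E ℝ) + a • ContinuousLinearMap.snd ℝ E ℝ))
    ((ContinuousLinearMap.fst ℝ E ℝ).prod
      (a⁻¹ • (ContinuousLinearMap.snd ℝ E ℝ - ℓ.comp (ContinuousLinearMap.fst ℝ E ℝ))))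
    (fun x => by ext <;> simp [ha])
    (fun x => by ext <;> simp [ha])

/-- S(x, c) is the distance to travel from x along e to reach the level c. It is the second
component of the local inverse of (x, s) ↦ (x, ρ(x + se)) at (p, 0), whose differential is a shear
because dρ(e) ≠ 0 at p. -/
lemma exists_level_correction [CompleteSpace E] {k : WithTop ℕ∞} (hk : k ≠ 0) {ρ : E → ℝ}
    (hρ : ContDiff ℝ k ρ) {p e : E} (he : fderiv ℝ ρ p e ≠ 0) :
    ∃ O : Set (E × ℝ), IsOpen O ∧ (p, ρ p) ∈ O ∧ ∃ S : E × ℝ → ℝ, ContDiffOn ℝ k S O ∧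
      (∀ x ∈ O, ρ (x.1 + S x • e) = x.2 ∧ fderiv ℝ ρ (x.1 + S x • e) e ≠ 0) ∧
      ∀ q, (q, ρ q) ∈ O → S (q, ρ q) = 0 := by
  set Φ : E × ℝ → E × ℝ := fun x => (x.1, ρ (x.1 + x.2 • e)) with hΦ
  have hsum : ContDiff ℝ k fun x : E × ℝ => x.1 + x.2 • e :=
    contDiff_fst.add (contDiff_snd.smul contDiff_const)
  have hΦc : ContDiff ℝ k Φ := contDiff_fst.prodMk (hρ.comp hsum)
  have hΦd : ∀ x : E × ℝ, ∀ h : fderiv ℝ ρ (x.1 + x.2 • e) e ≠ 0,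
      HasFDerivAt Φ (shearEquiv (fderiv ℝ ρ (x.1 + x.2 • e)) h : E × ℝ →L[ℝ] E × ℝ) x := by
    intro x h
    have h1 : HasFDerivAt (fun x : E × ℝ => x.1 + x.2 • e)
        (ContinuousLinearMap.fst ℝ E ℝ + (ContinuousLinearMap.snd ℝ E ℝ).smulRight e) x :=
      hasFDerivAt_fst.add (hasFDerivAt_snd.smul_const e)
    have h2 := (hρ.differentiable hk (x.1 + x.2 • e)).hasFDerivAt.comp x h1
    refine (hasFDerivAt_fst.prodMk h2).congr_fderiv ?_
    ext <;> simp [shearEquiv, mul_comm]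
  have hp0 : fderiv ℝ ρ ((p, (0 : ℝ)).1 + (p, (0 : ℝ)).2 • e) e ≠ 0 := by simpa using he
  set Ψ := (hΦc.contDiffAt (x := (p, (0 : ℝ)))).toOpenPartialHomeomorph Φ (hΦd (p, 0) hp0) hk
    with hΨ
  have hΨc : ∀ x, Ψ x = Φ x := fun x => by
    rw [hΨ, ContDiffAt.toOpenPartialHomeomorph_coe]
  have hsrc : (p, (0 : ℝ)) ∈ Ψ.source := ContDiffAt.mem_toOpenPartialHomeomorph_source _ _ hk
  have hΦ0 : ∀ q, Φ (q, 0) = (q, ρ q) := fun q => by simp [hΦ]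
  set U₁ : Set (E × ℝ) := {x | fderiv ℝ ρ (x.1 + x.2 • e) e ≠ 0} with hU₁
  have hU₁o : IsOpen U₁ := by
    have hc : Continuous fun x : E × ℝ => fderiv ℝ ρ (x.1 + x.2 • e) e :=
      ((hρ.continuous_fderiv hk).comp hsum.continuous).clm_apply continuous_const
    exact isOpen_ne_fun hc continuous_const
  have hinv0 : ∀ q, (q, (0 : ℝ)) ∈ Ψ.source → Ψ.symm (q, ρ q) = (q, 0) := fun q hq => by
    rw [← hΦ0, ← hΨc, Ψ.left_inv hq]
  have hzero : Continuous fun x : E × ℝ => (x.1, (0 : ℝ)) := by fun_prop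
  -- The three conditions on x: the local inverse is defined, dρ(e) ≠ 0 at the corrected point, and
  -- (x.1, 0) lies in the source, so that a point already on its level needs no correction.
  refine ⟨(Ψ.target ∩ Ψ.symm ⁻¹' U₁) ∩ (fun x : E × ℝ => (x.1, (0 : ℝ))) ⁻¹' Ψ.source,
    (Ψ.symm.isOpen_inter_preimage hU₁o).inter (Ψ.open_source.preimage hzero), ?_,
    fun x => (Ψ.symm x).2, ?_, ?_, ?_⟩
  · refine ⟨⟨?_, ?_⟩, hsrc⟩
    · rw [← hΦ0, ← hΨc]; exact Ψ.map_source hsrc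
    · rw [mem_preimage, hinv0 p hsrc]; exact hp0
  · rintro x ⟨⟨hxt, hxU⟩, -⟩
    have := Ψ.contDiffAt_symm (n := k) hxt (f₀' := shearEquiv _ hxU)
      (by
        have := hΦd (Ψ.symm x) hxU
        refine this.congr_of_eventuallyEq (Filter.Eventually.of_forall hΨc))
      (by
        have := hΦc.contDiffAt (x := Ψ.symm x)
        refine this.congr_of_eventuallyEq (Filter.Eventually.of_forall hΨc))
    exact (contDiff_snd.contDiffAt.comp x this).contDiffWithinAt
  · rintro x ⟨⟨hxt, hxU⟩, -⟩
    have h1 : Φ (Ψ.symm x) = x := by rw [← hΨc]; exact Ψ.right_inv hxt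
    have h2 : (Φ (Ψ.symm x)).1 = x.1 := congrArg Prod.fst h1
    change (Ψ.symm x).1 = x.1 at h2
    have h3 : (Φ (Ψ.symm x)).2 = x.2 := congrArg Prod.snd h1
    rw [← h2]
    exact ⟨h3, hxU⟩
  · rintro q ⟨-, hq⟩
    change (Ψ.symm (q, ρ q)).2 = 0
    rw [hinv0 q hq]

end LevelCorrection

/-! ### Points of the boundary of a domain given by a defining function -/

variable {n : ℕ} {k : ℕ∞} {N : Set (Cn n)} {ρ : Cn n → ℝ}

lemma IsStrictlyPseudoconvex.eq_zero_of_mem_frontier (hN : IsStrictlyPseudoconvex k N ρ)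
    {p : Cn n} (hp : p ∈ frontier N) : ρ p = 0 := by
  rw [hN.isOpen.frontier_eq] at hp
  refine le_antisymm ?_ ?_
  · have : closure N ⊆ {q | ρ q ≤ 0} :=
      closure_minimal (fun q hq => by rw [hN.eq_sublevel] at hq; exact le_of_lt (show ρ q < 0 from hq))
        (isClosed_le hN.continuous continuous_const)
    exact this hp.1
  · have := hp.2
    rw [hN.eq_sublevel] at this
    exact not_lt.1 this

/-- Zeros of ρ away from the closure of N are not excluded. Such a zero is a local minimum of ρ,
hence a critical point. -/
lemma IsStrictlyPseudoconvex.mem_frontier (hN : IsStrictlyPseudoconvex k N ρ)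
    {p : Cn n} (hp : ρ p = 0) (hd : fderiv ℝ ρ p ≠ 0) : p ∈ frontier N := by
  rw [hN.isOpen.frontier_eq]
  refine ⟨?_, by rw [hN.eq_sublevel]; simp [hp]⟩
  by_contra hcl
  refine hd (IsLocalMin.fderiv_eq_zero ?_)
  filter_upwards [isClosed_closure.isOpen_compl.mem_nhds hcl] with q hq
  rw [hp]
  by_contra hlt
  refine hq (subset_closure ?_)
  rw [hN.eq_sublevel]
  exact not_le.1 hlt

lemma IsStrictlyPseudoconvex.neg_of_mem (hN : IsStrictlyPseudoconvex k N ρ) {p : Cn n}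
    (hp : p ∈ N) : ρ p < 0 := by
  rwa [hN.eq_sublevel] at hp

lemma two_le_coe (hk : 2 ≤ k) : (2 : WithTop ℕ∞) ≤ k := WithTop.coe_le_coe.2 hk

lemma one_le_coe (hk : 2 ≤ k) : (1 : WithTop ℕ∞) ≤ k := one_le_two.trans (two_le_coe hk)

lemma coe_ne_zero_of_two_le (hk : 2 ≤ k) : (k : WithTop ℕ∞) ≠ 0 := fun h => by
  have := one_le_coe hk
  rw [h] at this
  simp at this

/-! ### Local variations near a boundary point -/

open Classical in
/-- Near a boundary point, fields with small support are, up to a correction in a fixed direction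
that makes them tangent to the level sets of `ρ`, initial velocities of variations. -/
theorem exists_local_variation (hk : 2 ≤ k) (hN : IsStrictlyPseudoconvex k N ρ)
    {f : ℂ → Cn n} (hf : ContDiffOn ℝ ∞ f disk) (hfN : IsDiskIn N f) {z₀ : ℂ}
    (hz₀ : z₀ ∈ sphere (0 : ℂ) 1) :
    ∃ (e : Cn n) (U : Set ℂ), IsOpen U ∧ z₀ ∈ U ∧
      (∀ z ∈ U, z ∈ disk → fderiv ℝ ρ (f z) e ≠ 0) ∧
      ∀ V : ℂ → Cn n, ContDiffOn ℝ ∞ V disk → ∀ K ⊆ U, IsClosed K →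
        (∀ z ∈ disk, z ∉ K → V z = 0) →
        ∃ F : ℝ → ℂ → Cn n, IsVariation k N f F ∧ ∀ z ∈ disk, HasDerivAt (fun t => F t z)
          (V z - (fderiv ℝ ρ (f z) (V z) / fderiv ℝ ρ (f z) e) • e) 0 := by
  have hk0 := coe_ne_zero_of_two_le hk
  have hkinf : (k : WithTop ℕ∞) ≤ ∞ := by simp
  obtain ⟨e, he⟩ : ∃ e, fderiv ℝ ρ (f z₀) e ≠ 0 := by
    by_contra! h
    exact hN.fderiv_ne_zero _ (hfN.2 hz₀) (by ext v; exact h v)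
  obtain ⟨O, hO, hpO, S, hSc, hS, hS0⟩ := exists_level_correction hk0 hN.contDiff he
  have hgc : ContinuousOn (fun z => (f z, ρ (f z))) disk :=
    hf.continuousOn.prodMk (hN.continuous.comp_continuousOn hf.continuousOn)
  obtain ⟨U, hU, hz₀U, hUO⟩ := mem_nhdsWithin.1
    (hgc z₀ (sphere_subset_disk hz₀) (hO.mem_nhds hpO))
  have hUO' : ∀ z ∈ U, z ∈ disk → (f z, ρ (f z)) ∈ O := fun z h1 h2 => hUO ⟨h1, h2⟩
  have hne : ∀ z ∈ U, z ∈ disk → fderiv ℝ ρ (f z) e ≠ 0 := fun z h1 h2 => by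
    have h := hS _ (hUO' z h1 h2)
    simpa [hS0 _ (hUO' z h1 h2)] using h.2
  refine ⟨e, U, hU, hz₀U, hne, fun V hV K hKU hK hVK => ?_⟩
  -- The push along e restores the value of ρ at f(z) for every z, not only on the circle. So ρ∘F_t
  -- = ρ∘f, which keeps interior points in N and boundary points on ∂N.
  set raw : ℝ × ℂ → Cn n :=
    fun x => f x.2 + x.1 • V x.2 + S (f x.2 + x.1 • V x.2, ρ (f x.2)) • e with hraw
  -- On U ∖ K the velocity vanishes and no correction is made, so the two branches agree there and
  -- the gluing is of class C^k.
  set F : ℝ → ℂ → Cn n := fun t z => if z ∈ K then raw (t, z) else f z with hF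
  have hFraw : ∀ t, ∀ z ∈ U, z ∈ disk → F t z = raw (t, z) := fun t z hzU hzd => by
    by_cases hzK : z ∈ K
    · simp only [hF, if_pos hzK]
    · simp only [hF, if_neg hzK, hraw, hVK z hzd hzK, smul_zero, add_zero,
        hS0 _ (hUO' z hzU hzd), zero_smul]
  have hraw0 : ∀ z ∈ U, z ∈ disk → raw (0, z) = f z := fun z h1 h2 => by
    simp [hraw, hS0 _ (hUO' z h1 h2)]
  have hKd : IsCompact (K ∩ disk) := isCompact_disk.inter_left hK
  obtain ⟨δ, hδ, hδO⟩ := (hKd.image_of_continuousOn (hgc.mono inter_subset_right)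
    ).exists_thickening_subset_open hO
    (by rintro _ ⟨z, hz, rfl⟩; exact hUO' z (hKU hz.1) hz.2)
  obtain ⟨C, hC⟩ := isCompact_disk.exists_bound_of_continuousOn hV.continuousOn
  set ε := δ / (|C| + 1) with hε
  have hεpos : 0 < ε := by positivity
  have hmemO : ∀ t ∈ Ioo (-ε) ε, ∀ z ∈ K, z ∈ disk → (f z + t • V z, ρ (f z)) ∈ O := by
    intro t ht z hzK hzd
    refine hδO (mem_thickening_iff.2 ⟨_, mem_image_of_mem _ ⟨hzK, hzd⟩, ?_⟩)
    rw [Prod.dist_eq, dist_self, dist_eq_norm, add_sub_cancel_left, norm_smul]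
    have h1 : |t| < ε := abs_lt.2 ht
    have h2 : ‖V z‖ ≤ |C| + 1 := by linarith [hC z hzd, le_abs_self C]
    have h3 : (0 : ℝ) < |C| + 1 := by positivity
    refine max_lt ?_ hδ
    calc ‖t‖ * ‖V z‖ ≤ |t| * (|C| + 1) := by gcongr; exact le_rfl
      _ < δ := (lt_div_iff₀ h3).1 h1
  have h0 : (0 : ℝ) ∈ Ioo (-ε) ε := ⟨by linarith, hεpos⟩
  have hlev : ∀ t ∈ Ioo (-ε) ε, ∀ z ∈ K, z ∈ disk →
      ρ (F t z) = ρ (f z) ∧ fderiv ℝ ρ (F t z) e ≠ 0 := by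
    intro t ht z hzK hzd
    have := hS _ (hmemO t ht z hzK hzd)
    simpa only [hF, if_pos hzK, hraw] using this
  refine ⟨F, ⟨fun z hz => ?_, ε, hεpos, ?_, fun t ht => ⟨fun z hz => ?_, fun z hz => ?_⟩⟩,
    fun z hz => ?_⟩
  · by_cases hzK : z ∈ K
    · rw [hFraw 0 z (hKU hzK) hz, hraw0 z (hKU hzK) hz]
    · simp only [hF, if_neg hzK]
  · rintro ⟨t, z⟩ ⟨ht, hz⟩
    have hft : ContDiffWithinAt ℝ k (fun x : ℝ × ℂ => f x.2) (Ioo (-ε) ε ×ˢ disk) (t, z) :=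
      ((hf z hz).of_le hkinf).comp (t, z) contDiffWithinAt_snd fun p hp => hp.2
    have hVt : ContDiffWithinAt ℝ k (fun x : ℝ × ℂ => V x.2) (Ioo (-ε) ε ×ˢ disk) (t, z) :=
      ((hV z hz).of_le hkinf).comp (t, z) contDiffWithinAt_snd fun p hp => hp.2
    by_cases hzK : z ∈ K
    · have h1 : ContDiffWithinAt ℝ k (fun x : ℝ × ℂ => f x.2 + x.1 • V x.2)
          (Ioo (-ε) ε ×ˢ disk) (t, z) := hft.add (contDiffWithinAt_fst.smul hVt)
      have h2 : ContDiffWithinAt ℝ k (fun x : ℝ × ℂ => (f x.2 + x.1 • V x.2, ρ (f x.2)))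
          (Ioo (-ε) ε ×ˢ disk) (t, z) :=
        h1.prodMk (hN.contDiff.contDiffAt.comp_contDiffWithinAt (t, z) hft)
      have h3 : ContDiffAt ℝ k S (f z + t • V z, ρ (f z)) :=
        hSc.contDiffAt (hO.mem_nhds (hmemO t ht z hzK hz))
      have h4 : ContDiffWithinAt ℝ k raw (Ioo (-ε) ε ×ˢ disk) (t, z) :=
        h1.add ((h3.comp_contDiffWithinAt (t, z) h2).smul contDiffWithinAt_const)
      refine h4.congr_of_eventuallyEq ?_ (hFraw t z (hKU hzK) hz)
      have hU' : (Prod.snd ⁻¹' U : Set (ℝ × ℂ)) ∈ 𝓝 (t, z) :=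
        (hU.preimage continuous_snd).mem_nhds (hKU hzK)
      filter_upwards [mem_nhdsWithin_of_mem_nhds hU', self_mem_nhdsWithin] with x hx1 hx2
      exact hFraw x.1 x.2 hx1 hx2.2
    · refine hft.congr_of_eventuallyEq ?_ (by simp only [Function.uncurry, hF, if_neg hzK])
      have hU' : (Prod.snd ⁻¹' Kᶜ : Set (ℝ × ℂ)) ∈ 𝓝 (t, z) :=
        (hK.isOpen_compl.preimage continuous_snd).mem_nhds hzK
      filter_upwards [mem_nhdsWithin_of_mem_nhds hU'] with x hx1
      simp only [Function.uncurry, hF]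
      exact if_neg hx1
  · by_cases hzK : z ∈ K
    · rw [hN.eq_sublevel]
      change ρ (F t z) < 0
      rw [(hlev t ht z hzK (ball_subset_disk hz)).1]
      exact hN.neg_of_mem (hfN.1 hz)
    · simp only [hF, if_neg hzK]; exact hfN.1 hz
  · by_cases hzK : z ∈ K
    · have h1 := hlev t ht z hzK (sphere_subset_disk hz)
      refine hN.mem_frontier (h1.1.trans (hN.eq_zero_of_mem_frontier (hfN.2 hz))) fun h => ?_
      exact h1.2 (by rw [h]; rfl)
    · simp only [hF, if_neg hzK]; exact hfN.2 hz
  · by_cases hzK : z ∈ K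
    · have hzU := hKU hzK
      have hSd : HasFDerivAt S (fderiv ℝ S (f z, ρ (f z))) (f z, ρ (f z)) :=
        ((hSc.contDiffAt (hO.mem_nhds (hUO' z hzU hz))).differentiableAt hk0).hasFDerivAt
      have h1 : HasDerivAt (fun t : ℝ => f z + t • V z) (V z) 0 := by
        simpa using ((hasDerivAt_id (0 : ℝ)).smul_const (V z)).const_add (f z)
      have h2 : HasDerivAt (fun t : ℝ => (f z + t • V z, ρ (f z))) (V z, (0 : ℝ)) 0 :=
        h1.prodMk (hasDerivAt_const _ _)
      have h3 : HasDerivAt (fun t : ℝ => S (f z + t • V z, ρ (f z)))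
          (fderiv ℝ S (f z, ρ (f z)) (V z, 0)) 0 :=
        HasFDerivAt.comp_hasDerivAt (0 : ℝ) (by simpa using hSd) h2
      set σ := fderiv ℝ S (f z, ρ (f z)) (V z, 0) with hσ
      have h4 : HasDerivAt (fun t => F t z) (V z + σ • e) 0 := by
        refine (h1.add (h3.smul_const e)).congr_of_eventuallyEq
          (Filter.Eventually.of_forall fun t => ?_)
        simp only [hFraw t z hzU hz, hraw]
        rfl
      have hF0 : F 0 z = f z := by rw [hFraw 0 z hzU hz, hraw0 z hzU hz]
      -- The derivative σ of the correction is not computed from S: constancy of ρ along t ↦ F t z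
      -- gives dρ(V + σe) = 0, which determines it.
      have h5 : HasDerivAt (fun t => ρ (F t z)) (fderiv ℝ ρ (f z) (V z + σ • e)) 0 :=
        HasFDerivAt.comp_hasDerivAt (0 : ℝ)
          (by rw [hF0]; exact (hN.contDiff.differentiable hk0 _).hasFDerivAt) h4
      have h6 : HasDerivAt (fun t => ρ (F t z)) 0 0 := by
        refine (hasDerivAt_const (0 : ℝ) (ρ (f z))).congr_of_eventuallyEq ?_
        filter_upwards [Ioo_mem_nhds h0.1 h0.2] with t ht
        exact (hlev t ht z hzK hz).1
      have h7 := h5.unique h6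
      rw [map_add, map_smul, smul_eq_mul] at h7
      have h8 : σ = -(fderiv ℝ ρ (f z) (V z) / fderiv ℝ ρ (f z) e) := by
        have := hne z hzU hz
        field_simp
        linarith
      rw [h8, neg_smul, ← sub_eq_add_neg] at h4
      exact h4
    · simp only [hF, if_neg hzK, hVK z hz hzK, map_zero, zero_div, zero_smul, sub_zero]
      exact hasDerivAt_const _ _

end DbarDisk

namespace DbarDisk

open Complex Set Metric MeasureTheory Filter Asymptotics

/-! ### Second-order Taylor expansions -/

section Taylor

variable {E : Type*} [NormedAddCommGroup E] [NormedSpace ℝ E]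

lemma isSymmSndFDerivAt_of_contDiff {E' : Type*} [NormedAddCommGroup E'] [NormedSpace ℝ E']
    {ρ : E → E'} {p : E} (hρ : ContDiffAt ℝ 2 ρ p) : IsSymmSndFDerivAt ℝ ρ p :=
  hρ.isSymmSndFDerivAt (by simp)

/-- The remainder has derivative dρ(x) − dρ(p) − D²ρ(p)(x − p), by symmetry of the Hessian. This is
o(|x − p|), and the mean value inequality on the segment gains one more power. -/
lemma isLittleO_taylor_two {ρ : E → ℝ} (hρ : ContDiff ℝ 2 ρ) (p : E) :
    (fun x => ρ x - ρ p - fderiv ℝ ρ p (x - p)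
      - (1 / 2) * fderiv ℝ (fderiv ℝ ρ) p (x - p) (x - p)) =o[𝓝 p] fun x => ‖x - p‖ ^ 2 := by
  have hsym := isSymmSndFDerivAt_of_contDiff hρ.contDiffAt (p := p)
  have hd2 : HasFDerivAt (fderiv ℝ ρ) (fderiv ℝ (fderiv ℝ ρ) p) p :=
    ((hρ.fderiv_right (m := 1) (by norm_num)).differentiable one_ne_zero p).hasFDerivAt
  set B := fderiv ℝ (fderiv ℝ ρ) p with hB
  refine isLittleO_iff.2 fun c hc => ?_
  have h1 := isLittleO_iff.1 hd2.isLittleO hc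
  obtain ⟨δ, hδ, hδ'⟩ := Metric.eventually_nhds_iff_ball.1 h1
  filter_upwards [ball_mem_nhds p hδ] with q hq
  have hsub : segment ℝ p q ⊆ ball p δ :=
    (convex_ball p δ).segment_subset (mem_ball_self hδ) hq
  have hseg : ∀ x ∈ segment ℝ p q, ‖x - p‖ ≤ ‖q - p‖ := by
    rintro x hx
    rw [segment_eq_image'] at hx
    obtain ⟨s, hs, rfl⟩ := hx
    rw [add_sub_cancel_left, norm_smul, Real.norm_eq_abs, abs_of_nonneg hs.1]
    exact mul_le_of_le_one_left (norm_nonneg _) hs.2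
  set ψ : E → ℝ := fun x => ρ x - fderiv ℝ ρ p (x - p) - (1 / 2) * B (x - p) (x - p) with hψ
  have hψd : ∀ x, HasFDerivAt ψ (fderiv ℝ ρ x - fderiv ℝ ρ p - B (x - p)) x := by
    intro x
    have hsubd : HasFDerivAt (fun x : E => x - p) (ContinuousLinearMap.id ℝ E) x :=
      (hasFDerivAt_id x).sub_const p
    have e1 : HasFDerivAt ρ (fderiv ℝ ρ x) x := (hρ.differentiable two_ne_zero x).hasFDerivAt
    have e2 := (fderiv ℝ ρ p).hasFDerivAt.comp x hsubd
    have e3 := ((B.hasFDerivAt.comp x hsubd).clm_apply hsubd).const_mul (1 / 2 : ℝ)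
    refine ((e1.sub e2).sub e3).congr_fderiv ?_
    ext v
    have := hsym v (x - p)
    simp only [← hB, map_sub, sub_apply] at this
    simp
    linear_combination (1 / 2 : ℝ) * this
  have hmv := (convex_segment p q).norm_image_sub_le_of_norm_hasFDerivWithin_le
    (f := ψ) (C := c * ‖q - p‖) (fun x hx => (hψd x).hasFDerivWithinAt)
    (fun x hx => (hδ' x (hsub hx)).trans (by gcongr; exact hseg x hx))
    (left_mem_segment ℝ p q) (right_mem_segment ℝ p q)
  have e : ψ q - ψ p = ρ q - ρ p - fderiv ℝ ρ p (q - p) - (1 / 2) * B (q - p) (q - p) := by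
    simp [hψ]; ring
  rw [e] at hmv
  rw [Real.norm_of_nonneg (sq_nonneg ‖q - p‖), sq, ← mul_assoc]
  exact hmv

/-- On a curve inside a level set the first-order Taylor term must balance the Hessian term. Only
the first derivative of the curve at 0 enters; no acceleration is needed. -/
lemma tendsto_fderiv_sub_div_sq {ρ : E → ℝ} (hρ : ContDiff ℝ 2 ρ) {q : ℝ → E} {X : E}
    (hq : HasDerivAt q X 0) (hlev : ∀ᶠ t in 𝓝 0, ρ (q t) = ρ (q 0)) :
    Tendsto (fun t : ℝ => fderiv ℝ ρ (q 0) (q t - q 0) / t ^ 2) (𝓝[≠] 0)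
      (𝓝 (-(1 / 2) * fderiv ℝ (fderiv ℝ ρ) (q 0) X X)) := by
  set p := q 0
  set B := fderiv ℝ (fderiv ℝ ρ) p with hB
  have h1 := (isLittleO_taylor_two hρ p).comp_tendsto hq.continuousAt.tendsto
  have h2 : (fun t => q t - p) =O[𝓝 0] fun t : ℝ => t := by
    simpa using hq.hasFDerivAt.isBigO_sub
  have h3 : (fun t => ‖q t - p‖ ^ 2) =O[𝓝 0] fun t : ℝ => t ^ 2 := h2.norm_left.pow 2
  have h4 := ((h1.trans_isBigO h3).mono (nhdsWithin_le_nhds (s := {0}ᶜ))).tendsto_div_nhds_zero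
  have h5 : Tendsto (fun t : ℝ => t⁻¹ • (q t - p)) (𝓝[≠] 0) (𝓝 X) := by
    have := hasDerivAt_iff_tendsto_slope_zero.1 hq
    simpa using this
  have h6 : Tendsto (fun t : ℝ => B (t⁻¹ • (q t - p)) (t⁻¹ • (q t - p))) (𝓝[≠] 0)
      (𝓝 (B X X)) :=
    ((B.continuous.clm_apply continuous_id).tendsto X).comp h5
  have h7 := (h6.const_mul (-(1 / 2) : ℝ)).sub h4
  rw [sub_zero] at h7
  refine h7.congr' ?_
  filter_upwards [self_mem_nhdsWithin, nhdsWithin_le_nhds hlev] with t ht hl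
  have ht : t ≠ 0 := ht
  simp only [Function.comp, map_smul, smul_apply, smul_eq_mul]
  rw [hl]
  field_simp
  ring

/-- Uniform counterpart of `tendsto_fderiv_sub_div_sq`, from the Lipschitz bound for dρ on a ball;
it supplies the dominating constant in `tendsto_dbarEnergy_second`. -/
lemma exists_abs_fderiv_sub_le [ProperSpace E] {ρ : E → ℝ} (hρ : ContDiff ℝ 2 ρ) {s : Set E}
    (hs : Bornology.IsBounded s) :
    ∃ M : ℝ, 0 ≤ M ∧ ∀ p ∈ s, ∀ q ∈ s, ρ q = ρ p → |fderiv ℝ ρ p (q - p)| ≤ M * ‖q - p‖ ^ 2 := by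
  obtain ⟨R, hR⟩ := hs.subset_closedBall 0
  have hd : ContDiff ℝ 1 (fderiv ℝ ρ) := hρ.fderiv_right (by norm_num)
  obtain ⟨M, hM⟩ := (hd.contDiffOn.locallyLipschitzOn
    (convex_closedBall (0 : E) R)).exists_lipschitzOnWith_of_compact (isCompact_closedBall 0 R)
  refine ⟨M, M.2, fun p hp q hq hpq => ?_⟩
  have hsub : segment ℝ p q ⊆ closedBall 0 R :=
    (convex_closedBall 0 R).segment_subset (hR hp) (hR hq)
  have hmv := (convex_segment p q).norm_image_sub_le_of_norm_hasFDerivWithin_le'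
    (f := ρ) (C := M * ‖q - p‖) (φ := fderiv ℝ ρ p)
    (fun x hx => ((hρ.differentiable two_ne_zero x).hasFDerivAt).hasFDerivWithinAt)
    (fun x hx => by
      have h1 := hM.dist_le_mul x (hsub hx) p (hR hp)
      rw [dist_eq_norm, dist_eq_norm] at h1
      refine h1.trans (by
        gcongr
        rw [segment_eq_image'] at hx
        obtain ⟨s, hs, rfl⟩ := hx
        rw [add_sub_cancel_left, norm_smul, Real.norm_eq_abs, abs_of_nonneg hs.1]
        exact mul_le_of_le_one_left (norm_nonneg _) hs.2))
    (left_mem_segment ℝ p q) (right_mem_segment ℝ p q)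
  rw [hpq, sub_self, zero_sub, norm_neg] at hmv
  rw [sq, ← mul_assoc]
  exact hmv

end Taylor

/-! ### First-order expansion of a deformation -/

variable {n : ℕ}

section Deformation

variable {ε : ℝ} {F : ℝ → ℂ → Cn n} {X : ℂ → Cn n}

lemma uniqueDiffOn_Ioo_prod_disk : UniqueDiffOn ℝ (Ioo (-ε) ε ×ˢ disk) :=
  (uniqueDiffOn_Ioo _ _).prod uniqueDiffOn_disk

/-- The linear map sending the differential of `F` to `∂F/∂z̄`. -/
def dbarPart (A : ℝ × ℂ →L[ℝ] Cn n) : Cn n :=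
  (1 / 2 : ℂ) • (A (0, 1) + I • A (0, I))

lemma norm_dbarPart_le (A : ℝ × ℂ →L[ℝ] Cn n) : ‖dbarPart A‖ ≤ ‖A‖ := by
  have h1 : ‖A (0, 1)‖ ≤ ‖A‖ := by simpa using A.le_opNorm (0, 1)
  have h2 : ‖A (0, I)‖ ≤ ‖A‖ := by simpa using A.le_opNorm (0, I)
  rw [dbarPart, norm_smul]
  have h3 : ‖A (0, 1) + I • A (0, I)‖ ≤ ‖A‖ + ‖A‖ :=
    (norm_add_le _ _).trans (add_le_add h1 (by rw [norm_smul]; simpa using h2))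
  norm_num
  linarith

lemma dbarPart_sub (A B : ℝ × ℂ →L[ℝ] Cn n) : dbarPart (A - B) = dbarPart A - dbarPart B := by
  simp only [dbarPart, sub_apply]
  module

lemma fderivWithin_slice (hF : ContDiffOn ℝ 2 (Function.uncurry F) (Ioo (-ε) ε ×ˢ disk))
    {t : ℝ} (ht : t ∈ Ioo (-ε) ε) {z : ℂ} (hz : z ∈ disk) (v : ℂ) :
    fderivWithin ℝ (F t) disk z v
      = fderivWithin ℝ (Function.uncurry F) (Ioo (-ε) ε ×ˢ disk) (t, z) (0, v) := by
  have h1 := (hF.differentiableOn two_ne_zero (t, z) ⟨ht, hz⟩).hasFDerivWithinAt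
  have h2 : HasFDerivWithinAt (fun w : ℂ => (t, w))
      ((0 : ℂ →L[ℝ] ℝ).prod (ContinuousLinearMap.id ℝ ℂ)) disk z :=
    (hasFDerivWithinAt_const t z disk).prodMk (hasFDerivWithinAt_id z disk)
  have h3 := h1.comp z h2 (fun w hw => ⟨ht, hw⟩)
  have h4 := h3.fderivWithin (uniqueDiffOn_disk z hz)
  change fderivWithin ℝ (F t) disk z = _ at h4
  rw [h4]; rfl

lemma dbar_slice (hF : ContDiffOn ℝ 2 (Function.uncurry F) (Ioo (-ε) ε ×ˢ disk))
    {t : ℝ} (ht : t ∈ Ioo (-ε) ε) {z : ℂ} (hz : z ∈ disk) :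
    dbar (F t) z
      = dbarPart (fderivWithin ℝ (Function.uncurry F) (Ioo (-ε) ε ×ˢ disk) (t, z)) := by
  simp only [dbar, dirDeriv, dbarPart, fderivWithin_slice hF ht hz]

lemma contDiffOn_slice (hF : ContDiffOn ℝ 2 (Function.uncurry F) (Ioo (-ε) ε ×ˢ disk))
    {t : ℝ} (ht : t ∈ Ioo (-ε) ε) : ContDiffOn ℝ 2 (F t) disk :=
  hF.comp (contDiff_const.prodMk contDiff_id).contDiffOn fun _ hz => ⟨ht, hz⟩

/-- Both F and its differential are C¹, hence Lipschitz on the compact convex set |t| ≤ ε/2, z in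
the closed disk. These bounds dominate the difference quotients below. -/
lemma exists_norm_sub_le (hε : 0 < ε)
    (hF : ContDiffOn ℝ 2 (Function.uncurry F) (Ioo (-ε) ε ×ˢ disk)) :
    ∃ δ > 0, δ < ε ∧ ∃ C : ℝ, 0 ≤ C ∧ ∀ t, |t| ≤ δ → ∀ z ∈ disk,
      ‖F t z - F 0 z‖ ≤ C * |t| ∧ ‖dbar (F t) z - dbar (F 0) z‖ ≤ C * |t| := by
  set s := Ioo (-ε) ε ×ˢ disk with hs
  set T := Icc (-(ε / 2)) (ε / 2) ×ˢ disk with hT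
  have hTs : T ⊆ s := prod_mono (fun t ht => ⟨by linarith [ht.1], by linarith [ht.2]⟩) subset_rfl
  have hTc : IsCompact T := isCompact_Icc.prod isCompact_disk
  have hTconv : Convex ℝ T := (convex_Icc _ _).prod convex_disk
  have hD : ContDiffOn ℝ 1 (fderivWithin ℝ (Function.uncurry F) s) s :=
    hF.fderivWithin uniqueDiffOn_Ioo_prod_disk (by norm_num)
  obtain ⟨C₁, hC₁⟩ := (((hF.of_le one_le_two).mono hTs).locallyLipschitzOn
    hTconv).exists_lipschitzOnWith_of_compact hTc
  obtain ⟨C₂, hC₂⟩ := ((hD.mono hTs).locallyLipschitzOn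
    hTconv).exists_lipschitzOnWith_of_compact hTc
  refine ⟨ε / 2, by linarith, by linarith, C₁ + C₂, by positivity, fun t ht z hz => ?_⟩
  have ht' := abs_le.1 ht
  have hm : (t, z) ∈ T := ⟨ht', hz⟩
  have hm0 : ((0 : ℝ), z) ∈ T := ⟨⟨by linarith, by linarith⟩, hz⟩
  have hdist : dist (t, z) ((0 : ℝ), z) = |t| := by
    rw [Prod.dist_eq, dist_self, Real.dist_eq, sub_zero]; exact max_eq_left (abs_nonneg t)
  have h1 := hC₁.dist_le_mul _ hm _ hm0
  have h2 := hC₂.dist_le_mul _ hm _ hm0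
  rw [hdist, dist_eq_norm] at h1 h2
  have hC₁0 : (0 : ℝ) ≤ C₁ * |t| := by positivity
  have hC₂0 : (0 : ℝ) ≤ C₂ * |t| := by positivity
  constructor
  · refine (show ‖F t z - F 0 z‖ ≤ _ from h1).trans (by linarith)
  · rw [dbar_slice hF (hTs hm).1 hz, dbar_slice hF (hTs hm0).1 hz, ← dbarPart_sub]
    exact (norm_dbarPart_le _).trans (h2.trans (by linarith))

lemma velocity_eq (hε : 0 < ε) (hF : ContDiffOn ℝ 2 (Function.uncurry F) (Ioo (-ε) ε ×ˢ disk))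
    (hX : ∀ z ∈ disk, HasDerivAt (fun t => F t z) (X z) 0) {z : ℂ} (hz : z ∈ disk) :
    X z = fderivWithin ℝ (Function.uncurry F) (Ioo (-ε) ε ×ˢ disk) (0, z) (1, 0) := by
  have h0 : (0 : ℝ) ∈ Ioo (-ε) ε := ⟨by linarith, hε⟩
  have h1 := (hF.differentiableOn two_ne_zero (0, z) ⟨h0, hz⟩).hasFDerivWithinAt
  have h2 : HasDerivWithinAt (fun t : ℝ => (t, z)) (1, (0 : ℂ)) (Ioo (-ε) ε) 0 :=
    (hasDerivWithinAt_id 0 _).prodMk (hasDerivWithinAt_const 0 _ z)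
  have hm : MapsTo (fun t : ℝ => (t, z)) (Ioo (-ε) ε) (Ioo (-ε) ε ×ˢ disk) :=
    fun t ht => ⟨ht, hz⟩
  have h3 := (h1.comp_hasDerivWithinAt (0 : ℝ) h2 hm).hasDerivAt
    (Ioo_mem_nhds h0.1 h0.2)
  exact (hX z hz).unique h3

lemma contDiffOn_velocity (hε : 0 < ε)
    (hF : ContDiffOn ℝ 2 (Function.uncurry F) (Ioo (-ε) ε ×ˢ disk))
    (hX : ∀ z ∈ disk, HasDerivAt (fun t => F t z) (X z) 0) : ContDiffOn ℝ 1 X disk := by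
  have h0 : (0 : ℝ) ∈ Ioo (-ε) ε := ⟨by linarith, hε⟩
  have hD : ContDiffOn ℝ 1 (fderivWithin ℝ (Function.uncurry F) (Ioo (-ε) ε ×ˢ disk))
      (Ioo (-ε) ε ×ˢ disk) := hF.fderivWithin uniqueDiffOn_Ioo_prod_disk (by norm_num)
  have h1 : ContDiffOn ℝ 1 (fun z : ℂ => ((0 : ℝ), z)) disk :=
    (contDiff_const.prodMk contDiff_id).contDiffOn
  have h2 : MapsTo (fun z : ℂ => ((0 : ℝ), z)) disk (Ioo (-ε) ε ×ˢ disk) :=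
    fun z hz => ⟨h0, hz⟩
  exact ((hD.comp h1 h2).clm_apply contDiffOn_const).congr
    fun z hz => velocity_eq hε hF hX hz

/-- Mixed partial derivatives commute. Interior points suffice, since the energy is an integral over
the open disk. -/
lemma hasDerivAt_dbar (hε : 0 < ε)
    (hF : ContDiffOn ℝ 2 (Function.uncurry F) (Ioo (-ε) ε ×ˢ disk))
    (hX : ∀ z ∈ disk, HasDerivAt (fun t => F t z) (X z) 0) {z : ℂ} (hz : z ∈ ball (0 : ℂ) 1) :
    HasDerivAt (fun t => dbar (F t) z) (dbar X z) 0 := by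
  have h0 : (0 : ℝ) ∈ Ioo (-ε) ε := ⟨by linarith, hε⟩
  set G := Function.uncurry F with hG
  set s₀ : Set (ℝ × ℂ) := Ioo (-ε) ε ×ˢ ball (0 : ℂ) 1 with hs₀
  have hs₀o : IsOpen s₀ := isOpen_Ioo.prod isOpen_ball
  have hnhds : ∀ x ∈ s₀, Ioo (-ε) ε ×ˢ disk ∈ 𝓝 x := fun x hx =>
    mem_of_superset (hs₀o.mem_nhds hx) (prod_mono subset_rfl ball_subset_disk)
  have hDeq : ∀ x ∈ s₀, fderivWithin ℝ G (Ioo (-ε) ε ×ˢ disk) x = fderiv ℝ G x := fun x hx =>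
    fderivWithin_of_mem_nhds (hnhds x hx)
  have hm : ((0 : ℝ), z) ∈ s₀ := ⟨h0, hz⟩
  have hGc : ContDiffAt ℝ 2 G (0, z) := hF.contDiffAt (hnhds _ hm)
  have hsym := isSymmSndFDerivAt_of_contDiff hGc
  have hd2 : HasFDerivAt (fderiv ℝ G) (fderiv ℝ (fderiv ℝ G) (0, z)) (0, z) :=
    ((hGc.fderiv_right (m := 1) (by norm_num)).differentiableAt one_ne_zero).hasFDerivAt
  set H := fderiv ℝ (fderiv ℝ G) (0, z) with hH
  have hXd : HasFDerivAt X (((ContinuousLinearMap.apply ℝ (Cn n) ((1 : ℝ), (0 : ℂ))).comp H).comp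
      ((0 : ℂ →L[ℝ] ℝ).prod (ContinuousLinearMap.id ℝ ℂ))) z := by
    have e1 : HasFDerivAt (fun w : ℂ => ((0 : ℝ), w))
        ((0 : ℂ →L[ℝ] ℝ).prod (ContinuousLinearMap.id ℝ ℂ)) z :=
      (hasFDerivAt_const (0 : ℝ) z).prodMk (hasFDerivAt_id z)
    have e2 := (((ContinuousLinearMap.apply ℝ (Cn n) ((1 : ℝ), (0 : ℂ))).hasFDerivAt).comp
      ((0 : ℝ), z) hd2).comp z e1
    refine e2.congr_of_eventuallyEq ?_
    filter_upwards [isOpen_ball.mem_nhds hz] with w hw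
    rw [velocity_eq hε hF hX (ball_subset_disk hw), hDeq (0, w) ⟨h0, hw⟩]
    rfl
  have hXv : ∀ v, fderivWithin ℝ X disk z v = H (1, 0) (0, v) := fun v => by
    rw [fderivWithin_disk hz, hXd.fderiv, hsym (1, 0) (0, v)]
    rfl
  have hcurve : HasDerivAt (fun t : ℝ => (t, z)) ((1 : ℝ), (0 : ℂ)) 0 :=
    (hasDerivAt_id (0 : ℝ)).prodMk (hasDerivAt_const (0 : ℝ) z)
  have hAd : HasDerivAt (fun t : ℝ => fderiv ℝ G (t, z)) (H (1, 0)) 0 :=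
    HasFDerivAt.comp_hasDerivAt (0 : ℝ) hd2 hcurve
  have hv : ∀ v : ℂ, HasDerivAt (fun t : ℝ => fderiv ℝ G (t, z) (0, v)) (H (1, 0) (0, v)) 0 :=
    fun v => by simpa using hAd.clm_apply (hasDerivAt_const (0 : ℝ) ((0 : ℝ), v))
  have hfin := ((hv 1).add ((hv I).const_smul I)).const_smul (1 / 2 : ℂ)
  have hval : dbar X z = (1 / 2 : ℂ) • (H (1, 0) (0, 1) + I • H (1, 0) (0, I)) := by
    simp only [dbar, dirDeriv, hXv]
  rw [hval]
  refine hfin.congr_of_eventuallyEq ?_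
  filter_upwards [Ioo_mem_nhds h0.1 h0.2] with t ht
  rw [dbar_slice hF ht (ball_subset_disk hz), ← hG, hDeq (t, z) ⟨ht, hz⟩]
  rfl

end Deformation

end DbarDisk

namespace DbarDisk

open Complex Set Metric MeasureTheory Filter Asymptotics

/-! ### Expansion of the energy along a deformation of a critical disk -/

variable {n : ℕ}

lemma continuous_re_circleMap_mul_inner {P w : ℂ → Cn n} (hP : ContinuousOn P disk)
    (hw : ContinuousOn w disk) : Continuous fun θ : ℝ =>
      (circleMap 0 1 θ * inner ℂ (P (circleMap 0 1 θ)) (w (circleMap 0 1 θ))).re :=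
  Complex.continuous_re.comp <| continuous_comp_circleMap (g := fun z => z * inner ℂ (P z) (w z))
    ((continuousOn_id.mul (hP.inner hw)).mono sphere_subset_disk)

/-- The energy is quadratic, and Green's formula turns the cross term into a boundary integral
because ∂f/∂z̄ is antiholomorphic. The expansion is exact, and it yields both the first and the
second variation. -/
lemma dbarEnergy_eq_add {f g : ℂ → Cn n} (hf : ContDiffOn ℝ ∞ f disk)
    (hPa : IsAntiholomorphic (dbar f)) (hg : ContDiffOn ℝ 1 g disk) :
    dbarEnergy g = dbarEnergy f
      + (∫ θ in (0 : ℝ)..2 * Real.pi, (circleMap 0 1 θ *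
          inner ℂ (dbar f (circleMap 0 1 θ)) (g (circleMap 0 1 θ) - f (circleMap 0 1 θ))).re)
      + dbarEnergy (fun z => g z - f z) := by
  have hf1 : ContDiffOn ℝ 1 f disk := hf.of_le (by simp)
  have hP : ContDiffOn ℝ 1 (dbar f) disk := contDiffOn_dbar hf one_add_one_le_infty
  have hu : ContDiffOn ℝ 1 (fun z => g z - f z) disk := hg.sub hf1
  have h1 := dbarEnergy_add hf1 hu
  have h2 : (fun z => f z + (g z - f z)) = g := by funext z; simp
  rw [h2] at h1
  have h3 := integral_inner_dbar hP hu hPa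
  have h4 : 2 * (∫ z in ball (0 : ℂ) 1, inner ℂ (dbar f z) (dbar (fun z => g z - f z) z)).re
      = (2 * ∫ z in ball (0 : ℂ) 1, inner ℂ (dbar f z) (dbar (fun z => g z - f z) z)).re := by
    simp
  rw [h1, h4, h3]
  congr 2
  have hc : Continuous fun θ : ℝ => circleMap 0 1 θ *
      inner ℂ (dbar f (circleMap 0 1 θ)) (g (circleMap 0 1 θ) - f (circleMap 0 1 θ)) :=
    continuous_comp_circleMap (g := fun z => z * inner ℂ (dbar f z) (g z - f z))
      ((continuousOn_id.mul (hP.continuousOn.inner hu.continuousOn)).mono sphere_subset_disk)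
  exact (intervalIntegral.intervalIntegral_re (𝕜 := ℂ) (hc.intervalIntegrable _ _)).symm

section Deformation

variable {f : ℂ → Cn n} {ε : ℝ} {F : ℝ → ℂ → Cn n} {X : ℂ → Cn n}

lemma tendsto_inv_smul_sub (hF0 : EqOn (F 0) f disk)
    (hX : ∀ z ∈ disk, HasDerivAt (fun t => F t z) (X z) 0) {z : ℂ} (hz : z ∈ disk) :
    Tendsto (fun t : ℝ => t⁻¹ • (F t z - f z)) (𝓝[≠] 0) (𝓝 (X z)) := by
  have := hasDerivAt_iff_tendsto_slope_zero.1 (hX z hz)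
  simpa [hF0 hz] using this

lemma dbar_sub {f u : ℂ → Cn n} {z : ℂ} (hz : z ∈ disk) (hf : ContDiffOn ℝ 1 f disk)
    (hu : ContDiffOn ℝ 1 u disk) : dbar (fun z => f z - u z) z = dbar f z - dbar u z := by
  have := dbar_add hz (hf.sub hu) hu
  simp only [sub_add_cancel] at this
  rw [this, add_sub_cancel_right]

lemma eventually_mem_Ioo (hε : 0 < ε) : ∀ᶠ t in 𝓝[≠] (0 : ℝ), t ∈ Ioo (-ε) ε :=
  nhdsWithin_le_nhds (Ioo_mem_nhds (by linarith) hε)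

lemma eventually_abs_le {δ : ℝ} (hδ : 0 < δ) : ∀ᶠ t in 𝓝[≠] (0 : ℝ), |t| ≤ δ := by
  filter_upwards [eventually_mem_Ioo hδ] with t ht
  exact (abs_lt.2 ht).le

lemma tendsto_dbarEnergy_sub_div_sq (hf : ContDiffOn ℝ ∞ f disk) (hε : 0 < ε)
    (hF : ContDiffOn ℝ 2 (Function.uncurry F) (Ioo (-ε) ε ×ˢ disk)) (hF0 : EqOn (F 0) f disk)
    (hX : ∀ z ∈ disk, HasDerivAt (fun t => F t z) (X z) 0) :
    Tendsto (fun t : ℝ => dbarEnergy (fun z => F t z - f z) / t ^ 2) (𝓝[≠] 0)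
      (𝓝 (dbarEnergy X)) := by
  have hf1 : ContDiffOn ℝ 1 f disk := hf.of_le (by simp)
  obtain ⟨δ, hδ, hδε, C, hC0, hC⟩ := exists_norm_sub_le hε hF
  have hFt : ∀ t ∈ Ioo (-ε) ε, ContDiffOn ℝ 1 (F t) disk := fun t ht =>
    (contDiffOn_slice hF ht).of_le one_le_two
  have heq : ∀ t, dbarEnergy (fun z => F t z - f z) / t ^ 2
      = ∫ z in ball (0 : ℂ) 1, ‖dbar (fun z => F t z - f z) z‖ ^ 2 / t ^ 2 := fun t => by
    rw [dbarEnergy, integral_div]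
  simp only [heq]
  refine tendsto_integral_filter_of_dominated_convergence (fun _ => C ^ 2) ?_ ?_ ?_ ?_
  · filter_upwards [eventually_mem_Ioo hε] with t ht
    exact (integrableOn_ball_of_continuousOn
      (((continuousOn_dbar ((hFt t ht).sub hf1)).norm.pow 2).div_const _)).aestronglyMeasurable
  · filter_upwards [eventually_mem_Ioo hε, eventually_abs_le hδ, self_mem_nhdsWithin]
      with t ht htδ ht0
    refine (ae_restrict_iff' measurableSet_ball).2 (Eventually.of_forall fun z hz => ?_)
    have hz' := ball_subset_disk hz
    have h1 := (hC t htδ z hz').2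
    rw [dbar_congr hF0 hz', ← dbar_sub hz' (hFt t ht) hf1] at h1
    have ht0' : 0 < t ^ 2 := by have : t ≠ 0 := ht0; positivity
    rw [Real.norm_of_nonneg (by positivity), div_le_iff₀ ht0', ← sq_abs t, ← mul_pow]
    gcongr
  · exact integrableOn_const (by exact measure_ball_lt_top.ne)
  · refine (ae_restrict_iff' measurableSet_ball).2 (Eventually.of_forall fun z hz => ?_)
    have hz' := ball_subset_disk hz
    have h1 := hasDerivAt_iff_tendsto_slope_zero.1 (hasDerivAt_dbar hε hF hX hz)
    refine (h1.norm.pow 2).congr' ?_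
    filter_upwards [eventually_mem_Ioo hε] with t ht
    simp only [zero_add]
    rw [dbar_congr hF0 hz', dbar_sub hz' (hFt t ht) hf1, norm_smul, mul_pow, norm_inv,
      Real.norm_eq_abs, inv_pow, sq_abs, inv_mul_eq_div]

lemma hasDerivAt_dbarEnergy (hf : ContDiffOn ℝ ∞ f disk)
    (hPa : IsAntiholomorphic (dbar f)) (hε : 0 < ε)
    (hF : ContDiffOn ℝ 2 (Function.uncurry F) (Ioo (-ε) ε ×ˢ disk)) (hF0 : EqOn (F 0) f disk)
    (hX : ∀ z ∈ disk, HasDerivAt (fun t => F t z) (X z) 0) :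
    HasDerivAt (fun t => dbarEnergy (F t))
      (∫ θ in (0 : ℝ)..2 * Real.pi, (circleMap 0 1 θ *
          inner ℂ (dbar f (circleMap 0 1 θ)) (X (circleMap 0 1 θ))).re) 0 := by
  have hP : ContinuousOn (dbar f) disk := continuousOn_dbar (hf.of_le (by simp))
  obtain ⟨δ, hδ, hδε, C, hC0, hC⟩ := exists_norm_sub_le hε hF
  obtain ⟨M, hM⟩ := isCompact_disk.exists_bound_of_continuousOn hP
  have hFt : ∀ t ∈ Ioo (-ε) ε, ContDiffOn ℝ 1 (F t) disk := fun t ht =>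
    (contDiffOn_slice hF ht).of_le one_le_two
  have hlin : Tendsto (fun t : ℝ => ∫ θ in (0 : ℝ)..2 * Real.pi, (circleMap 0 1 θ *
      inner ℂ (dbar f (circleMap 0 1 θ))
        (t⁻¹ • (F t (circleMap 0 1 θ) - f (circleMap 0 1 θ)))).re) (𝓝[≠] 0)
      (𝓝 (∫ θ in (0 : ℝ)..2 * Real.pi, (circleMap 0 1 θ *
          inner ℂ (dbar f (circleMap 0 1 θ)) (X (circleMap 0 1 θ))).re)) := by
    refine intervalIntegral.tendsto_integral_filter_of_dominated_convergence
      (fun _ => M * C) ?_ ?_ (intervalIntegrable_const) ?_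
    · filter_upwards [eventually_mem_Ioo hε] with t ht
      have hc : ContinuousOn (fun z => t⁻¹ • (F t z - f z)) disk :=
        ((hFt t ht).continuousOn.sub hf.continuousOn).const_smul t⁻¹
      exact (continuous_re_circleMap_mul_inner hP hc).aestronglyMeasurable
    · filter_upwards [eventually_abs_le hδ, self_mem_nhdsWithin] with t htδ ht0
      refine Eventually.of_forall fun θ _ => ?_
      have hz := circleMap_mem_disk θ
      have h1 := (hC t htδ _ hz).1
      rw [hF0 hz] at h1
      have ht0' : 0 < |t| := abs_pos.2 ht0
      have h2 : ‖t⁻¹ • (F t (circleMap 0 1 θ) - f (circleMap 0 1 θ))‖ ≤ C := by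
        rw [norm_smul, norm_inv, Real.norm_eq_abs, inv_mul_le_iff₀ ht0', mul_comm]
        exact h1
      calc _ ≤ ‖circleMap 0 1 θ * inner ℂ (dbar f (circleMap 0 1 θ))
            (t⁻¹ • (F t (circleMap 0 1 θ) - f (circleMap 0 1 θ)))‖ := Complex.abs_re_le_norm _
        _ ≤ 1 * (‖dbar f (circleMap 0 1 θ)‖ *
            ‖t⁻¹ • (F t (circleMap 0 1 θ) - f (circleMap 0 1 θ))‖) := by
          rw [norm_mul, norm_circleMap_zero, abs_one]
          gcongr
          exact norm_inner_le_norm _ _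
        _ ≤ M * C := by
          rw [one_mul]
          gcongr
          · exact (norm_nonneg _).trans (hM _ hz)
          · exact hM _ hz
    · refine Eventually.of_forall fun θ _ => ?_
      have h1 := tendsto_inv_smul_sub hF0 hX (circleMap_mem_disk θ)
      have hc : Continuous fun v : Cn n =>
          (circleMap 0 1 θ * inner ℂ (dbar f (circleMap 0 1 θ)) v).re := by fun_prop
      exact (hc.tendsto _).comp h1
  have hquad := tendsto_dbarEnergy_sub_div_sq hf hε hF hF0 hX
  have hid : Tendsto (fun t : ℝ => t) (𝓝[≠] 0) (𝓝 0) := nhdsWithin_le_nhds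
  have hsum := hlin.add (hid.mul hquad)
  rw [zero_mul, add_zero] at hsum
  rw [hasDerivAt_iff_tendsto_slope_zero]
  refine hsum.congr' ?_
  filter_upwards [eventually_mem_Ioo hε, self_mem_nhdsWithin] with t ht ht0
  have ht0 : t ≠ 0 := ht0
  rw [zero_add, dbarEnergy_eq_add hf hPa (hFt t ht), dbarEnergy_congr hF0]
  have : (∫ θ in (0 : ℝ)..2 * Real.pi, (circleMap 0 1 θ *
      inner ℂ (dbar f (circleMap 0 1 θ))
        (t⁻¹ • (F t (circleMap 0 1 θ) - f (circleMap 0 1 θ)))).re)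
      = t⁻¹ * ∫ θ in (0 : ℝ)..2 * Real.pi, (circleMap 0 1 θ *
          inner ℂ (dbar f (circleMap 0 1 θ))
            (F t (circleMap 0 1 θ) - f (circleMap 0 1 θ))).re := by
    rw [← intervalIntegral.integral_const_mul]
    congr 1; funext θ
    rw [← Complex.coe_smul, inner_smul_right, mul_left_comm, re_ofReal_mul]
  rw [this, smul_eq_mul]
  field_simp
  ring

/-- On the circle the linear term of `dbarEnergy_eq_add` is μ dρ(F_t − f). Since F_t and f both lie
on ∂N, it is of second order in t, with limit given by the Hessian. In this way deformations of
class C² suffice. -/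
lemma tendsto_dbarEnergy_second {k : ℕ∞} (hk : 2 ≤ k) {N : Set (Cn n)} {ρ : Cn n → ℝ}
    (hN : IsStrictlyPseudoconvex k N ρ) (hf : ContDiffOn ℝ ∞ f disk) (hfN : IsDiskIn N f)
    (hPa : IsAntiholomorphic (dbar f)) {μ : ℂ → ℝ} (hμc : ContinuousOn μ (sphere 0 1))
    (hμ : ∀ z ∈ sphere (0 : ℂ) 1, ∀ w : Cn n,
      (z * inner ℂ (dbar f z) w).re = μ z * fderiv ℝ ρ (f z) w)
    (hε : 0 < ε)
    (hF : ContDiffOn ℝ 2 (Function.uncurry F) (Ioo (-ε) ε ×ˢ disk)) (hF0 : EqOn (F 0) f disk)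
    (hFN : ∀ t ∈ Ioo (-ε) ε, IsDiskIn N (F t))
    (hX : ∀ z ∈ disk, HasDerivAt (fun t => F t z) (X z) 0) :
    Tendsto (fun t : ℝ => (dbarEnergy (F t) - dbarEnergy f) / t ^ 2) (𝓝[≠] 0)
      (𝓝 ((∫ θ in (0 : ℝ)..2 * Real.pi, μ (circleMap 0 1 θ) *
          (-(1 / 2) * fderiv ℝ (fderiv ℝ ρ) (f (circleMap 0 1 θ))
            (X (circleMap 0 1 θ)) (X (circleMap 0 1 θ)))) + dbarEnergy X)) := by
  have hρ2 : ContDiff ℝ 2 ρ := hN.contDiff.of_le (two_le_coe hk)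
  have hP : ContinuousOn (dbar f) disk := continuousOn_dbar (hf.of_le (by simp))
  obtain ⟨δ, hδ, hδε, C, hC0, hC⟩ := exists_norm_sub_le hε hF
  obtain ⟨A, hA⟩ := (isCompact_sphere (0 : ℂ) 1).exists_bound_of_continuousOn hμc
  obtain ⟨M, hM0, hM⟩ := exists_abs_fderiv_sub_le hρ2 hN.bounded.closure
  have hFt : ∀ t ∈ Ioo (-ε) ε, ContDiffOn ℝ 1 (F t) disk := fun t ht =>
    (contDiffOn_slice hF ht).of_le one_le_two
  have hlev : ∀ t ∈ Ioo (-ε) ε, ∀ z ∈ sphere (0 : ℂ) 1, ρ (F t z) = ρ (f z) := fun t ht z hz => by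
    rw [hN.eq_zero_of_mem_frontier ((hFN t ht).2 hz), hN.eq_zero_of_mem_frontier (hfN.2 hz)]
  have hlin : Tendsto (fun t : ℝ => ∫ θ in (0 : ℝ)..2 * Real.pi,
      (circleMap 0 1 θ * inner ℂ (dbar f (circleMap 0 1 θ))
        (F t (circleMap 0 1 θ) - f (circleMap 0 1 θ))).re / t ^ 2) (𝓝[≠] 0)
      (𝓝 (∫ θ in (0 : ℝ)..2 * Real.pi, μ (circleMap 0 1 θ) *
          (-(1 / 2) * fderiv ℝ (fderiv ℝ ρ) (f (circleMap 0 1 θ))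
            (X (circleMap 0 1 θ)) (X (circleMap 0 1 θ))))) := by
    refine intervalIntegral.tendsto_integral_filter_of_dominated_convergence
      (fun _ => A * (M * C ^ 2)) ?_ ?_ (intervalIntegrable_const) ?_
    · filter_upwards [eventually_mem_Ioo hε] with t ht
      exact ((continuous_re_circleMap_mul_inner (w := fun z => F t z - f z) hP
        ((hFt t ht).continuousOn.sub hf.continuousOn)).div_const _).aestronglyMeasurable
    · filter_upwards [eventually_mem_Ioo hε, eventually_abs_le hδ, self_mem_nhdsWithin]
        with t ht htδ ht0
      refine Eventually.of_forall fun θ _ => ?_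
      have hz := circleMap_mem_disk θ
      have hzs := circleMap_mem_sphere_one θ
      have h1 := (hC t htδ _ hz).1
      rw [hF0 hz] at h1
      have ht0' : 0 < t ^ 2 := by have : t ≠ 0 := ht0; positivity
      have h2 := hM _ (frontier_subset_closure (hfN.2 hzs)) _
        (frontier_subset_closure ((hFN t ht).2 hzs)) (hlev t ht _ hzs)
      rw [hμ _ hzs, Real.norm_eq_abs, abs_div, abs_of_pos ht0', div_le_iff₀ ht0', abs_mul,
        mul_assoc]
      have hA0 : 0 ≤ A := (norm_nonneg _).trans (hA _ hzs)
      refine mul_le_mul (hA _ hzs) (h2.trans ?_) (abs_nonneg _) hA0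
      rw [mul_assoc, ← sq_abs t, ← mul_pow]
      gcongr
    · refine Eventually.of_forall fun θ _ => ?_
      have hz := circleMap_mem_disk θ
      have hzs := circleMap_mem_sphere_one θ
      have h1 := tendsto_fderiv_sub_div_sq hρ2 (hX _ hz) (by
        filter_upwards [Ioo_mem_nhds (show -ε < 0 by linarith) hε] with t ht
        rw [hlev t ht _ hzs, hF0 hz])
      rw [hF0 hz] at h1
      refine (h1.const_mul (μ (circleMap 0 1 θ))).congr fun t => ?_
      rw [hμ _ hzs, mul_div_assoc]
  refine (hlin.add (tendsto_dbarEnergy_sub_div_sq hf hε hF hF0 hX)).congr' ?_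
  filter_upwards [eventually_mem_Ioo hε, self_mem_nhdsWithin] with t ht ht0
  rw [dbarEnergy_eq_add hf hPa (hFt t ht), intervalIntegral.integral_div]
  ring

end Deformation

end DbarDisk

namespace DbarDisk

open Complex Set Metric MeasureTheory Filter Asymptotics

/-! ### Integrals over the circle -/

lemma exists_circleMap_eq {z : ℂ} (hz : z ∈ sphere (0 : ℂ) 1) :
    ∃ θ ∈ Icc (-Real.pi) Real.pi, circleMap 0 1 θ = z := by
  refine ⟨z.arg, ⟨(Complex.neg_pi_lt_arg z).le, Complex.arg_le_pi z⟩, ?_⟩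
  have := Complex.norm_mul_exp_arg_mul_I z
  rw [mem_sphere_zero_iff_norm] at hz
  rw [hz] at this
  simpa [circleMap] using this

lemma integral_circle_pos {g : ℂ → ℝ} (hg : ContinuousOn g (sphere 0 1))
    (h0 : ∀ z ∈ sphere (0 : ℂ) 1, 0 ≤ g z) {z₀ : ℂ} (hz₀ : z₀ ∈ sphere (0 : ℂ) 1)
    (hpos : 0 < g z₀) : 0 < ∫ θ in (0 : ℝ)..2 * Real.pi, g (circleMap 0 1 θ) := by
  rw [intervalIntegral_circle_eq]
  obtain ⟨θ, hθ, rfl⟩ := exists_circleMap_eq hz₀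
  exact intervalIntegral.integral_pos (by linarith [Real.pi_pos])
    (continuous_comp_circleMap hg).continuousOn
    (fun x _ => h0 _ (circleMap_mem_sphere_one x)) ⟨θ, hθ, hpos⟩

/-! ### The boundary condition for a critical disk -/

variable {n : ℕ} {k : ℕ∞} {N : Set (Cn n)} {ρ : Cn n → ℝ} {f : ℂ → Cn n}

lemma IsVariation.exists_contDiffOn (hk : 2 ≤ k) {F : ℝ → ℂ → Cn n} (hF : IsVariation k N f F) :
    ∃ ε > 0, ContDiffOn ℝ 2 (Function.uncurry F) (Ioo (-ε) ε ×ˢ disk) ∧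
      ∀ t ∈ Ioo (-ε) ε, IsDiskIn N (F t) := by
  obtain ⟨-, ε, hε, hc, hd⟩ := hF
  exact ⟨ε, hε, hc.of_le (two_le_coe hk), hd⟩

lemma contDiffOn_bump_smul {z₀ : ℂ} (χ : ContDiffBump z₀) {w : ℂ → Cn n}
    (hw : ContDiffOn ℝ ∞ w disk) : ContDiffOn ℝ ∞ (fun z => χ z • w z) disk :=
  χ.contDiff.contDiffOn.smul hw

/-- Otherwise the integrand stays positive near z₀ for the corrected constant field, and a bump
function times that field is the velocity of a variation along which the energy has positive
derivative. -/
lemma not_pos_of_tangent (hk : 2 ≤ k) (hN : IsStrictlyPseudoconvex k N ρ)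
    (hf : ContDiffOn ℝ ∞ f disk) (hfN : IsDiskIn N f) (hcrit : IsDbarCritical k N f)
    (hPa : IsAntiholomorphic (dbar f)) {z₀ : ℂ} (hz₀ : z₀ ∈ sphere (0 : ℂ) 1) {w : Cn n}
    (hw : fderiv ℝ ρ (f z₀) w = 0) : ¬ 0 < (z₀ * inner ℂ (dbar f z₀) w).re := by
  intro hpos
  have hz₀d := sphere_subset_disk hz₀
  have hP : ContinuousOn (dbar f) disk := continuousOn_dbar (hf.of_le (by simp))
  obtain ⟨e, U, hU, hz₀U, hne, hvar⟩ := exists_local_variation hk hN hf hfN hz₀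
  have hdρ : ∀ v : Cn n, ContinuousOn (fun z => fderiv ℝ ρ (f z) v) disk := fun v =>
    ((hN.contDiff.continuous_fderiv (coe_ne_zero_of_two_le hk)).comp_continuousOn
      hf.continuousOn).clm_apply continuousOn_const
  set Y : ℂ → Cn n := fun z => w - (fderiv ℝ ρ (f z) w / fderiv ℝ ρ (f z) e) • e with hY
  have hYc : ContinuousWithinAt Y disk z₀ :=
    continuousWithinAt_const.sub ((((hdρ w) z₀ hz₀d).div ((hdρ e) z₀ hz₀d)
      (hne z₀ hz₀U hz₀d)).smul continuousWithinAt_const)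
  have hY0 : Y z₀ = w := by simp [hY, hw]
  have hβc : ContinuousWithinAt (fun z => (z * inner ℂ (dbar f z) (Y z)).re) disk z₀ :=
    Complex.continuous_re.continuousAt.comp_continuousWithinAt
      (continuousWithinAt_id.mul ((hP z₀ hz₀d).inner hYc))
  have hev : ∀ᶠ z in 𝓝[disk] z₀, 0 < (z * inner ℂ (dbar f z) (Y z)).re ∧ z ∈ U := by
    refine (hβc.eventually_const_lt ?_).and
      (mem_nhdsWithin_of_mem_nhds (hU.mem_nhds hz₀U))
    simpa only [hY0] using hpos
  obtain ⟨W, hW, hWev⟩ := mem_nhdsWithin_iff_exists_mem_nhds_inter.1 hev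
  obtain ⟨r, hr, hrW⟩ := Metric.nhds_basis_closedBall.mem_iff.1
    (inter_mem hW (hU.mem_nhds hz₀U))
  let χ : ContDiffBump z₀ := ⟨r / 2, r, by positivity, by linarith⟩
  have hχ0 : ∀ z, z ∉ closedBall z₀ r → χ z = 0 := fun z hz => by
    refine χ.zero_of_le_dist ?_
    exact (not_le.1 hz).le
  obtain ⟨F, hFv, hFX⟩ := hvar (fun z => χ z • w) (contDiffOn_bump_smul χ contDiffOn_const)
    (closedBall z₀ r) (fun z hz => (hrW hz).2) isClosed_closedBall
    (fun z _ hz => by simp only [hχ0 z hz, zero_smul])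
  obtain ⟨ε, hε, hFc, hFN⟩ := hFv.exists_contDiffOn hk
  set X : ℂ → Cn n := fun z => χ z • w
    - (fderiv ℝ ρ (f z) (χ z • w) / fderiv ℝ ρ (f z) e) • e with hX
  have hXY : ∀ z, X z = χ z • Y z := fun z => by
    simp only [hX, hY, map_smul, smul_sub, smul_smul, smul_eq_mul, mul_div_assoc]
  have hd := (hcrit F hFv).unique (hasDerivAt_dbarEnergy hf hPa hε hFc hFv.1 hFX)
  have hXc : ContinuousOn X disk := (contDiffOn_velocity hε hFc hFX).continuousOn
  have hgc : ContinuousOn (fun z => (z * inner ℂ (dbar f z) (X z)).re) (sphere 0 1) :=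
    (Complex.continuous_re.comp_continuousOn
      (continuousOn_id.mul (hP.inner hXc))).mono sphere_subset_disk
  have hval : ∀ z, (z * inner ℂ (dbar f z) (X z)).re
      = χ z * (z * inner ℂ (dbar f z) (Y z)).re := fun z => by
    rw [hXY, ← Complex.coe_smul, inner_smul_right, mul_left_comm, re_ofReal_mul]
  refine absurd hd (ne_of_lt (integral_circle_pos hgc (fun z hz => ?_) hz₀ ?_))
  · rw [hval]
    by_cases hzr : z ∈ closedBall z₀ r
    · exact mul_nonneg χ.nonneg (hWev ⟨(hrW hzr).1, sphere_subset_disk hz⟩).1.le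
    · rw [hχ0 z hzr, zero_mul]
  · rw [hval, hY0]
    have : χ z₀ = 1 := χ.one_of_mem_closedBall (mem_closedBall_self (by positivity))
    rw [this, one_mul]
    exact hpos

/-- At a critical disk, `∂f/∂r + J ∂f/∂θ = 2 z̄ ∂f/∂z̄` is normal to the boundary. -/
theorem exists_multiplier (hk : 2 ≤ k) (hN : IsStrictlyPseudoconvex k N ρ)
    (hf : ContDiffOn ℝ ∞ f disk) (hfN : IsDiskIn N f) (hcrit : IsDbarCritical k N f)
    (hPa : IsAntiholomorphic (dbar f)) :
    ∃ μ : ℂ → ℝ, ContinuousOn μ (sphere 0 1) ∧ ∀ z ∈ sphere (0 : ℂ) 1, ∀ w : Cn n,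
      (z * inner ℂ (dbar f z) w).re = μ z * fderiv ℝ ρ (f z) w := by
  have hP : ContinuousOn (dbar f) disk := continuousOn_dbar (hf.of_le (by simp))
  have hdir : ∀ z ∈ sphere (0 : ℂ) 1, ∃ e, fderiv ℝ ρ (f z) e ≠ 0 := fun z hz => by
    by_contra! h
    exact hN.fderiv_ne_zero _ (hfN.2 hz) (by ext v; exact h v)
  have htan : ∀ z ∈ sphere (0 : ℂ) 1, ∀ w : Cn n, fderiv ℝ ρ (f z) w = 0 →
      (z * inner ℂ (dbar f z) w).re = 0 := fun z hz w hw => by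
    refine le_antisymm (not_lt.1 (not_pos_of_tangent hk hN hf hfN hcrit hPa hz hw)) ?_
    have := not_lt.1 (not_pos_of_tangent hk hN hf hfN hcrit hPa hz (w := -w) (by simp [hw]))
    rw [inner_neg_right, mul_neg, neg_re] at this
    linarith
  have hquot : ∀ z ∈ sphere (0 : ℂ) 1, ∀ e, fderiv ℝ ρ (f z) e ≠ 0 → ∀ w,
      (z * inner ℂ (dbar f z) w).re
        = (z * inner ℂ (dbar f z) e).re / fderiv ℝ ρ (f z) e * fderiv ℝ ρ (f z) w := by
    intro z hz e he w
    have h := htan z hz (w - (fderiv ℝ ρ (f z) w / fderiv ℝ ρ (f z) e) • e) (by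
      rw [map_sub, map_smul, smul_eq_mul, div_mul_cancel₀ _ he, sub_self])
    rw [inner_sub_right, ← Complex.coe_smul, inner_smul_right, mul_sub, mul_left_comm, sub_re,
      re_ofReal_mul] at h
    rw [sub_eq_zero.1 h]
    field_simp
  choose! e he using hdir
  refine ⟨fun z => (z * inner ℂ (dbar f z) (e z)).re / fderiv ℝ ρ (f z) (e z), fun z₀ hz₀ => ?_,
    fun z hz w => hquot z hz (e z) (he z hz) w⟩
  have hdρ : ContinuousOn (fun z => fderiv ℝ ρ (f z) (e z₀)) (sphere 0 1) :=
    ((hN.contDiff.continuous_fderiv (coe_ne_zero_of_two_le hk)).comp_continuousOn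
      (hf.continuousOn.mono sphere_subset_disk)).clm_apply continuousOn_const
  have hnum : ContinuousOn (fun z => (z * inner ℂ (dbar f z) (e z₀)).re) (sphere 0 1) :=
    (Complex.continuous_re.comp_continuousOn
      (continuousOn_id.mul (hP.inner continuousOn_const))).mono sphere_subset_disk
  -- The chosen vectors e(z) need not depend continuously on z. The quotient does not depend on the
  -- vector, so near z₀ it can be computed with the fixed vector e(z₀).
  refine ((hnum z₀ hz₀).div (hdρ z₀ hz₀) (he z₀ hz₀)).congr_of_eventuallyEq ?_ rfl
  filter_upwards [(hdρ z₀ hz₀).eventually_ne (he z₀ hz₀), self_mem_nhdsWithin] with z hz hzs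
  have h1 := hquot z hzs (e z) (he z hzs) (e z₀)
  rw [Pi.div_apply, eq_div_iff hz]
  exact h1.symm

/-! ### Radial and angular derivatives -/

lemma map_complex_mk (L : ℂ →L[ℝ] Cn n) (a b : ℝ) :
    L ⟨a, b⟩ = (a : ℂ) • L 1 + (b : ℂ) • L I := by
  have : (⟨a, b⟩ : ℂ) = a • (1 : ℂ) + b • I := by apply Complex.ext <;> simp
  rw [this, map_add, map_smul, map_smul, Complex.coe_smul, Complex.coe_smul]

lemma two_smul_conj_smul_dbar (f : ℂ → Cn n) (z : ℂ) :
    (2 * (starRingEnd ℂ) z) • dbar f z = dirDeriv f z z + I • dirDeriv f z (I * z) := by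
  obtain ⟨x, y⟩ := z
  have h1 : I * (⟨x, y⟩ : ℂ) = ⟨-y, x⟩ := by apply Complex.ext <;> simp
  have h2 : (starRingEnd ℂ) (⟨x, y⟩ : ℂ) = (x : ℂ) - y * I := by apply Complex.ext <;> simp
  simp only [dbar, dirDeriv]
  rw [h1, map_complex_mk _ x y, map_complex_mk _ (-y) x, h2]
  generalize fderivWithin ℝ f disk ⟨x, y⟩ 1 = a
  generalize fderivWithin ℝ f disk ⟨x, y⟩ I = b
  push_cast
  linear_combination (norm := module) ((-(y : ℂ)) • Complex.I_sq) • b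

lemma boundaryField_eq (f : ℂ → Cn n) (z : ℂ) :
    boundaryField f z = (2 * (starRingEnd ℂ) z) • dbar f z :=
  (two_smul_conj_smul_dbar f z).symm

lemma smul_conj_wirtinger (f : ℂ → Cn n) (z : ℂ) :
    z • (dirDeriv f z 1 - I • dirDeriv f z I) = dirDeriv f z z - I • dirDeriv f z (I * z) := by
  obtain ⟨x, y⟩ := z
  have h1 : I * (⟨x, y⟩ : ℂ) = ⟨-y, x⟩ := by apply Complex.ext <;> simp
  have h2 : (⟨x, y⟩ : ℂ) = (x : ℂ) + y * I := by apply Complex.ext <;> simp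
  simp only [dirDeriv]
  rw [h1, map_complex_mk _ x y, map_complex_mk _ (-y) x]
  generalize fderivWithin ℝ f disk ⟨x, y⟩ 1 = a
  generalize fderivWithin ℝ f disk ⟨x, y⟩ I = b
  rw [h2]
  push_cast
  linear_combination (norm := module) ((-(y : ℂ)) • Complex.I_sq) • b

lemma fderiv_angular_eq_zero (hk : 2 ≤ k) (hN : IsStrictlyPseudoconvex k N ρ)
    (hf : ContDiffOn ℝ ∞ f disk) (hfN : IsDiskIn N f) {z : ℂ} (hz : z ∈ sphere (0 : ℂ) 1) :
    fderiv ℝ ρ (f z) (dirDeriv f z (I * z)) = 0 := by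
  obtain ⟨θ, -, rfl⟩ := exists_circleMap_eq hz
  have h1 := (hf.differentiableOn (by simp) _ (circleMap_mem_disk θ)).hasFDerivWithinAt
  have h2 := (hasDerivAt_circleMap 0 1 θ).hasDerivWithinAt (s := univ)
  have h3 := h1.comp_hasDerivWithinAt θ h2 (fun t _ => circleMap_mem_disk t)
  have h4 := ((hN.contDiff.differentiable (coe_ne_zero_of_two_le hk)
    (f (circleMap 0 1 θ))).hasFDerivAt.comp_hasDerivWithinAt θ h3).hasDerivAt univ_mem
  have h5 : HasDerivAt (ρ ∘ f ∘ circleMap 0 1) 0 θ := by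
    refine (hasDerivAt_const θ (0 : ℝ)).congr_of_eventuallyEq (Eventually.of_forall fun t => ?_)
    exact hN.eq_zero_of_mem_frontier (hfN.2 (circleMap_mem_sphere_one t))
  have := h4.unique h5
  rwa [mul_comm] at this

lemma fderiv_radial_nonneg (hk : 2 ≤ k) (hN : IsStrictlyPseudoconvex k N ρ)
    (hf : ContDiffOn ℝ ∞ f disk) (hfN : IsDiskIn N f) {z : ℂ} (hz : z ∈ sphere (0 : ℂ) 1) :
    0 ≤ fderiv ℝ ρ (f z) (dirDeriv f z z) := by
  have hzn : ‖z‖ = 1 := mem_sphere_zero_iff_norm.1 hz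
  have h1 : HasFDerivWithinAt f (fderivWithin ℝ f disk z) disk ((1 : ℝ) • z) := by
    rw [one_smul]
    exact (hf.differentiableOn (by simp) _ (sphere_subset_disk hz)).hasFDerivWithinAt
  have h2 : HasDerivWithinAt (fun s : ℝ => s • z) z (Ioo 0 1) 1 := by
    simpa using ((hasDerivAt_id (1 : ℝ)).smul_const z).hasDerivWithinAt
  have hball : ∀ s ∈ Ioo (0 : ℝ) 1, s • z ∈ ball (0 : ℂ) 1 := fun s hs => by
    rw [mem_ball_zero_iff, norm_smul, hzn, mul_one, Real.norm_eq_abs, abs_of_pos hs.1]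
    exact hs.2
  have h3 := h1.comp_hasDerivWithinAt (1 : ℝ) h2 (fun s hs => ball_subset_disk (hball s hs))
  have h4 := (hN.contDiff.differentiable (coe_ne_zero_of_two_le hk)
    (f ((1 : ℝ) • z))).hasFDerivAt.comp_hasDerivWithinAt (1 : ℝ) h3
  have h5 := (hasDerivWithinAt_iff_tendsto_slope' (by simp)).1 h4
  have h6 : ρ (f ((1 : ℝ) • z)) = 0 := by
    rw [one_smul]; exact hN.eq_zero_of_mem_frontier (hfN.2 hz)
  have : (𝓝[Ioo (0 : ℝ) 1] 1).NeBot := right_nhdsWithin_Ioo_neBot zero_lt_one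
  have h7 := ge_of_tendsto (b := (0 : ℝ)) h5 (by
    filter_upwards [self_mem_nhdsWithin] with s hs
    have h8 := hN.neg_of_mem (hfN.1 (hball s hs))
    simp only [slope, Function.comp, vsub_eq_sub, smul_eq_mul, h6, sub_zero]
    exact (mul_pos_of_neg_of_neg (inv_lt_zero.2 (by linarith [hs.2])) h8).le)
  simpa [dirDeriv] using h7

/-! ### The quadratic differential of a harmonic disk -/

/-- Up to a factor this is the Hopf differential of f. As f is harmonic, ∂f/∂z is holomorphic, and
pairing it with the antiholomorphic ∂f/∂z̄ in the conjugate-linear slot keeps it so. -/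
lemma differentiableAt_inner_wirtinger (hf : ContDiffOn ℝ ∞ f disk)
    (hPa : IsAntiholomorphic (dbar f)) {z : ℂ} (hz : z ∈ ball (0 : ℂ) 1) :
    DifferentiableAt ℂ (fun z => inner ℂ (dbar f z) (dirDeriv f z 1 - I • dirDeriv f z I)) z := by
  have hz' := ball_subset_disk hz
  have hP : ContDiffOn ℝ 1 (dbar f) disk := contDiffOn_dbar hf one_add_one_le_infty
  have hfv : ∀ v, ContDiffOn ℝ 1 (fun z => dirDeriv f z v) disk := fun v =>
    contDiffOn_fderivWithin_disk hf one_add_one_le_infty v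
  have hQ : ContDiffOn ℝ 1 (fun z => dirDeriv f z 1 - I • dirDeriv f z I) disk :=
    (hfv 1).sub ((hfv I).const_smul I)
  have hD := uniqueDiffOn_disk z hz'
  have hd : ∀ v, DifferentiableWithinAt ℝ (fun z => dirDeriv f z v) disk z := fun v =>
    (hfv v).differentiableOn one_ne_zero z hz'
  have hfc : ContDiffAt ℝ 2 f z :=
    (hf.contDiffAt (disk_mem_nhds hz)).of_le (WithTop.coe_le_coe.2 (le_top : (2 : ℕ∞) ≤ ⊤))
  set H := fderiv ℝ (fderiv ℝ f) z with hH
  have hsym := isSymmSndFDerivAt_of_contDiff hfc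
  have hd2 : HasFDerivAt (fderiv ℝ f) H z :=
    ((hfc.fderiv_right (m := 1) (by norm_num)).differentiableAt one_ne_zero).hasFDerivAt
  have hH' : ∀ v w, fderivWithin ℝ (fun z => dirDeriv f z v) disk z w = H w v := fun v w => by
    rw [fderivWithin_disk hz]
    have h1 : HasFDerivAt (fun z => fderiv ℝ f z v)
        ((ContinuousLinearMap.apply ℝ (Cn n) v).comp H) z :=
      (ContinuousLinearMap.apply ℝ (Cn n) v).hasFDerivAt.comp z hd2
    have h2 : (fun z => dirDeriv f z v) =ᶠ[𝓝 z] fun z => fderiv ℝ f z v := by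
      filter_upwards [isOpen_ball.mem_nhds hz] with x hx
      rw [dirDeriv, fderivWithin_disk hx]
    rw [h2.fderiv_eq, h1.fderiv]
    rfl
  have hdP : ∀ w, fderivWithin ℝ (dbar f) disk z w = (1 / 2 : ℂ) • (H w 1 + I • H w I) := by
    intro w
    have h1 : HasFDerivWithinAt (dbar f) ((1 / 2 : ℂ) •
        (fderivWithin ℝ (fun z => dirDeriv f z 1) disk z
          + I • fderivWithin ℝ (fun z => dirDeriv f z I) disk z)) disk z :=
      ((hd 1).hasFDerivWithinAt.add ((hd I).hasFDerivWithinAt.const_smul I)).const_smul (1 / 2 : ℂ)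
    rw [h1.fderivWithin hD]
    simp only [smul_apply, add_apply, hH']
  have hdQ : ∀ w, fderivWithin ℝ (fun z => dirDeriv f z 1 - I • dirDeriv f z I) disk z w
      = H w 1 - I • H w I := by
    intro w
    have h1 : HasFDerivWithinAt (fun z => dirDeriv f z 1 - I • dirDeriv f z I)
        (fderivWithin ℝ (fun z => dirDeriv f z 1) disk z
          - I • fderivWithin ℝ (fun z => dirDeriv f z I) disk z) disk z :=
      (hd 1).hasFDerivWithinAt.sub ((hd I).hasFDerivWithinAt.const_smul I)
    rw [h1.fderivWithin hD]
    simp only [smul_apply, sub_apply, hH']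
  -- Laplace's equation, read off from ∂P/∂z = 0 and the symmetry of D²f.
  have hharm : H I I = - H 1 1 := by
    have h := hPa z hz
    rw [hdP, hdP, hsym 1 I] at h
    generalize H I I = a at *
    generalize H 1 1 = b at *
    generalize H I 1 = c at *
    have h1 : I • a = -I • b := by
      linear_combination (norm := module) (2 : ℂ) • h - (Complex.I_sq) • c
    have h2 := congrArg (fun x => -I • x) h1
    simpa [smul_smul] using h2
  have hCR : fderivWithin ℝ (fun z => dirDeriv f z 1 - I • dirDeriv f z I) disk z I
      = I • fderivWithin ℝ (fun z => dirDeriv f z 1 - I • dirDeriv f z I) disk z 1 := by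
    rw [hdQ, hdQ, hharm, hsym 1 I]
    generalize H 1 1 = b
    generalize H I 1 = c
    linear_combination (norm := module) (Complex.I_sq) • c
  rw [differentiableAt_complex_iff_differentiableAt_real]
  refine ⟨differentiableAt_of_mem_ball one_ne_zero (hP.inner ℂ hQ) hz, ?_⟩
  rw [← fderivWithin_disk hz, fderivWithin_inner hP hQ hz', fderivWithin_inner hP hQ hz', hCR,
    hPa z hz, inner_smul_right, inner_smul_left]
  simp only [map_neg, conj_I, neg_neg, smul_eq_mul]
  ring

/-- Let a be the Hopf differential. On the circle z²a = 2|P|² − 2iz⟨P, ∂f/∂θ⟩ is real, because ∂f/∂θ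
is tangent to ∂N. Cauchy's theorem makes it vanish, so |P|² = μ dρ(J ∂f/∂θ). Combined with 2z̄P =
∂f/∂r + J ∂f/∂θ, which gives 2|P|² = μ dρ(∂f/∂r + J ∂f/∂θ), this leaves the radial term. -/
lemma normSq_dbar_eq (hk : 2 ≤ k) (hN : IsStrictlyPseudoconvex k N ρ)
    (hf : ContDiffOn ℝ ∞ f disk) (hfN : IsDiskIn N f) (hPa : IsAntiholomorphic (dbar f))
    {μ : ℂ → ℝ} (hμ : ∀ z ∈ sphere (0 : ℂ) 1, ∀ w : Cn n,
      (z * inner ℂ (dbar f z) w).re = μ z * fderiv ℝ ρ (f z) w) {z : ℂ}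
    (hz : z ∈ sphere (0 : ℂ) 1) :
    ‖dbar f z‖ ^ 2 = μ z * fderiv ℝ ρ (f z) (dirDeriv f z z) := by
  have hP : ContDiffOn ℝ 1 (dbar f) disk := contDiffOn_dbar hf one_add_one_le_infty
  have hfv : ∀ v, ContinuousOn (fun z => dirDeriv f z v) disk := fun v =>
    (contDiffOn_fderivWithin_disk hf one_add_one_le_infty v).continuousOn
  set a : ℂ → ℂ := fun z => inner ℂ (dbar f z) (dirDeriv f z 1 - I • dirDeriv f z I) with ha
  have hac : ContinuousOn a disk := hP.continuousOn.inner ((hfv 1).sub ((hfv I).const_smul I))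
  -- `z² a` is real on the circle
  have hreal : ∀ z ∈ sphere (0 : ℂ) 1, z ^ 2 * a z
      = ((2 * ‖dbar f z‖ ^ 2 - 2 * (μ z * fderiv ℝ ρ (f z) (I • dirDeriv f z (I * z))) : ℝ) : ℂ) := by
    intro z hz
    have hzz : z * (starRingEnd ℂ) z = 1 := by
      rw [Complex.mul_conj, Complex.normSq_eq_norm_sq, mem_sphere_zero_iff_norm.1 hz]; simp
    set fθ := dirDeriv f z (I * z) with hfθ
    have h1 : z • (dirDeriv f z 1 - I • dirDeriv f z I)
        = (2 * (starRingEnd ℂ) z) • dbar f z - (2 * I) • fθ := by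
      rw [smul_conj_wirtinger, two_smul_conj_smul_dbar]; module
    have h2 : z ^ 2 * a z = z * inner ℂ (dbar f z) (z • (dirDeriv f z 1 - I • dirDeriv f z I)) := by
      rw [inner_smul_right]; ring
    have h3 : inner ℂ (dbar f z) (dbar f z) = ((‖dbar f z‖ ^ 2 : ℝ) : ℂ) := by
      simp [inner_self_eq_norm_sq_to_K]
    have hre : (z * inner ℂ (dbar f z) fθ).re = 0 := by
      rw [hμ z hz, fderiv_angular_eq_zero hk hN hf hfN hz, mul_zero]
    have him := hμ z hz (I • fθ)
    rw [inner_smul_right] at him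
    rw [h2, h1, inner_sub_right, inner_smul_right, inner_smul_right, h3, ← him]
    have h4 : z * (2 * (starRingEnd ℂ) z * ((‖dbar f z‖ ^ 2 : ℝ) : ℂ) - 2 * I * inner ℂ (dbar f z) fθ)
        = ((2 * ‖dbar f z‖ ^ 2 : ℝ) : ℂ) - 2 * (I * (z * inner ℂ (dbar f z) fθ)) := by
      push_cast
      linear_combination (2 * (‖dbar f z‖ : ℂ) ^ 2) * hzz
    rw [h4, mul_left_comm z I]
    apply Complex.ext
    · simp
    · simp [hre]
  -- With dz = iz dθ, the contour integral of the holomorphic function z³a² is i times the integral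
  -- of (z²a)². The latter integrand is the square of a real number.
  have hint : ∫ θ in (0 : ℝ)..2 * Real.pi, (circleMap 0 1 θ ^ 2 * a (circleMap 0 1 θ)) ^ 2 = 0 := by
    have h1 := Complex.circleIntegral_eq_zero_of_differentiable_on_off_countable zero_le_one
      countable_empty (c := 0) (f := fun z => z ^ 3 * a z ^ 2)
      (((continuousOn_id.pow 3).mul (hac.pow 2)))
      (fun z hz => ((differentiableAt_id.pow 3).mul
        ((differentiableAt_inner_wirtinger hf hPa hz.1).pow 2)))
    rw [circleIntegral] at h1
    have h2 : ∀ θ : ℝ, deriv (circleMap 0 1) θ • (circleMap 0 1 θ ^ 3 * a (circleMap 0 1 θ) ^ 2)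
        = I * (circleMap 0 1 θ ^ 2 * a (circleMap 0 1 θ)) ^ 2 := fun θ => by
      rw [deriv_circleMap, smul_eq_mul]; ring
    simp only [h2, intervalIntegral.integral_const_mul] at h1
    exact (mul_eq_zero.1 h1).resolve_left I_ne_zero
  have hzero : ∀ z ∈ sphere (0 : ℂ) 1, z ^ 2 * a z = 0 := by
    set g : ℂ → ℝ := fun z => (z ^ 2 * a z).re ^ 2 with hg
    have hgc : ContinuousOn g (sphere 0 1) :=
      ((Complex.continuous_re.comp_continuousOn
        ((continuousOn_id.pow 2).mul hac)).pow 2).mono sphere_subset_disk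
    have hgi : ∫ θ in (0 : ℝ)..2 * Real.pi, g (circleMap 0 1 θ) = 0 := by
      have : ∀ θ : ℝ, (circleMap 0 1 θ ^ 2 * a (circleMap 0 1 θ)) ^ 2
          = ((g (circleMap 0 1 θ) : ℝ) : ℂ) := fun θ => by
        simp only [hg]
        rw [hreal _ (circleMap_mem_sphere_one θ), ofReal_re, ofReal_pow]
      simp only [this, intervalIntegral.integral_ofReal] at hint
      exact_mod_cast hint
    intro z hz
    by_contra hne
    have hpos : 0 < g z := by
      have : (z ^ 2 * a z).re ≠ 0 := fun h => hne (by
        rw [hreal z hz, ofReal_re] at h; rw [hreal z hz, h, ofReal_zero])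
      positivity
    exact absurd hgi (integral_circle_pos hgc (fun z _ => sq_nonneg _) hz hpos).ne'
  have h1 := hreal z hz
  rw [hzero z hz] at h1
  have h2 : 2 * ‖dbar f z‖ ^ 2 - 2 * (μ z * fderiv ℝ ρ (f z) (I • dirDeriv f z (I * z))) = 0 := by
    exact_mod_cast h1.symm
  have hzz : z * (starRingEnd ℂ) z = 1 := by
    rw [Complex.mul_conj, Complex.normSq_eq_norm_sq, mem_sphere_zero_iff_norm.1 hz]; simp
  have h3 := hμ z hz ((2 * (starRingEnd ℂ) z) • dbar f z)
  rw [two_smul_conj_smul_dbar, map_add, ← two_smul_conj_smul_dbar, inner_smul_right] at h3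
  have h4 : z * (2 * (starRingEnd ℂ) z * inner ℂ (dbar f z) (dbar f z))
      = ((2 * ‖dbar f z‖ ^ 2 : ℝ) : ℂ) := by
    have : inner ℂ (dbar f z) (dbar f z) = ((‖dbar f z‖ ^ 2 : ℝ) : ℂ) := by
      simp [inner_self_eq_norm_sq_to_K]
    rw [this]; push_cast
    linear_combination (2 * (‖dbar f z‖ : ℂ) ^ 2) * hzz
  rw [h4, ofReal_re] at h3
  linarith

/-- In |P|² = μ dρ(∂f/∂r) the last factor is nonnegative. Where P = 0 the boundary condition gives μ
= 0. -/
lemma multiplier_nonneg (hk : 2 ≤ k) (hN : IsStrictlyPseudoconvex k N ρ)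
    (hf : ContDiffOn ℝ ∞ f disk) (hfN : IsDiskIn N f) (hPa : IsAntiholomorphic (dbar f))
    {μ : ℂ → ℝ} (hμ : ∀ z ∈ sphere (0 : ℂ) 1, ∀ w : Cn n,
      (z * inner ℂ (dbar f z) w).re = μ z * fderiv ℝ ρ (f z) w) {z : ℂ}
    (hz : z ∈ sphere (0 : ℂ) 1) : 0 ≤ μ z ∧ (dbar f z ≠ 0 → 0 < μ z) := by
  have h1 := normSq_dbar_eq hk hN hf hfN hPa hμ hz
  have h2 := fderiv_radial_nonneg hk hN hf hfN hz
  have h3 : dbar f z ≠ 0 → 0 < μ z := fun hne => by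
    have h4 : 0 < ‖dbar f z‖ ^ 2 := by positivity
    rw [h1] at h4
    exact pos_of_mul_pos_left h4 h2
  refine ⟨?_, h3⟩
  by_cases h0 : dbar f z = 0
  · obtain ⟨e, he⟩ : ∃ e, fderiv ℝ ρ (f z) e ≠ 0 := by
      by_contra! h
      exact hN.fderiv_ne_zero _ (hfN.2 hz) (by ext v; exact h v)
    have h5 := hμ z hz e
    rw [h0, inner_zero_left, mul_zero, zero_re] at h5
    exact ((mul_eq_zero.1 h5.symm).resolve_right he).ge
  · exact (h3 h0).le

end DbarDisk

namespace DbarDisk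

open Complex Set Metric MeasureTheory Filter Asymptotics Module

/-! ### A lower bound for the index of a real quadratic form on a complex vector space -/

section NegativeIndex

variable {E : Type*} [AddCommGroup E] [Module ℂ E]

/-- The complex linear functional with real part `ℓ`. -/
def complexify (ℓ : E →ₗ[ℝ] ℝ) : E →ₗ[ℂ] ℂ where
  toFun v := ℓ v - I * ℓ (I • v)
  map_add' v w := by simp only [smul_add, map_add]; push_cast; ring
  map_smul' c v := by
    have h : ∀ u : E, c • u = c.re • u + c.im • (I • u) := fun u => by
      conv_lhs => rw [← Complex.re_add_im c, add_smul, mul_smul, Complex.coe_smul, Complex.coe_smul]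
    have h2 : I • c • v = c.re • (I • v) - c.im • v := by
      rw [h, smul_add, smul_comm I c.re, smul_comm I c.im, smul_smul I I, I_mul_I, neg_one_smul,
        smul_neg, sub_eq_add_neg]
    rw [h2, h v]
    simp only [map_add, map_sub, map_smul, smul_eq_mul, RingHom.id_apply]
    push_cast
    conv_rhs => rw [← Complex.re_add_im c]
    linear_combination ((c.im : ℂ) * ℓ (I • v)) * I_sq

lemma complexify_eq_zero {ℓ : E →ₗ[ℝ] ℝ} {v : E} (h : complexify ℓ v = 0) : ℓ v = 0 := by
  have := congrArg Complex.re h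
  simpa [complexify] using this

/-- In any nonzero complex subspace the hypothesis provides a v with B(v, v) < 0. The B-orthogonal
complement of v contains a complex subspace of codimension at most one, to which the induction
applies. Passing to a complex subspace is essential: the hypothesis compares u with iu. This is why
S ranges over complex subspaces. -/
lemma exists_negativeDefinite_of_le_finrank [FiniteDimensional ℂ E] (B : E →ₗ[ℝ] E →ₗ[ℝ] ℝ)
    (hB : ∀ v ≠ 0, B v v + B (I • v) (I • v) < 0) (d : ℕ) :
    ∀ S : Submodule ℂ E, d ≤ finrank ℂ S → ∃ W : Submodule ℝ E, W ≤ S.restrictScalars ℝ ∧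
      FiniteDimensional ℝ W ∧ d ≤ finrank ℝ W ∧ ∀ v ∈ W, v ≠ 0 → B v v < 0 := by
  induction d with
  | zero => exact fun S _ => ⟨⊥, bot_le, inferInstance, Nat.zero_le _, fun v hv h0 => absurd hv h0⟩
  | succ d ih =>
    intro S hS
    obtain ⟨u, huS, hu0⟩ : ∃ u ∈ S, u ≠ 0 := by
      refine (Submodule.ne_bot_iff S).1 fun h => ?_
      rw [h, finrank_bot] at hS
      omega
    obtain ⟨v, hvS, hv⟩ : ∃ v ∈ S, B v v < 0 := by
      by_contra! h
      exact absurd (hB u hu0) (not_lt.2 (add_nonneg (h u huS) (h _ (S.smul_mem I huS))))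
    -- Both orders appear because B is not assumed symmetric.
    set ℓ : E →ₗ[ℝ] ℝ := B v + B.flip v with hℓ
    have hℓv : ∀ w, ℓ w = B v w + B w v := fun w => rfl
    set φ : S →ₗ[ℂ] ℂ := (complexify ℓ).comp S.subtype with hφ
    have hker : d ≤ finrank ℂ ((LinearMap.ker φ).map S.subtype) := by
      rw [LinearEquiv.finrank_eq (Submodule.equivMapOfInjective S.subtype S.subtype_injective _).symm]
      have h1 := φ.finrank_range_add_finrank_ker
      have h2 : finrank ℂ (LinearMap.range φ) ≤ 1 :=
        (Submodule.finrank_le _).trans (finrank_self ℂ).le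
      omega
    obtain ⟨W, hWS, hWf, hWd, hWneg⟩ := ih _ hker
    have hWmem : ∀ w ∈ W, w ∈ S ∧ ℓ w = 0 := fun w hw => by
      obtain ⟨x, hx, rfl⟩ := hWS hw
      exact ⟨x.2, complexify_eq_zero hx⟩
    have hdisj : Disjoint W (Submodule.span ℝ {v}) := by
      rw [Submodule.disjoint_span_singleton]
      intro hvW
      have h := (hWmem v hvW).2
      rw [hℓv] at h
      linarith
    refine ⟨W ⊔ Submodule.span ℝ {v}, ?_, inferInstance, ?_, ?_⟩
    · refine sup_le (fun w hw => (hWmem w hw).1) ?_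
      rw [Submodule.span_le, singleton_subset_iff]
      exact hvS
    · have h1 := Submodule.finrank_sup_add_finrank_inf_eq W (Submodule.span ℝ {v})
      have hv0 : v ≠ 0 := fun h => by rw [h] at hv; simp at hv
      rw [hdisj.eq_bot, finrank_bot, finrank_span_singleton hv0] at h1
      omega
    · intro x hx hx0
      obtain ⟨w, hw, y, hy, rfl⟩ := Submodule.mem_sup.1 hx
      obtain ⟨a, rfl⟩ := Submodule.mem_span_singleton.1 hy
      have h1 : B (w + a • v) (w + a • v) = B w w + a * ℓ w + a ^ 2 * B v v := by
        rw [hℓv]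
        simp only [map_add, map_smul, LinearMap.add_apply, LinearMap.smul_apply, smul_eq_mul]
        ring
      rw [h1, (hWmem w hw).2, mul_zero, add_zero]
      by_cases hw0 : w = 0
      · have ha : a ≠ 0 := fun h => hx0 (by rw [hw0, h, zero_smul, add_zero])
        rw [hw0]
        simp only [map_zero, zero_add]
        exact mul_neg_of_pos_of_neg (by positivity) hv
      · exact add_neg_of_neg_of_nonpos (hWneg w hw hw0)
          (mul_nonpos_of_nonneg_of_nonpos (sq_nonneg a) hv.le)

lemma exists_negativeDefinite [FiniteDimensional ℂ E] (B : E →ₗ[ℝ] E →ₗ[ℝ] ℝ)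
    (hB : ∀ v ≠ 0, B v v + B (I • v) (I • v) < 0) :
    ∃ W : Submodule ℝ E, FiniteDimensional ℝ W ∧ finrank ℂ E ≤ finrank ℝ W ∧
      ∀ v ∈ W, v ≠ 0 → B v v < 0 := by
  obtain ⟨W, -, h⟩ := exists_negativeDefinite_of_le_finrank B hB (finrank ℂ E) ⊤ (by simp)
  exact ⟨W, h⟩

end NegativeIndex

/-! ### The Levi form and the real Hessian -/

variable {n : ℕ} {k : ℕ∞} {N : Set (Cn n)} {ρ : Cn n → ℝ} {f : ℂ → Cn n}

lemma sum_smul_basisVec (w : Cn n) : ∑ j, w j • (basisVec j : Cn n) = w := by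
  ext i
  simp [basisVec, Finset.sum_apply, Pi.single_apply]

/-- The Wirtinger coefficients of ℓ are the coordinates of its complex linear part. -/
lemma sum_wirtinger_coeff (ℓ : Cn n →L[ℝ] ℂ) (w : Cn n) :
    ∑ j, (1 / 2 : ℂ) * (ℓ (basisVec j) - I * ℓ (I • basisVec j)) * w j
      = (1 / 2 : ℂ) * (ℓ w - I * ℓ (I • w)) := by
  have hs : ∀ (c : ℂ) (u : Cn n), ℓ (c • u) = c.re * ℓ u + c.im * ℓ (I • u) := fun c u => by
    conv_lhs => rw [← Complex.re_add_im c, add_smul, mul_smul, Complex.coe_smul, Complex.coe_smul]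
    simp
  have h1 : ∀ j, (1 / 2 : ℂ) * (ℓ (basisVec j) - I * ℓ (I • basisVec j)) * w j
      = (1 / 2 : ℂ) * (ℓ (w j • basisVec j) - I * ℓ (I • w j • basisVec j)) := fun j => by
    have h2 : ℓ (I • w j • basisVec j) = (w j).re * ℓ (I • basisVec j)
        - (w j).im * ℓ (basisVec j) := by
      rw [smul_smul, hs]
      simp
      ring
    rw [h2, hs (w j)]
    conv_lhs => rw [← Complex.re_add_im (w j)]
    linear_combination (-(1 / 2 : ℂ) * (w j).im * ℓ (I • basisVec j)) * I_sq
  simp only [h1]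
  rw [← Finset.mul_sum, Finset.sum_sub_distrib, ← Finset.mul_sum, ← map_sum, ← map_sum,
    ← Finset.smul_sum, sum_smul_basisVec]

lemma fderiv_ofReal_comp {u : Cn n → ℝ} (hu : Differentiable ℝ u) (p v : Cn n) :
    fderiv ℝ (fun q => (u q : ℂ)) p v = fderiv ℝ u p v := by
  have h : HasFDerivAt (fun q => (u q : ℂ)) (ofRealCLM.comp (fderiv ℝ u p)) p :=
    ofRealCLM.hasFDerivAt.comp p (hu p).hasFDerivAt
  rw [h.fderiv]; rfl

lemma sum_wirtinger_mul {u : Cn n → ℝ} (hu : Differentiable ℝ u) (p w : Cn n) :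
    ∑ j, wirtinger j (fun q => (u q : ℂ)) p * w j
      = (1 / 2 : ℂ) * (fderiv ℝ u p w - I * fderiv ℝ u p (I • w)) := by
  have := sum_wirtinger_coeff (fderiv ℝ (fun q => (u q : ℂ)) p) w
  simpa only [wirtinger, fderiv_ofReal_comp hu] using this

/-- Contracting with w_j takes the complex linear part of D²ρ in one argument, contracting with the
conjugate of w_k the antilinear part in the other. At w the real part is the Hessian averaged over w
and iw, up to a factor. -/
lemma leviForm_re (hρ : ContDiff ℝ 2 ρ) (p w : Cn n) :
    (leviForm ρ p w).re = (1 / 4) * (fderiv ℝ (fderiv ℝ ρ) p w w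
      + fderiv ℝ (fderiv ℝ ρ) p (I • w) (I • w)) := by
  set B := fderiv ℝ (fderiv ℝ ρ) p with hB
  have hd : Differentiable ℝ ρ := hρ.differentiable two_ne_zero
  have hd2 : HasFDerivAt (fderiv ℝ ρ) B p :=
    ((hρ.fderiv_right (m := 1) (by norm_num)).differentiable one_ne_zero p).hasFDerivAt
  -- the real linear functional `∂ρ/∂z̄_k`
  have hv : ∀ v : Cn n, HasFDerivAt (fun q => ((fderiv ℝ ρ q v : ℝ) : ℂ))
      (ofRealCLM.comp ((ContinuousLinearMap.apply ℝ ℝ v).comp B)) p := fun v =>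
    ofRealCLM.hasFDerivAt.comp p ((ContinuousLinearMap.apply ℝ ℝ v).hasFDerivAt.comp p hd2)
  have hbar : ∀ (k : Fin n) (v : Cn n),
      fderiv ℝ (wirtingerBar k fun q => (ρ q : ℂ)) p v
        = (1 / 2 : ℂ) * (B v (basisVec k) + I * B v (I • basisVec k)) := fun k v => by
    have h1 : wirtingerBar k (fun q => (ρ q : ℂ)) = fun q => (1 / 2 : ℂ) *
        (((fderiv ℝ ρ q (basisVec k) : ℝ) : ℂ) + I * (fderiv ℝ ρ q (I • basisVec k) : ℝ)) := by
      funext q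
      simp only [wirtingerBar, fderiv_ofReal_comp hd]
    have h2 := ((hv (basisVec k)).add ((hv (I • basisVec k)).const_mul I)).const_mul (1 / 2 : ℂ)
    have h3 := h2.fderiv
    rw [h1]
    refine (DFunLike.congr_fun h3 v).trans ?_
    simp
    ring
  have hfirst : ∀ k : Fin n, ∑ j, wirtinger j (wirtingerBar k fun q => (ρ q : ℂ)) p * w j
      = (1 / 2 : ℂ) * ((1 / 2 : ℂ) * (B w (basisVec k) + I * B w (I • basisVec k))
        - I * ((1 / 2 : ℂ) * (B (I • w) (basisVec k) + I * B (I • w) (I • basisVec k)))) :=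
    fun k => by
      have := sum_wirtinger_coeff (fderiv ℝ (wirtingerBar k fun q => (ρ q : ℂ)) p) w
      simpa only [wirtinger, hbar] using this
  have hconj : ∀ ℓ : Cn n →L[ℝ] ℝ, ∑ k, (1 / 2 : ℂ) * (ℓ (basisVec k) + I * ℓ (I • basisVec k))
      * (starRingEnd ℂ) (w k) = (1 / 2 : ℂ) * (ℓ w + I * ℓ (I • w)) := fun ℓ => by
    have := congrArg (starRingEnd ℂ) (sum_wirtinger_coeff (ofRealCLM.comp ℓ) w)
    have h2 : (starRingEnd ℂ) 2 = 2 := Complex.conj_ofNat 2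
    simpa [map_sum, h2] using this
  have hlevi : leviForm ρ p w = (1 / 2 : ℂ) * ((1 / 2 : ℂ) * (B w w + I * B w (I • w)))
      - (1 / 2 : ℂ) * I * ((1 / 2 : ℂ) * (B (I • w) w + I * B (I • w) (I • w))) := by
    rw [leviForm, Finset.sum_comm]
    simp only [← Finset.sum_mul, hfirst]
    rw [← hconj (B w), ← hconj (B (I • w)), Finset.mul_sum, Finset.mul_sum,
      ← Finset.sum_sub_distrib]
    refine Finset.sum_congr rfl fun k _ => ?_
    ring
  rw [hlevi]
  simp
  ring

/-- On complex tangent vectors of the boundary, the averaged real Hessian is positive. -/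
lemma hessian_add_pos (hk : 2 ≤ k) (hN : IsStrictlyPseudoconvex k N ρ) {p : Cn n}
    (hp : p ∈ frontier N) {w : Cn n} (hw : w ≠ 0) (h1 : fderiv ℝ ρ p w = 0)
    (h2 : fderiv ℝ ρ p (I • w) = 0) :
    0 < fderiv ℝ (fderiv ℝ ρ) p w w + fderiv ℝ (fderiv ℝ ρ) p (I • w) (I • w) := by
  have hρ2 : ContDiff ℝ 2 ρ := hN.contDiff.of_le (two_le_coe hk)
  have h := hN.levi_pos p hp w hw (by
    rw [sum_wirtinger_mul (hρ2.differentiable two_ne_zero), h1, h2]; simp)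
  rw [leviForm_re hρ2] at h
  linarith

end DbarDisk

namespace DbarDisk

open Complex Set Metric MeasureTheory Filter Asymptotics Module

/-! ### Boundary values of `∂f/∂z̄` -/

variable {n : ℕ} {k : ℕ∞} {N : Set (Cn n)} {ρ : Cn n → ℝ} {f : ℂ → Cn n}

lemma differentiableAt_inner_dbar (hf : ContDiffOn ℝ ∞ f disk)
    (hPa : IsAntiholomorphic (dbar f)) (v : Cn n) {z : ℂ} (hz : z ∈ ball (0 : ℂ) 1) :
    DifferentiableAt ℂ (fun z => inner ℂ (dbar f z) v) z := by
  have hz' := ball_subset_disk hz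
  have hP : ContDiffOn ℝ 1 (dbar f) disk := contDiffOn_dbar hf one_add_one_le_infty
  rw [differentiableAt_complex_iff_differentiableAt_real]
  refine ⟨differentiableAt_of_mem_ball one_ne_zero (hP.inner ℂ contDiffOn_const) hz, ?_⟩
  rw [← fderivWithin_disk hz, fderivWithin_inner hP contDiffOn_const hz',
    fderivWithin_inner hP contDiffOn_const hz', hPa z hz, inner_smul_left]
  simp

/-- Each ⟨P, v⟩ is holomorphic inside and continuous up to the circle. If P vanished on the circle,
it would vanish inside, which is the Cauchy–Riemann equation for f. -/
lemma exists_dbar_ne_zero (hf : ContDiffOn ℝ ∞ f disk) (hPa : IsAntiholomorphic (dbar f))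
    (hnot : ¬ DifferentiableOn ℂ f (ball (0 : ℂ) 1)) :
    ∃ z ∈ sphere (0 : ℂ) 1, dbar f z ≠ 0 := by
  by_contra! h
  refine hnot fun z hz => DifferentiableAt.differentiableWithinAt ?_
  have hP : ContinuousOn (dbar f) disk := continuousOn_dbar (hf.of_le (by simp))
  have hz0 : dbar f z = 0 := by
    refine ext_inner_right ℂ fun v => ?_
    have hd : DiffContOnCl ℂ (fun z => inner ℂ (dbar f z) v) (ball (0 : ℂ) 1) :=
      ⟨fun z hz => (differentiableAt_inner_dbar hf hPa v hz).differentiableWithinAt, by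
        rw [closure_ball _ one_ne_zero]; exact hP.inner continuousOn_const⟩
    have := Complex.eqOn_of_eqOn_frontier (g := fun _ => (0 : ℂ)) isBounded_ball hd
      diffContOnCl_const (fun z hz => by
        rw [frontier_ball _ one_ne_zero] at hz
        simp only [h z hz, inner_zero_left]) hz
    rw [inner_zero_left]; exact this
  rw [differentiableAt_complex_iff_differentiableAt_real]
  refine ⟨differentiableAt_of_mem_ball (by simp) hf hz, ?_⟩
  rw [← fderivWithin_disk hz]
  have h1 := two_smul_dbar f z
  rw [hz0, smul_zero] at h1
  have h2 : fderivWithin ℝ f disk z 1 = -(I • fderivWithin ℝ f disk z I) :=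
    eq_neg_of_add_eq_zero_left h1.symm
  rw [h2, smul_neg, smul_smul]
  simp

/-! ### Holomorphic complex tangent fields -/

/-- The field `⟨P, b⟩ c - ⟨P, c⟩ b`, which is orthogonal to `P`. -/
def tangentField (P : ℂ → Cn n) (b c : Cn n) (z : ℂ) : Cn n :=
  inner ℂ (P z) b • c - inner ℂ (P z) c • b

lemma inner_tangentField (P : ℂ → Cn n) (b c : Cn n) (z : ℂ) :
    inner ℂ (P z) (tangentField P b c z) = 0 := by
  rw [tangentField, inner_sub_right, inner_smul_right, inner_smul_right]; ring

lemma tangentField_smul (P : ℂ → Cn n) (b : Cn n) (a : ℂ) (c : Cn n) (z : ℂ) :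
    tangentField P b (a • c) z = a • tangentField P b c z := by
  simp only [tangentField, inner_smul_right]; module

lemma tangentField_add (P : ℂ → Cn n) (b c d : Cn n) (z : ℂ) :
    tangentField P b (c + d) z = tangentField P b c z + tangentField P b d z := by
  simp only [tangentField, inner_add_right]; module

lemma contDiffOn_tangentField (hf : ContDiffOn ℝ ∞ f disk) (b c : Cn n) :
    ContDiffOn ℝ ∞ (tangentField (dbar f) b c) disk := by
  have hP : ContDiffOn ℝ ∞ (dbar f) disk := contDiffOn_dbar hf (by simp)
  exact ((hP.inner ℂ contDiffOn_const).smul contDiffOn_const).sub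
    ((hP.inner ℂ contDiffOn_const).smul contDiffOn_const)

lemma differentiableAt_tangentField (hf : ContDiffOn ℝ ∞ f disk)
    (hPa : IsAntiholomorphic (dbar f)) (b c : Cn n) {z : ℂ} (hz : z ∈ ball (0 : ℂ) 1) :
    DifferentiableAt ℂ (tangentField (dbar f) b c) z :=
  ((differentiableAt_inner_dbar hf hPa b hz).smul_const c).sub
    ((differentiableAt_inner_dbar hf hPa c hz).smul_const b)

lemma fderiv_eq_zero_of_inner_eq_zero (hk : 2 ≤ k) (hN : IsStrictlyPseudoconvex k N ρ)
    (hf : ContDiffOn ℝ ∞ f disk) (hfN : IsDiskIn N f) (hPa : IsAntiholomorphic (dbar f))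
    {μ : ℂ → ℝ} (hμ : ∀ z ∈ sphere (0 : ℂ) 1, ∀ w : Cn n,
      (z * inner ℂ (dbar f z) w).re = μ z * fderiv ℝ ρ (f z) w) {z : ℂ}
    (hz : z ∈ sphere (0 : ℂ) 1) (hP : dbar f z ≠ 0) {w : Cn n}
    (hw : inner ℂ (dbar f z) w = 0) : fderiv ℝ ρ (f z) w = 0 := by
  have h1 := hμ z hz w
  rw [hw, mul_zero, zero_re] at h1
  exact (mul_eq_zero.1 h1.symm).resolve_left
    ((multiplier_nonneg hk hN hf hfN hPa hμ hz).2 hP).ne'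

/-- Where P ≠ 0, orthogonality to P is complex tangency because μ > 0. Where P = 0 the field itself
vanishes, so zeros of P on the circle do no harm. -/
lemma fderiv_tangentField (hk : 2 ≤ k) (hN : IsStrictlyPseudoconvex k N ρ)
    (hf : ContDiffOn ℝ ∞ f disk) (hfN : IsDiskIn N f) (hPa : IsAntiholomorphic (dbar f))
    {μ : ℂ → ℝ} (hμ : ∀ z ∈ sphere (0 : ℂ) 1, ∀ w : Cn n,
      (z * inner ℂ (dbar f z) w).re = μ z * fderiv ℝ ρ (f z) w) (b c : Cn n) {z : ℂ}
    (hz : z ∈ sphere (0 : ℂ) 1) (a : ℂ) :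
    fderiv ℝ ρ (f z) (a • tangentField (dbar f) b c z) = 0 := by
  by_cases hP : dbar f z = 0
  · simp [tangentField, hP]
  · refine fderiv_eq_zero_of_inner_eq_zero hk hN hf hfN hPa hμ hz hP ?_
    rw [inner_smul_right, inner_tangentField, mul_zero]

/-! ### The index form on holomorphic fields -/

lemma dirDeriv_eq_smul {V : ℂ → Cn n} (hV : ContDiffOn ℝ ∞ V disk)
    (hVh : ∀ z ∈ ball (0 : ℂ) 1, DifferentiableAt ℂ V z) {z : ℂ} (hz : z ∈ disk) (v : ℂ) :
    dirDeriv V z v = v • dirDeriv V z 1 := by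
  have hc : ∀ v, ContinuousOn (fun z => dirDeriv V z v) disk := fun v =>
    (contDiffOn_fderivWithin_disk hV one_add_one_le_infty v).continuousOn
  -- The Cauchy–Riemann equation extends from the open disk to the circle by continuity of the
  -- one-sided derivatives.
  have hI : EqOn (fun z => dirDeriv V z I) (fun z => I • dirDeriv V z 1) disk := by
    refine EqOn.of_subset_closure (s := ball (0 : ℂ) 1) (fun z hz => ?_) (hc I)
      ((hc 1).const_smul I) ball_subset_disk (by rw [closure_ball _ one_ne_zero])
    simp only [dirDeriv, fderivWithin_disk hz]
    exact (differentiableAt_complex_iff_differentiableAt_real.1 (hVh z hz)).2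
  obtain ⟨x, y⟩ := v
  have h1 : dirDeriv V z I = I • dirDeriv V z 1 := hI hz
  have h2 : (⟨x, y⟩ : ℂ) = x + y * I := by apply Complex.ext <;> simp
  rw [dirDeriv, map_complex_mk]
  change (x : ℂ) • dirDeriv V z 1 + (y : ℂ) • dirDeriv V z I = _
  rw [h1, h2]
  module

/-- This is the Cauchy–Pompeiu formula for ⟨V, V′⟩: inside, (∂/∂x + i ∂/∂y)⟨V, V′⟩ = 2|V′|² because
V and V′ are holomorphic; on the circle J ∂V/∂θ = −zV′. -/
lemma integral_normSq_holomorphic {V : ℂ → Cn n} (hV : ContDiffOn ℝ ∞ V disk)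
    (hVh : ∀ z ∈ ball (0 : ℂ) 1, DifferentiableAt ℂ V z) :
    (∫ z in ball (0 : ℂ) 1, (‖dirDeriv V z 1‖ ^ 2 + ‖dirDeriv V z I‖ ^ 2))
      + ∫ θ in (0 : ℝ)..2 * Real.pi, inner ℝ
          (I • dirDeriv V (circleMap 0 1 θ) (I * circleMap 0 1 θ)) (V (circleMap 0 1 θ)) = 0 := by
  have hV1 : ContDiffOn ℝ 1 V disk := hV.of_le (by simp)
  set W : ℂ → Cn n := fun z => dirDeriv V z 1 with hW
  have hW1 : ContDiffOn ℝ 1 W disk := contDiffOn_fderivWithin_disk hV one_add_one_le_infty 1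
  have hWI : ∀ z ∈ ball (0 : ℂ) 1, fderivWithin ℝ W disk z I = I • fderivWithin ℝ W disk z 1 := by
    intro z hz
    rw [fderivWithin_disk hz]
    refine (differentiableAt_complex_iff_differentiableAt_real.1 ?_).2
    have hVon : DifferentiableOn ℂ V (ball (0 : ℂ) 1) := fun z hz =>
      (hVh z hz).differentiableWithinAt
    refine ((hVon.deriv isOpen_ball).differentiableAt
      (isOpen_ball.mem_nhds hz)).congr_of_eventuallyEq ?_
    filter_upwards [isOpen_ball.mem_nhds hz] with x hx
    simp only [hW, dirDeriv, fderivWithin_disk hx]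
    rw [(hVh x hx).fderiv_restrictScalars ℝ]
    simp
  have hVv : ∀ z ∈ disk, ∀ v, fderivWithin ℝ V disk z v = v • W z := fun z hz v =>
    dirDeriv_eq_smul hV hVh hz v
  have hp := integral_ball_wirtingerBar (hV1.inner ℂ hW1)
  have h1 : ∫ z in ball (0 : ℂ) 1, (fderivWithin ℝ (fun z => inner ℂ (V z) (W z)) disk z 1
      + I * fderivWithin ℝ (fun z => inner ℂ (V z) (W z)) disk z I)
      = ∫ z in ball (0 : ℂ) 1,
        (((‖dirDeriv V z 1‖ ^ 2 + ‖dirDeriv V z I‖ ^ 2 : ℝ)) : ℂ) := by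
    refine setIntegral_congr_fun measurableSet_ball fun z hz => ?_
    have hz' := ball_subset_disk hz
    have h2 : ‖dirDeriv V z I‖ = ‖W z‖ := by
      change ‖fderivWithin ℝ V disk z I‖ = _
      rw [hVv z hz' I, norm_smul, Complex.norm_I, one_mul]
    have h3 : inner ℂ (W z) (W z) = ((‖W z‖ ^ 2 : ℝ) : ℂ) := by
      simp [inner_self_eq_norm_sq_to_K]
    simp only [fderivWithin_inner hV1 hW1 hz', hWI z hz, hVv z hz', h2]
    rw [one_smul, inner_smul_right, inner_smul_left, h3]
    simp only [conj_I]
    change _ = (((‖W z‖ ^ 2 + ‖W z‖ ^ 2 : ℝ)) : ℂ)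
    push_cast
    linear_combination (inner ℂ (V z) (fderivWithin ℝ W disk z 1) - (‖W z‖ : ℂ) ^ 2) * I_sq
  rw [h1, integral_complex_ofReal] at hp
  have hc : Continuous fun θ : ℝ => circleMap 0 1 θ *
      inner ℂ (V (circleMap 0 1 θ)) (W (circleMap 0 1 θ)) :=
    continuous_comp_circleMap (g := fun z => z * inner ℂ (V z) (W z))
      ((continuousOn_id.mul (hV1.continuousOn.inner hW1.continuousOn)).mono sphere_subset_disk)
  have h4 := congrArg Complex.re hp
  rw [ofReal_re] at h4
  have h5 := intervalIntegral.intervalIntegral_re (𝕜 := ℂ)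
    (hc.intervalIntegrable (μ := volume) 0 (2 * Real.pi))
  rw [h4]
  have h6 : ∀ θ : ℝ, inner ℝ (I • dirDeriv V (circleMap 0 1 θ) (I * circleMap 0 1 θ))
      (V (circleMap 0 1 θ))
      = -(circleMap 0 1 θ * inner ℂ (V (circleMap 0 1 θ)) (W (circleMap 0 1 θ))).re := fun θ => by
    have h7 : I • dirDeriv V (circleMap 0 1 θ) (I * circleMap 0 1 θ)
        = -(circleMap 0 1 θ • W (circleMap 0 1 θ)) := by
      rw [dirDeriv_eq_smul hV hVh (circleMap_mem_disk θ), smul_smul, ← mul_assoc, I_mul_I,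
        neg_one_mul, neg_smul]
    rw [h7, inner_real_eq_re, ← inner_conj_symm, conj_re, inner_neg_right, inner_smul_right, neg_re]
  simp only [h6, intervalIntegral.integral_neg]
  rw [← sub_eq_add_neg, sub_eq_zero]
  exact h5.symm

lemma indexForm_holomorphic {V : ℂ → Cn n} (hV : ContDiffOn ℝ ∞ V disk)
    (hVh : ∀ z ∈ ball (0 : ℂ) 1, DifferentiableAt ℂ V z) :
    indexForm ρ f V = (1 / 2 : ℝ) * ∫ θ in (0 : ℝ)..(2 * Real.pi),
        normalAccel ρ (f (circleMap 0 1 θ)) (V (circleMap 0 1 θ))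
          * normalComponent ρ (f (circleMap 0 1 θ)) (boundaryField f (circleMap 0 1 θ)) := by
  have := integral_normSq_holomorphic hV hVh
  rw [indexForm]
  linear_combination (1 / 2 : ℝ) * this

/-! ### The index estimate -/

lemma norm_fderiv_pos (hN : IsStrictlyPseudoconvex k N ρ) (hfN : IsDiskIn N f) {z : ℂ}
    (hz : z ∈ sphere (0 : ℂ) 1) : 0 < ‖fderiv ℝ ρ (f z)‖ :=
  norm_pos_iff.2 (hN.fderiv_ne_zero _ (hfN.2 hz))

lemma normalComponent_boundaryField (hk : 2 ≤ k) (hN : IsStrictlyPseudoconvex k N ρ)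
    (hf : ContDiffOn ℝ ∞ f disk) (hfN : IsDiskIn N f) (hPa : IsAntiholomorphic (dbar f))
    {μ : ℂ → ℝ} (hμ : ∀ z ∈ sphere (0 : ℂ) 1, ∀ w : Cn n,
      (z * inner ℂ (dbar f z) w).re = μ z * fderiv ℝ ρ (f z) w) {z : ℂ}
    (hz : z ∈ sphere (0 : ℂ) 1) :
    0 ≤ normalComponent ρ (f z) (boundaryField f z) ∧
      (dbar f z ≠ 0 → 0 < normalComponent ρ (f z) (boundaryField f z)) := by
  have hzz : z * (starRingEnd ℂ) z = 1 := by
    rw [Complex.mul_conj, Complex.normSq_eq_norm_sq, mem_sphere_zero_iff_norm.1 hz]; simp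
  have h3 := hμ z hz ((2 * (starRingEnd ℂ) z) • dbar f z)
  rw [inner_smul_right] at h3
  have h4 : z * (2 * (starRingEnd ℂ) z * inner ℂ (dbar f z) (dbar f z))
      = ((2 * ‖dbar f z‖ ^ 2 : ℝ) : ℂ) := by
    have : inner ℂ (dbar f z) (dbar f z) = ((‖dbar f z‖ ^ 2 : ℝ) : ℂ) := by
      simp [inner_self_eq_norm_sq_to_K]
    rw [this]; push_cast
    linear_combination (2 * (‖dbar f z‖ : ℂ) ^ 2) * hzz
  rw [h4, ofReal_re, ← boundaryField_eq] at h3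
  have hpos : dbar f z ≠ 0 → 0 < normalComponent ρ (f z) (boundaryField f z) := fun hP => by
    have hμpos := (multiplier_nonneg hk hN hf hfN hPa hμ hz).2 hP
    have h5 : 0 < 2 * ‖dbar f z‖ ^ 2 := by positivity
    rw [h3] at h5
    exact div_pos (pos_of_mul_pos_right h5 hμpos.le) (norm_fderiv_pos hN hfN hz)
  refine ⟨?_, hpos⟩
  by_cases hP : dbar f z = 0
  · rw [boundaryField_eq, hP, smul_zero, normalComponent, map_zero, zero_div]
  · exact (hpos hP).le

/-- The Morse index of a critical disk that is not holomorphic is at least `n - 1`. -/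
theorem le_morseIndex (hk : 2 ≤ k) (hN : IsStrictlyPseudoconvex k N ρ)
    (hf : ContDiffOn ℝ ∞ f disk) (hfN : IsDiskIn N f) (hcrit : IsDbarCritical k N f)
    (hnot : ¬ DifferentiableOn ℂ f (ball (0 : ℂ) 1)) :
    ((n - 1 : ℕ) : ℕ∞) ≤ morseIndex ρ f := by
  have hPa := hcrit.isAntiholomorphic hN.isOpen hf hfN
  obtain ⟨μ, -, hμ⟩ := exists_multiplier hk hN hf hfN hcrit hPa
  obtain ⟨z₀, hz₀, hb⟩ := exists_dbar_ne_zero hf hPa hnot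
  have hρ2 : ContDiff ℝ 2 ρ := hN.contDiff.of_le (two_le_coe hk)
  set b := dbar f z₀ with hbdef
  -- For c in E the field equals |b|²c at z₀. So c ↦ V_c is injective, and E has complex dimension n
  -- − 1.
  set E := (ℂ ∙ b)ᗮ with hE
  set P := dbar f with hP
  have hPc : ContinuousOn P disk := continuousOn_dbar (hf.of_le (by simp))
  have hfs : ContinuousOn f (sphere 0 1) := hf.continuousOn.mono sphere_subset_disk
  -- the weight in the boundary integral
  set κ : ℂ → ℝ := fun z =>
    normalComponent ρ (f z) (boundaryField f z) / ‖fderiv ℝ ρ (f z)‖ with hκ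
  have hd1 : ContinuousOn (fun z => fderiv ℝ ρ (f z)) (sphere 0 1) :=
    (hρ2.continuous_fderiv two_ne_zero).comp_continuousOn hfs
  have hd2 : ContinuousOn (fun z => fderiv ℝ (fderiv ℝ ρ) (f z)) (sphere 0 1) :=
    ((hρ2.fderiv_right (m := 1) (by norm_num)).continuous_fderiv one_ne_zero).comp_continuousOn hfs
  have hnz : ∀ z ∈ sphere (0 : ℂ) 1, ‖fderiv ℝ ρ (f z)‖ ≠ 0 := fun z hz =>
    (norm_fderiv_pos hN hfN hz).ne'
  have hκc : ContinuousOn κ (sphere 0 1) := by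
    have hbd : ContinuousOn (fun z => (2 * (starRingEnd ℂ) z) • P z) (sphere 0 1) :=
      ((continuous_const.mul Complex.continuous_conj).continuousOn).smul
        (hPc.mono sphere_subset_disk)
    simp only [hκ, normalComponent, boundaryField_eq]
    exact ((hd1.clm_apply hbd).div hd1.norm hnz).div hd1.norm hnz
  have hκ0 : ∀ z ∈ sphere (0 : ℂ) 1, 0 ≤ κ z := fun z hz =>
    div_nonneg (normalComponent_boundaryField hk hN hf hfN hPa hμ hz).1 (norm_nonneg _)
  have hκpos : 0 < κ z₀ :=
    div_pos ((normalComponent_boundaryField hk hN hf hfN hPa hμ hz₀).2 hb)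
      (norm_fderiv_pos hN hfN hz₀)
  have hVc : ∀ c : E, ContinuousOn (tangentField P b (c : Cn n)) (sphere 0 1) := fun c =>
    (contDiffOn_tangentField hf b (c : Cn n)).continuousOn.mono sphere_subset_disk
  -- the bilinear form
  set q : E → E → ℂ → ℝ := fun c d z => κ z * fderiv ℝ (fderiv ℝ ρ) (f z)
    (tangentField P b (c : Cn n) z) (tangentField P b (d : Cn n) z) with hq
  have hqs : ∀ c d, ContinuousOn (q c d) (sphere 0 1) := fun c d =>
    hκc.mul ((hd2.clm_apply (hVc c)).clm_apply (hVc d))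
  have hqi : ∀ c d, IntervalIntegrable (fun θ : ℝ => q c d (circleMap 0 1 θ)) volume 0
      (2 * Real.pi) := fun c d => (continuous_comp_circleMap (hqs c d)).intervalIntegrable _ _
  have hsm : ∀ (a : ℝ) (c : E) z, tangentField P b ((a • c : E) : Cn n) z
      = a • tangentField P b (c : Cn n) z := fun a c z => by
    have : ((a • c : E) : Cn n) = (a : ℂ) • (c : Cn n) := by
      rw [Complex.coe_smul]; rfl
    rw [this, tangentField_smul, Complex.coe_smul]
  let B : E →ₗ[ℝ] E →ₗ[ℝ] ℝ := LinearMap.mk₂ ℝ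
    (fun c d => -(1 / 2) * ∫ θ in (0 : ℝ)..2 * Real.pi, q c d (circleMap 0 1 θ))
    (fun c₁ c₂ d => by
      rw [← mul_add, ← intervalIntegral.integral_add (hqi _ _) (hqi _ _)]
      simp only [hq, Submodule.coe_add, tangentField_add, map_add, add_apply, mul_add])
    (fun a c d => by
      have h : ∀ z, q (a • c) d z = a * q c d z := fun z => by
        simp only [hq, hsm, map_smul, smul_apply, smul_eq_mul]; ring
      simp only [h, intervalIntegral.integral_const_mul, smul_eq_mul]; ring)
    (fun c d₁ d₂ => by
      rw [← mul_add, ← intervalIntegral.integral_add (hqi _ _) (hqi _ _)]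
      simp only [hq, Submodule.coe_add, tangentField_add, map_add, mul_add])
    (fun a c d => by
      have h : ∀ z, q c (a • d) z = a * q c d z := fun z => by
        simp only [hq, hsm, map_smul, smul_eq_mul]; ring
      simp only [h, intervalIntegral.integral_const_mul, smul_eq_mul]; ring)
  have hBdef : ∀ c, B c c = -(1 / 2) * ∫ θ in (0 : ℝ)..2 * Real.pi, q c c (circleMap 0 1 θ) :=
    fun c => rfl
  have hBindex : ∀ c : E, indexForm ρ f (tangentField P b (c : Cn n)) = B c c := fun c => by
    rw [indexForm_holomorphic (contDiffOn_tangentField hf b _)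
      (fun z hz => differentiableAt_tangentField hf hPa b _ hz), hBdef, neg_mul, ← mul_neg,
      ← intervalIntegral.integral_neg]
    congr 2
    funext θ
    simp only [hq, hκ, normalAccel]
    ring
  have hval : ∀ c : E, tangentField P b (c : Cn n) z₀ = ((‖b‖ : ℂ) ^ 2) • (c : Cn n) := fun c => by
    have h1 : inner ℂ b (c : Cn n) = 0 := Submodule.mem_orthogonal_singleton_iff_inner_right.1 c.2
    simp only [tangentField]
    rw [← hbdef, h1, zero_smul, sub_zero, inner_self_eq_norm_sq_to_K]
    rfl
  have hval0 : ∀ c : E, c ≠ 0 → tangentField P b (c : Cn n) z₀ ≠ 0 := fun c hc => by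
    rw [hval]
    refine smul_ne_zero (pow_ne_zero _ (by simpa using hb)) (by simpa using hc)
  -- The field depends complex linearly on c, so replacing c by ic multiplies it by i. The sum then
  -- integrates the positive averaged Hessian against a weight that is nonnegative and positive at
  -- z₀.
  have hBneg : ∀ c ≠ 0, B c c + B (I • c) (I • c) < 0 := by
    intro c hc
    rw [hBdef, hBdef, ← mul_add, ← intervalIntegral.integral_add (hqi _ _) (hqi _ _)]
    have hqI : ∀ z, q c c z + q (I • c) (I • c) z = κ z *
        (fderiv ℝ (fderiv ℝ ρ) (f z) (tangentField P b (c : Cn n) z)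
          (tangentField P b (c : Cn n) z)
        + fderiv ℝ (fderiv ℝ ρ) (f z) (I • tangentField P b (c : Cn n) z)
          (I • tangentField P b (c : Cn n) z)) := fun z => by
      simp only [hq, Submodule.coe_smul, tangentField_smul]
      ring
    have hpos : ∀ z ∈ sphere (0 : ℂ) 1, tangentField P b (c : Cn n) z ≠ 0 →
        0 < fderiv ℝ (fderiv ℝ ρ) (f z) (tangentField P b (c : Cn n) z)
          (tangentField P b (c : Cn n) z)
        + fderiv ℝ (fderiv ℝ ρ) (f z) (I • tangentField P b (c : Cn n) z)
          (I • tangentField P b (c : Cn n) z) := fun z hz h0 => by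
      refine hessian_add_pos hk hN (hfN.2 hz) h0 ?_
        (fderiv_tangentField hk hN hf hfN hPa hμ b _ hz I)
      simpa using fderiv_tangentField hk hN hf hfN hPa hμ b (c : Cn n) hz 1
    have := integral_circle_pos (g := fun z => q c c z + q (I • c) (I • c) z)
      ((hqs c c).add (hqs _ _)) (fun z hz => by
        rw [hqI]
        by_cases h0 : tangentField P b (c : Cn n) z = 0
        · simp [h0]
        · exact mul_nonneg (hκ0 z hz) (hpos z hz h0).le) hz₀ (by
        rw [hqI]; exact mul_pos hκpos (hpos z₀ hz₀ (hval0 c hc)))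
    linarith
  obtain ⟨W, hWf, hWd, hWneg⟩ := exists_negativeDefinite B hBneg
  let Φ : E →ₗ[ℝ] (ℂ → Cn n) :=
    { toFun := fun c => tangentField P b (c : Cn n)
      map_add' := fun c d => by funext z; exact tangentField_add _ _ _ _ _
      map_smul' := fun a c => by funext z; exact hsm a c z }
  have hΦinj : Function.Injective Φ := by
    rw [← LinearMap.ker_eq_bot, LinearMap.ker_eq_bot']
    intro c hc
    by_contra h
    exact hval0 c h (congrFun hc z₀)
  have hfin : finrank ℝ (W.map Φ) = finrank ℝ W :=
    (LinearEquiv.finrank_eq (Submodule.equivMapOfInjective Φ hΦinj W)).symm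
  have hneg : IsNegativeDefiniteOn ρ f (W.map Φ) := by
    rintro V ⟨c, hc, rfl⟩
    refine ⟨⟨contDiffOn_tangentField hf b _, fun z hz => ?_⟩, fun hV => ?_⟩
    · have := fderiv_tangentField hk hN hf hfN hPa hμ b (c : Cn n) hz 1
      rw [one_smul] at this
      exact this
    · have hc0 : c ≠ 0 := fun h => hV (by rw [h, map_zero])
      exact (hBindex c).trans_lt (hWneg c hc hc0)
  have hdim : n - 1 ≤ finrank ℝ (W.map Φ) := by
    rw [hfin]
    refine le_trans ?_ hWd
    have h1 : finrank ℂ (ℂ ∙ b) + finrank ℂ E = finrank ℂ (Cn n) :=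
      Submodule.finrank_add_finrank_orthogonal (𝕜 := ℂ) (ℂ ∙ b)
    have h2 : finrank ℂ (ℂ ∙ b) = 1 := finrank_span_singleton hb
    have h3 : finrank ℂ (Cn n) = n := finrank_euclideanSpace_fin
    omega
  calc ((n - 1 : ℕ) : ℕ∞) ≤ (finrank ℝ (W.map Φ) : ℕ∞) := by exact_mod_cast hdim
    _ ≤ morseIndex ρ f := le_iSup
      (fun W : {W : Submodule ℝ (ℂ → Cn n) // FiniteDimensional ℝ W ∧
        IsNegativeDefiniteOn ρ f W} => (finrank ℝ W.1 : ℕ∞)) ⟨W.map Φ, inferInstance, hneg⟩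

/-- A stable critical disk has Morse index zero. -/
lemma morseIndex_eq_zero_of_stable (hs : IsDbarStable ρ f) : morseIndex ρ f = 0 := by
  rw [morseIndex, ENat.iSup_eq_zero]
  rintro ⟨W, hWf, hW⟩
  have : W = ⊥ := by
    refine (Submodule.eq_bot_iff W).2 fun V hV => ?_
    by_contra h
    exact absurd (hs V (hW V hV).1) (not_le.2 ((hW V hV).2 h))
  simp [this]

end DbarDisk

namespace DbarDisk

open Complex Set Metric MeasureTheory Filter Asymptotics Module

variable {n : ℕ} {k : ℕ∞} {N : Set (Cn n)} {ρ : Cn n → ℝ} {f : ℂ → Cn n}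

/-! ### Fields concentrating at the boundary -/

/-- Each of the m + 1 terms of the geometric sum 1 + r + … + r^m is at least r^m. This makes the
bound for the ∂̄-energy densities uniform in m. -/
lemma succ_mul_pow_mul_one_sub_le {r : ℝ} (h0 : 0 ≤ r) (h1 : r ≤ 1) (m : ℕ) :
    (m + 1) * r ^ m * (1 - r) ≤ 1 := by
  have h2 := geom_sum_mul r (m + 1)
  have h3 : ((m + 1 : ℕ) : ℝ) * r ^ m ≤ ∑ i ∈ Finset.range (m + 1), r ^ i := by
    have := Finset.card_nsmul_le_sum (Finset.range (m + 1)) (fun i => r ^ i) (r ^ m)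
      (fun i hi => pow_le_pow_of_le_one h0 h1 (Nat.lt_succ_iff.1 (Finset.mem_range.1 hi)))
    simpa using this
  have h4 : 0 ≤ r ^ (m + 1) := pow_nonneg h0 _
  push_cast at h3
  nlinarith [mul_le_mul_of_nonneg_right h3 (sub_nonneg.2 h1)]

lemma exists_norm_le_one_sub {Z : ℂ → Cn n} (hZ : ContDiffOn ℝ 1 Z disk)
    (h0 : ∀ z ∈ sphere (0 : ℂ) 1, Z z = 0) :
    ∃ C, 0 ≤ C ∧ ∀ z ∈ disk, ‖Z z‖ ≤ C * (1 - ‖z‖) := by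
  obtain ⟨C, hC⟩ := isCompact_disk.exists_bound_of_continuousOn
    (hZ.continuousOn_fderivWithin uniqueDiffOn_disk le_rfl)
  have hC0 : 0 ≤ C := (norm_nonneg _).trans (hC 0 (by simp))
  refine ⟨C, hC0, fun z hz => ?_⟩
  obtain ⟨u, hu, hzu⟩ : ∃ u ∈ sphere (0 : ℂ) 1, ‖z - u‖ = 1 - ‖z‖ := by
    have hz1 : ‖z‖ ≤ 1 := mem_closedBall_zero_iff.1 hz
    by_cases hz0 : z = 0
    · exact ⟨1, by simp, by simp [hz0]⟩
    · have hzn : (0 : ℝ) < ‖z‖ := norm_pos_iff.2 hz0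
      refine ⟨(‖z‖⁻¹ : ℝ) • z, ?_, ?_⟩
      · rw [mem_sphere_zero_iff_norm, norm_smul, norm_inv, norm_norm, inv_mul_cancel₀ hzn.ne']
      · have h1 : z - (‖z‖⁻¹ : ℝ) • z = (1 - ‖z‖⁻¹ : ℝ) • z := by module
        have h2 : 1 ≤ ‖z‖⁻¹ := (one_le_inv₀ hzn).2 hz1
        rw [h1, norm_smul, Real.norm_of_nonpos (by linarith)]
        field_simp
        ring
  have := convex_disk.norm_image_sub_le_of_norm_fderivWithin_le
    (hZ.differentiableOn one_ne_zero) hC (sphere_subset_disk hu) hz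
  rwa [h0 u hu, sub_zero, hzu] at this

/-- The field `a A + (Im a) Z` with `a = τ z ^ (m + 1)`. -/
def powField (τ : ℂ) (A Z : ℂ → Cn n) (m : ℕ) (z : ℂ) : Cn n :=
  (τ * z ^ (m + 1)) • A z + (τ * z ^ (m + 1)).im • Z z

lemma contDiffOn_powField (τ : ℂ) {A Z : ℂ → Cn n} (hA : ContDiffOn ℝ 1 A disk)
    (hZ : ContDiffOn ℝ 1 Z disk) (m : ℕ) : ContDiffOn ℝ 1 (powField τ A Z m) disk := by
  have ha : ContDiff ℝ 1 fun z : ℂ => τ * z ^ (m + 1) := contDiff_const.mul (contDiff_id.pow _)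
  exact (ha.contDiffOn.smul hA).add ((imCLM.contDiff.comp ha).contDiffOn.smul hZ)

/-- As a is holomorphic, ∂̄ differentiates only A, Z and the factor Im a; the last gives (i/2) times
the conjugate of a′, times Z. This is the only term of size m, and Z vanishing on the circle
compensates for it. -/
lemma norm_dbar_powField_le (τ : ℂ) {A Z : ℂ → Cn n} (hA : ContDiffOn ℝ 1 A disk)
    (hZ : ContDiffOn ℝ 1 Z disk) (m : ℕ) {z : ℂ} (hz : z ∈ ball (0 : ℂ) 1) :
    ‖dbar (powField τ A Z m) z‖ ≤
      ‖τ‖ * ((‖dbar A z‖ + ‖dbar Z z‖) * ‖z‖ ^ (m + 1) + (m + 1) * ‖z‖ ^ m * ‖Z z‖) := by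
  set a : ℂ := τ * z ^ (m + 1) with ha
  set a' : ℂ := τ * ((m + 1) * z ^ m) with ha'
  have hda : HasFDerivAt (fun z : ℂ => τ * z ^ (m + 1))
      ((ContinuousLinearMap.toSpanSingleton ℂ a').restrictScalars ℝ) z := by
    have : HasDerivAt (fun z : ℂ => τ * z ^ (m + 1)) a' z := by
      simpa using (hasDerivAt_pow (m + 1) z).const_mul τ
    exact this.hasFDerivAt.restrictScalars ℝ
  have hdA := (differentiableAt_of_mem_ball one_ne_zero hA hz).hasFDerivAt
  have hdZ := (differentiableAt_of_mem_ball one_ne_zero hZ hz).hasFDerivAt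
  have hd := (hda.smul hdA).add (((imCLM.hasFDerivAt (x := a)).comp z hda).smul hdZ)
  have h1 := two_smul_dbar (powField τ A Z m) z
  have hA2 := two_smul_dbar A z
  have hZ2 := two_smul_dbar Z z
  rw [fderivWithin_disk hz] at h1 hA2 hZ2
  have hv : ∀ v, fderiv ℝ (powField τ A Z m) z v = a • fderiv ℝ A z v + (v * a') • A z
      + (a.im • fderiv ℝ Z z v + (v * a').im • Z z) := fun v => by
    have : fderiv ℝ (powField τ A Z m) z = _ := hd.fderiv
    rw [this]; rfl
  have h2 : (2 : ℂ) • dbar (powField τ A Z m) z = (2 : ℂ) • (a • dbar A z + a.im • dbar Z z)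
      + (a'.im + a'.re * I : ℂ) • Z z := by
    have e1 : (1 * a').im = a'.im := by rw [one_mul]
    have e2 : (I * a').im = a'.re := by simp
    rw [h1, hv, hv, e1, e2]
    simp only [← Complex.coe_smul]
    linear_combination (norm := module) (-a) • hA2 - ((a.im : ℂ)) • hZ2 + a' • (I_sq • A z)
  have h3 : ‖(a'.im + a'.re * I : ℂ)‖ = ‖a'‖ := by
    have : (a'.im + a'.re * I : ℂ) = I * (starRingEnd ℂ) a' := by apply Complex.ext <;> simp
    rw [this, norm_mul, Complex.norm_I, one_mul, RCLike.norm_conj]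
  have h4 : 2 * ‖dbar (powField τ A Z m) z‖
      ≤ 2 * (‖a‖ * ‖dbar A z‖ + ‖a‖ * ‖dbar Z z‖) + ‖a'‖ * ‖Z z‖ := by
    have h5 : 2 * ‖dbar (powField τ A Z m) z‖ = ‖(2 : ℂ) • dbar (powField τ A Z m) z‖ := by
      rw [norm_smul]; simp
    rw [h5, h2]
    refine (norm_add_le _ _).trans (add_le_add ?_ ?_)
    · rw [norm_smul, Complex.norm_ofNat]
      refine mul_le_mul_of_nonneg_left ((norm_add_le _ _).trans ?_) zero_le_two
      rw [norm_smul, norm_smul, Real.norm_eq_abs]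
      gcongr
      exact Complex.abs_im_le_norm a
    · rw [norm_smul, h3]
  have h6 : ‖a‖ = ‖τ‖ * ‖z‖ ^ (m + 1) := by rw [ha, norm_mul, norm_pow]
  have h7 : ‖a'‖ = ‖τ‖ * ((m + 1) * ‖z‖ ^ m) := by
    have : ‖((m : ℂ) + 1)‖ = (m : ℝ) + 1 := by exact_mod_cast Complex.norm_natCast (m + 1)
    rw [ha', norm_mul, norm_mul, norm_pow, this]
  rw [h6, h7] at h4
  have h8 : 0 ≤ ‖τ‖ * ((m + 1) * ‖z‖ ^ m) * ‖Z z‖ := by positivity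
  linarith

/-- If `Z` vanishes on the circle, the `∂̄`-energy of `powField τ A Z m` tends to zero. -/
lemma tendsto_dbarEnergy_powField (τ : ℂ) {A Z : ℂ → Cn n} (hA : ContDiffOn ℝ 1 A disk)
    (hZ : ContDiffOn ℝ 1 Z disk) (h0 : ∀ z ∈ sphere (0 : ℂ) 1, Z z = 0) :
    Tendsto (fun m => dbarEnergy (powField τ A Z m)) atTop (𝓝 0) := by
  obtain ⟨C, hC0, hC⟩ := exists_norm_le_one_sub hZ h0
  obtain ⟨M, hM⟩ := isCompact_disk.exists_bound_of_continuousOn (continuousOn_dbar hA)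
  obtain ⟨M', hM'⟩ := isCompact_disk.exists_bound_of_continuousOn (continuousOn_dbar hZ)
  have hM0 : 0 ≤ M := (norm_nonneg _).trans (hM 0 (by simp))
  have hM0' : 0 ≤ M' := (norm_nonneg _).trans (hM' 0 (by simp))
  have : IsFiniteMeasure (volume.restrict (ball (0 : ℂ) 1)) :=
    ⟨by simp⟩
  have hlim : Tendsto (fun m => ∫ z in ball (0 : ℂ) 1, ‖dbar (powField τ A Z m) z‖ ^ 2) atTop
      (𝓝 (∫ z in ball (0 : ℂ) 1, (0 : ℝ))) := by
    -- Since |Z| ≤ C(1 − |z|), the dangerous term (m + 1)|z|^m |Z| is at most C. Pointwise in the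
    -- open disk every term tends to 0.
    refine tendsto_integral_of_dominated_convergence
      (fun _ => (‖τ‖ * ((M + M') + C)) ^ 2) (fun m => ?_)
      (integrable_const _) (fun m => ?_) ?_
    · exact (((continuousOn_dbar (contDiffOn_powField τ hA hZ m)).mono
        ball_subset_disk).norm.pow 2).aestronglyMeasurable measurableSet_ball
    · refine (ae_restrict_iff' measurableSet_ball).2 (Eventually.of_forall fun z hz => ?_)
      have hz1 : ‖z‖ ≤ 1 := (mem_ball_zero_iff.1 hz).le
      have hz' := ball_subset_disk hz
      rw [Real.norm_of_nonneg (by positivity)]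
      refine pow_le_pow_left₀ (norm_nonneg _)
        ((norm_dbar_powField_le τ hA hZ m hz).trans ?_) 2
      refine mul_le_mul_of_nonneg_left (add_le_add ?_ ?_) (norm_nonneg _)
      · refine (mul_le_of_le_one_right (by positivity)
          (pow_le_one₀ (norm_nonneg _) hz1)).trans (add_le_add (hM z hz') (hM' z hz'))
      · calc (m + 1) * ‖z‖ ^ m * ‖Z z‖ ≤ (m + 1) * ‖z‖ ^ m * (C * (1 - ‖z‖)) := by
              gcongr; exact hC z hz'
          _ = C * ((m + 1) * ‖z‖ ^ m * (1 - ‖z‖)) := by ring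
          _ ≤ C := mul_le_of_le_one_right hC0
              (succ_mul_pow_mul_one_sub_le (norm_nonneg _) hz1 m)
    · refine (ae_restrict_iff' measurableSet_ball).2 (Eventually.of_forall fun z hz => ?_)
      have hz1 : ‖z‖ < 1 := mem_ball_zero_iff.1 hz
      have h1 := tendsto_pow_atTop_nhds_zero_of_lt_one (norm_nonneg z) hz1
      have h2 := tendsto_self_mul_const_pow_of_lt_one (norm_nonneg z) hz1
      have h3 : Tendsto (fun m : ℕ => ‖τ‖ * ((‖dbar A z‖ + ‖dbar Z z‖) * ‖z‖ ^ (m + 1)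
          + (m + 1) * ‖z‖ ^ m * ‖Z z‖)) atTop (𝓝 0) := by
        have := ((((tendsto_add_atTop_iff_nat 1).2 h1).const_mul (‖dbar A z‖ + ‖dbar Z z‖)).add
          ((h2.add h1).mul_const ‖Z z‖)).const_mul ‖τ‖
        simpa [add_mul] using this
      have h4 := squeeze_zero (fun m => norm_nonneg (dbar (powField τ A Z m) z))
        (fun m => norm_dbar_powField_le τ hA hZ m hz) h3
      simpa using h4.pow 2
  simpa [dbarEnergy] using hlim

/-! ### Minimizing disks -/

/-- Summing over v and iv leaves the part of L invariant under J, which scales by |a|². Hence the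
factors z^(m+1) do not affect the boundary term. -/
lemma bilin_smul_add_bilin_smul (L : Cn n →L[ℝ] Cn n →L[ℝ] ℝ) (a : ℂ) (v : Cn n) :
    L (a • v) (a • v) + L (I • a • v) (I • a • v)
      = ‖a‖ ^ 2 * (L v v + L (I • v) (I • v)) := by
  have h1 : a • v = a.re • v + a.im • I • v := by
    conv_lhs => rw [← Complex.re_add_im a]
    simp only [← Complex.coe_smul]
    module
  have h2 : I • a • v = a.re • I • v - a.im • v := by
    rw [h1]
    simp only [← Complex.coe_smul]
    linear_combination (norm := module) (a.im : ℂ) • I_sq • v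
  have h3 : ‖a‖ ^ 2 = a.re ^ 2 + a.im ^ 2 := by
    rw [← Complex.normSq_eq_norm_sq, Complex.normSq_apply]; ring
  rw [h2, h1, h3]
  simp only [map_add, map_sub, map_smul, add_apply, sub_apply, smul_apply, smul_eq_mul]
  ring

lemma exists_ne_zero_inner_eq_zero (hn : 2 ≤ n) (b : Cn n) :
    ∃ c : Cn n, c ≠ 0 ∧ inner ℂ b c = 0 := by
  have h1 : finrank ℂ (ℂ ∙ b) + finrank ℂ (ℂ ∙ b)ᗮ = finrank ℂ (Cn n) :=
    Submodule.finrank_add_finrank_orthogonal (𝕜 := ℂ) (ℂ ∙ b)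
  have h2 : finrank ℂ (ℂ ∙ b) ≤ 1 := by
    simpa using finrank_span_le_card (R := ℂ) ({b} : Set (Cn n))
  have h3 : finrank ℂ (Cn n) = n := finrank_euclideanSpace_fin
  obtain ⟨c, hc, hc0⟩ := Submodule.exists_mem_ne_zero_of_ne_bot
    (p := (ℂ ∙ b)ᗮ) fun h => by rw [h, finrank_bot] at h1; omega
  exact ⟨c, hc0, Submodule.mem_orthogonal_singleton_iff_inner_right.1 hc⟩

/-- Minimizing critical disks are holomorphic. -/
theorem IsDbarMinimizing.differentiableOn (hn : 2 ≤ n) (hk : 2 ≤ k)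
    (hN : IsStrictlyPseudoconvex k N ρ)
    (hf : ContDiffOn ℝ ∞ f disk) (hfN : IsDiskIn N f) (hcrit : IsDbarCritical k N f)
    (hmin : IsDbarMinimizing k N f) : DifferentiableOn ℂ f (ball (0 : ℂ) 1) := by
  by_contra hnot
  have hPa := hcrit.isAntiholomorphic hN.isOpen hf hfN
  obtain ⟨μ, hμc, hμ⟩ := exists_multiplier hk hN hf hfN hcrit hPa
  obtain ⟨z₀, hz₀, hb⟩ := exists_dbar_ne_zero hf hPa hnot
  obtain ⟨c, hc0, hbc⟩ := exists_ne_zero_inner_eq_zero hn (dbar f z₀)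
  set w := tangentField (dbar f) (dbar f z₀) c with hw
  have hρ2 : ContDiff ℝ 2 ρ := hN.contDiff.of_le (two_le_coe hk)
  have hws : ContDiffOn ℝ ∞ w disk := contDiffOn_tangentField hf _ c
  have hwt : ∀ z ∈ sphere (0 : ℂ) 1, ∀ a : ℂ, fderiv ℝ ρ (f z) (a • w z) = 0 := fun z hz a =>
    fderiv_tangentField hk hN hf hfN hPa hμ _ c hz a
  have hw0 : w z₀ ≠ 0 := by
    simp only [hw, tangentField]
    rw [hbc, zero_smul, sub_zero]
    exact smul_ne_zero (inner_self_ne_zero.2 hb) hc0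
  obtain ⟨e, U, hU, hz₀U, -, hvar⟩ := exists_local_variation hk hN hf hfN hz₀
  obtain ⟨r, hr, hrU⟩ := nhds_basis_closedBall.mem_iff.1 (hU.mem_nhds hz₀U)
  let χ : ContDiffBump z₀ := ⟨r / 2, r, by positivity, by linarith⟩
  have hχ0 : ∀ z ∉ closedBall z₀ r, χ z = 0 := fun z hz =>
    χ.zero_of_le_dist (le_of_lt (not_le.1 hz))
  have hχ1 : χ z₀ = 1 := χ.one_of_mem_closedBall (mem_closedBall_self (by positivity))
  -- the corrected velocity and its variation
  set X : (ℂ → ℂ) → ℂ → Cn n := fun a z => a z • χ z • w z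
    - (fderiv ℝ ρ (f z) (a z • χ z • w z) / fderiv ℝ ρ (f z) e) • e with hX
  have hFX : ∀ a : ℂ → ℂ, ContDiff ℝ ∞ a → ∃ F, IsVariation k N f F ∧
      ∀ z ∈ disk, HasDerivAt (fun t => F t z) (X a z) 0 := fun a ha =>
    hvar (fun z => a z • χ z • w z) (ha.contDiffOn.smul (contDiffOn_bump_smul χ hws))
      (closedBall z₀ r) hrU isClosed_closedBall
      (fun z _ hz => by simp only [hχ0 z hz, zero_smul, smul_zero])
  have hX1 : ∀ a : ℂ → ℂ, ContDiff ℝ ∞ a → ContDiffOn ℝ 1 (X a) disk := fun a ha => by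
    obtain ⟨F, hF, hFd⟩ := hFX a ha
    obtain ⟨ε, hε, hFc, -⟩ := hF.exists_contDiffOn hk
    exact contDiffOn_velocity hε hFc hFd
  have hXcirc : ∀ a, ∀ z ∈ sphere (0 : ℂ) 1, X a z = a z • χ z • w z := fun a z hz => by
    have h1 : a z • χ z • w z = (a z * χ z) • w z := by
      rw [← Complex.coe_smul, smul_smul]
    simp only [hX]
    rw [h1, hwt z hz, zero_div, zero_smul, sub_zero]
  set A := X fun _ => 1 with hA
  -- The correction along e makes X only real linear in the factor a, and Z measures the failure of
  -- complex linearity. It vanishes on the circle, where the field is complex tangent and nothing is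
  -- corrected.
  set Z : ℂ → Cn n := fun z => X (fun _ => I) z - I • A z with hZ
  have hA1 : ContDiffOn ℝ 1 A disk := hX1 _ contDiff_const
  have hZ1 : ContDiffOn ℝ 1 Z disk := (hX1 _ contDiff_const).sub (hA1.const_smul I)
  have hZ0 : ∀ z ∈ sphere (0 : ℂ) 1, Z z = 0 := fun z hz => by
    simp only [hZ, hA, hXcirc _ z hz, one_smul, sub_self]
  have hXpow : ∀ τ m, X (fun z => τ * z ^ (m + 1)) = powField τ A Z m := fun τ m => by
    funext z
    set v := χ z • w z with hv
    set a : ℂ := τ * z ^ (m + 1) with ha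
    have h1 : a • v = a.re • v + a.im • I • v := by
      conv_lhs => rw [← Complex.re_add_im a]
      simp only [← Complex.coe_smul]
      module
    have h2 : X (fun z => τ * z ^ (m + 1)) z = a.re • A z + a.im • X (fun _ => I) z := by
      simp only [hX, hA]
      rw [← hv, ← ha, h1, one_smul]
      simp only [map_add, map_smul, smul_eq_mul, add_div, mul_div_assoc]
      module
    rw [h2]
    change _ = a • A z + a.im • (X (fun _ => I) z - I • A z)
    simp only [← Complex.coe_smul]
    linear_combination (norm := module) (Complex.re_add_im a) • A z
  have hpow : ∀ τ m, ∀ z ∈ sphere (0 : ℂ) 1,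
      powField τ A Z m z = (τ * z ^ (m + 1)) • χ z • w z := fun τ m z hz => by
    have h1 := hXcirc (fun z => τ * z ^ (m + 1)) z hz
    rwa [hXpow] at h1
  clear_value Z A X w
  -- the boundary term
  set H : ℂ → Cn n → ℝ := fun z v => fderiv ℝ (fderiv ℝ ρ) (f z) v v with hH
  have hHc : ∀ {v : ℂ → Cn n}, ContinuousOn v (sphere 0 1) →
      ContinuousOn (fun z => H z (v z)) (sphere 0 1) := fun hv =>
    ((((hρ2.fderiv_right (m := 1) (by norm_num)).continuous_fderiv one_ne_zero).comp_continuousOn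
      (hf.continuousOn.mono sphere_subset_disk)).clm_apply hv).clm_apply hv
  have hwc : ContinuousOn w (sphere 0 1) := hws.continuousOn.mono sphere_subset_disk
  set Q : ℂ → ℝ := fun z => μ z * (χ z ^ 2 * (H z (w z) + H z (I • w z))) with hQ
  have hHpos : ∀ z ∈ sphere (0 : ℂ) 1, w z ≠ 0 → 0 < H z (w z) + H z (I • w z) :=
    fun z hz h0 => hessian_add_pos hk hN (hfN.2 hz) h0
      (by simpa only [one_smul] using hwt z hz 1) (hwt z hz I)
  have hQpos : 0 < ∫ θ in (0 : ℝ)..2 * Real.pi, Q (circleMap 0 1 θ) := by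
    refine integral_circle_pos (hμc.mul ((χ.continuous.continuousOn.pow 2).mul
      ((hHc hwc).add (hHc (hwc.const_smul I))))) (fun z hz => ?_) hz₀ ?_
    · refine mul_nonneg (multiplier_nonneg hk hN hf hfN hPa hμ hz).1
        (mul_nonneg (sq_nonneg _) ?_)
      by_cases h0 : w z = 0
      · simp [hH, h0]
      · exact (hHpos z hz h0).le
    · simp only [hQ, hχ1, one_pow, one_mul]
      exact mul_pos ((multiplier_nonneg hk hN hf hfN hPa hμ hz₀).2 hb) (hHpos z₀ hz₀ hw0)
  set T : ℂ → ℕ → ℝ := fun τ m => ∫ θ in (0 : ℝ)..2 * Real.pi, μ (circleMap 0 1 θ) *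
    (-(1 / 2) * H (circleMap 0 1 θ) (powField τ A Z m (circleMap 0 1 θ))) with hT
  have hsecond : ∀ τ m, 0 ≤ T τ m + dbarEnergy (powField τ A Z m) := fun τ m => by
    obtain ⟨F, hF, hFd⟩ := hFX (fun z => τ * z ^ (m + 1)) (contDiff_const.mul (contDiff_id.pow _))
    rw [hXpow] at hFd
    obtain ⟨ε, hε, hFc, hFN⟩ := hF.exists_contDiffOn hk
    refine ge_of_tendsto
      (tendsto_dbarEnergy_second hk hN hf hfN hPa hμc hμ hε hFc hF.1 hFN hFd) ?_
    filter_upwards [(hmin F hF).filter_mono nhdsWithin_le_nhds] with t ht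
    exact div_nonneg (sub_nonneg.2 ht) (sq_nonneg t)
  -- The factors τ = 1 and τ = i give fields that differ by i on the circle, so the two Hessians add
  -- up to the Levi form.
  have hTsum : ∀ m, T 1 m + T I m
      = -(1 / 2) * ∫ θ in (0 : ℝ)..2 * Real.pi, Q (circleMap 0 1 θ) := fun m => by
    have hi : ∀ τ, IntervalIntegrable (fun θ : ℝ => μ (circleMap 0 1 θ) *
        (-(1 / 2) * H (circleMap 0 1 θ) (powField τ A Z m (circleMap 0 1 θ)))) volume 0
        (2 * Real.pi) := fun τ =>
      (continuous_comp_circleMap (g := fun z => μ z * (-(1 / 2) * H z (powField τ A Z m z)))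
        (hμc.mul (continuousOn_const.mul (hHc ((contDiffOn_powField τ hA1 hZ1 m).continuousOn.mono
          sphere_subset_disk))))).intervalIntegrable _ _
    simp only [hT]
    rw [← intervalIntegral.integral_add (hi 1) (hi I), ← intervalIntegral.integral_const_mul]
    refine intervalIntegral.integral_congr fun θ _ => ?_
    have hz := circleMap_mem_sphere_one θ
    generalize circleMap 0 1 θ = z at hz
    have hnorm : ‖z ^ (m + 1) * (χ z : ℂ)‖ ^ 2 = χ z ^ 2 := by
      rw [norm_mul, norm_pow, mem_sphere_zero_iff_norm.1 hz, one_pow, one_mul, Complex.norm_real,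
        Real.norm_eq_abs, sq_abs]
    have h1 : powField 1 A Z m z = (z ^ (m + 1) * (χ z : ℂ)) • w z := by
      rw [hpow 1 m z hz, one_mul, ← Complex.coe_smul, smul_smul]
    have h2 : powField I A Z m z = I • (z ^ (m + 1) * (χ z : ℂ)) • w z := by
      rw [hpow I m z hz, ← Complex.coe_smul, smul_smul, smul_smul, mul_assoc]
    have h3 := bilin_smul_add_bilin_smul (fderiv ℝ (fderiv ℝ ρ) (f z))
      (z ^ (m + 1) * (χ z : ℂ)) (w z)
    rw [hnorm] at h3
    simp only [hQ, hH, h1, h2]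
    linear_combination (-(1 / 2) * μ z) * h3
  have hlim := (tendsto_dbarEnergy_powField 1 hA1 hZ1 hZ0).add
    (tendsto_dbarEnergy_powField I hA1 hZ1 hZ0)
  rw [add_zero] at hlim
  -- Adding the second-order inequalities for τ = 1 and τ = i bounds half the integral of Q by two
  -- energies that tend to 0, whereas that integral is positive and does not depend on m.
  have := ge_of_tendsto' hlim fun m => show
      (1 / 2) * ∫ θ in (0 : ℝ)..2 * Real.pi, Q (circleMap 0 1 θ) ≤ _ by
    linarith [hsecond 1 m, hsecond I m, hTsum m]
  linarith

end DbarDisk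

end

/-! ### The three conclusions -/

theorem theorem1p2 {n : ℕ} {k : ℕ∞} (hk : 2 ≤ k)
    {N : Set (DbarDisk.Cn n)} {ρ : DbarDisk.Cn n → ℝ}
    (hN : DbarDisk.IsStrictlyPseudoconvex k N ρ)
    {f : ℂ → DbarDisk.Cn n} (hf : ContDiffOn ℝ ∞ f DbarDisk.disk)
    (hfN : DbarDisk.IsDiskIn N f) (hcrit : DbarDisk.IsDbarCritical k N f) :
    (¬ DifferentiableOn ℂ f (Metric.ball (0 : ℂ) 1) →
      ((n - 1 : ℕ) : ℕ∞) ≤ DbarDisk.morseIndex ρ f) ∧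
    (2 ≤ n → DbarDisk.IsDbarStable ρ f → DifferentiableOn ℂ f (Metric.ball (0 : ℂ) 1)) ∧
    (2 ≤ n → DbarDisk.IsDbarMinimizing k N f →
      DifferentiableOn ℂ f (Metric.ball (0 : ℂ) 1)) := by
  refine ⟨DbarDisk.le_morseIndex hk hN hf hfN hcrit, fun hn hs => ?_,
    fun hn hm => hm.differentiableOn hn hk hN hf hfN hcrit⟩
  by_contra h
  have h1 := DbarDisk.le_morseIndex hk hN hf hfN hcrit h
  rw [DbarDisk.morseIndex_eq_zero_of_stable hs, nonpos_iff_eq_zero, Nat.cast_eq_zero] at h1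
  -- Index 0 forces n − 1 = 0, impossible for n ≥ 2.
  omega
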